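/- Let $b_n=4^n/\binom{2n}{n}$ for $n\ge 0$. For $N,w\ge 0$ let $\mathsf{CMZV}^N_w\subset\mathbb C$ be the $\mathbb Q$-vector space spanned by the colored multiple zeta values of level $N$ and weight $w$, i.e. by the numbers $$\mathrm{Li}_{\mathbf k}(\mathbf z)=\lim_{M\to\infty}\sum_{M\ge n_1>\cdots>n_r>0}\frac{z_1^{n_1}\cdots z_r^{n_r}}{n_1^{k_1}\cdots n_r^{k_r}}$$ with $r\ge0$, positive integers $k_1,\dots,k_r$ with $k_1+\cdots+k_r=w$, $N$th roots of unity $z_1,\dots,z_r$, and $(k_1,z_1)\ne(1,1)$ if $r\ge 1$ (so $\mathsf{CMZV}^N_0=\mathbb Q$). Put $\mathsf{CMZV}^N_{\le w}=\sum_{k\le w}\mathsf{CMZV}^N_k$, and let $\mathsf{CMZV}^N_{\le w}\otimes\mathbb Q[i]$ denote the $\mathbb Q[i]$-linear span of $\mathsf{CMZV}^N_{\le w}$ in $\mathbb C$. Let $d\ge1$, let $\mathbf s=(s_1,\dots,s_d)$ be positive integers with $s_1\ge3$, $|\mathbf s|=s_1+\cdots+s_d$, and for each $j$ let $l_j(n)$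 be one of the linear forms $2n$, $2n+1$, $2n-1$. Put $\nu(l_1)=1$ if $l_1(n)=2n-1$ and $\nu(l_1)=0$ otherwise. For a choice of relations $\succ_1,\dots,\succ_d$, each of which is $>$ or $\ge$, put $$S(\succ_1,\dots,\succ_d)=\sum_{n_1\succ_1 n_2\succ_2\cdots\succ_{d-1}n_d\succ_d 0}\frac{b_{n_1}^2}{l_1(n_1)^{s_1}\cdots l_d(n_d)^{s_d}},$$ the sum being over nonnegative integers. The standard choice is: $\succ_j$ is $\ge$ if $l_j(n)=2n+1$, and $\succ_j$ is $>$ otherwise; let $S$ denote the series for the standard choice. The chain condition is: whenever $j\ge2$ and $l_j(n)=2n-1$, one has $l_{j-1}(n)\ne2n$. Then all the series below converge absolutely, and: (a) If $l_1(n)\neq 2n-1$ and the chain condition holds, then $S\in\mathsf{CMZV}^4_{|\mathbf s|}$. In particular, this holds if $l_1(n)\ne 2n-1$ and $l_j(n)\ne2n$ for all $j$. If $l_1(n)=2n-1$ and the chain condition holds, then $S\in\mathsf{CMZV}^4_{|\mathbf s|}+\mathsf{CMZV}^4_{|\mathbf s|+1}+\mathsf{CMZV}^4_{|\mathbf s|+2}$.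 (b) In general, $S\in\mathsf{CMZV}^4_{\le|\mathbf s|+2\nu(l_1)}\otimes\mathbb Q[i]$. (c) For every choice of the relations $\succ_1,\dots,\succ_d$ for which the series is defined (that is, no denominator $l_j(n_j)$ vanishes for an index tuple in the range of summation), $S(\succ_1,\dots,\succ_d)\in\mathsf{CMZV}^4_{\le|\mathbf s|+2\nu(l_1)}\otimes\mathbb Q[i]$. -/

import Mathlib

open Filter Topology

noncomputable section

/-- The truncation `∑_{N ≥ n₁ > ⋯ > n_d > 0} z₁^{n₁} ⋯ z_d^{n_d} / (n₁^{s₁} ⋯ n_d^{s_d})`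
of the multiple polylogarithm `Li_s(z)`. -/
def polylogPartial {d : ℕ} (s : Fin d → ℕ) (z : Fin d → ℂ) (N : ℕ) : ℂ :=
  open Classical in
  ∑ n ∈ (Fintype.piFinset fun _ : Fin d => Finset.Icc 1 N).filter StrictAnti,
    ∏ j, z j ^ n j / (n j : ℂ) ^ s j

/-- `v = Li_s(z)` is a colored multiple zeta value of level `N` and weight `w`: `s` is a
composition of `w`, the `z j` are `N`-th roots of unity, `(s₁, z₁) ≠ (1, 1)`, and `v` is the sum of
the series. The series may converge only conditionally, so its sum is the limit of the
truncations. The empty composition gives the value `1` in weight `0`. -/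
def IsCMZV (N w : ℕ) (v : ℂ) : Prop :=
  ∃ (d : ℕ) (s : Fin d → ℕ) (z : Fin d → ℂ),
    (∀ j, 1 ≤ s j) ∧ ∑ j, s j = w ∧ (∀ j, z j ^ N = 1) ∧
    (∀ h : 0 < d, ¬ (s ⟨0, h⟩ = 1 ∧ z ⟨0, h⟩ = 1)) ∧
    Tendsto (polylogPartial s z) atTop (𝓝 v)

/-- The `ℚ`-vector space spanned by the colored multiple zeta values of level `N` and
weight `w`. -/
def CMZV (N w : ℕ) : Submodule ℚ ℂ := Submodule.span ℚ {v | IsCMZV N w v}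

/-- The `ℚ`-vector space spanned by the colored multiple zeta values of level `N` and weight at
most `w`. -/
def CMZVle (N w : ℕ) : Submodule ℚ ℂ := ⨆ k ≤ w, CMZV N k

/-- The `ℚ[i]`-linear span in `ℂ` of the space of colored multiple zeta values of level `N` and
weight at most `w`. -/
def CMZVleGaussian (N w : ℕ) : Submodule (Algebra.adjoin ℚ {Complex.I}) ℂ :=
  Submodule.span (Algebra.adjoin ℚ {Complex.I}) (CMZVle N w : Set ℂ)

/-- The three linear forms `2n`, `2n + 1`, `2n - 1`. -/
inductive ParityForm
  | even
  | oddPlus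
  | oddMinus

/-- The value `l(n)` of a linear form. -/
def ParityForm.eval : ParityForm → ℕ → ℝ
  | .even, n => 2 * (n : ℝ)
  | .oddPlus, n => 2 * (n : ℝ) + 1
  | .oddMinus, n => 2 * (n : ℝ) - 1

/-- `ν(l) = 1` if `l(n) = 2n - 1`, and `ν(l) = 0` otherwise. -/
def ParityForm.nu : ParityForm → ℕ
  | .oddMinus => 1
  | _ => 0

/-- `b_n = 4^n / binom(2n, n)`. -/
def aperyB (n : ℕ) : ℝ := 4 ^ n / (Nat.choose (2 * n) n : ℝ)

/-- The index following `n j` in the sequence `n`, which is continued by `0`. -/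
def nextIndex {d : ℕ} (n : Fin d → ℕ) (j : Fin d) : ℕ :=
  if h : (j : ℕ) + 1 < d then n ⟨(j : ℕ) + 1, h⟩ else 0

/-- The index tuples `n₁ ≻ n₂ ≻ ⋯ ≻ n_d ≻ 0`, where the `j`-th inequality is `>` for `j ∈ S` and
`≥` for `j ∉ S`. -/
def chainSet {d : ℕ} (S : Set (Fin d)) : Set (Fin d → ℕ) :=
  {n | ∀ j, (j ∈ S → nextIndex n j < n j) ∧ (j ∉ S → nextIndex n j ≤ n j)}

/-- The positions of the strict inequalities in the standard pattern attached to `l`: the `j`-th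
inequality is `≥` if `l j` is `2n + 1`, and `>` otherwise. -/
def standardStrict {d : ℕ} (l : Fin d → ParityForm) : Set (Fin d) :=
  {j | l j ≠ ParityForm.oddPlus}

/-- No denominator of the series vanishes. -/
def SeriesDefined {d : ℕ} (l : Fin d → ParityForm) (S : Set (Fin d)) : Prop :=
  ∀ n ∈ chainSet S, ∀ j, (l j).eval (n j) ≠ 0

/-- The summand `b_{n₁}² / (l₁(n₁)^{s₁} ⋯ l_d(n_d)^{s_d})`. -/
def aperySqTerm {d : ℕ} [NeZero d] (s : Fin d → ℕ) (l : Fin d → ParityForm) (n : Fin d → ℕ) : ℝ :=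
  aperyB (n 0) ^ 2 / ∏ j, (l j).eval (n j) ^ s j

/-- The series of the `aperySqTerm s l n` over the tuples `n` of `chainSet S` converges absolutely
and its sum lies in `A`. -/
def AperySqSeriesIn {d : ℕ} [NeZero d] (s : Fin d → ℕ) (l : Fin d → ParityForm) (S : Set (Fin d))
    (A : Set ℂ) : Prop :=
  Summable (fun n : chainSet S => aperySqTerm s l n) ∧
    ((∑' n : chainSet S, aperySqTerm s l n : ℝ) : ℂ) ∈ A

/-- The chain condition: no `2n - 1` immediately follows a `2n` in `l`. -/
def ChainCondition {d : ℕ} (l : Fin d → ParityForm) : Prop :=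
  ∀ j k : Fin d, (k : ℕ) = (j : ℕ) + 1 → l k = ParityForm.oddMinus → l j ≠ ParityForm.even

end

/-! Attach to a nested sum `τ` of weight w over the forms 2n, 2n+1 in the standard pattern the
function G_τ(θ) = ∑ b_n τ(n) sin^{2n} θ. The recurrence (2n+1) b_{n+1} = (2n+2) b_n makes prepending
a factor a differential operation. With A = ∫ G_τ dθ, prepending 1/(2n+1) gives A / (sin θ cos θ)
and prepending 1/(2n) gives A tan θ. Each further power is an integration: against cot θ dθ for G in
the even case, and for G sin θ in the odd case.

Under t = tan(θ/2) the forms i dθ, dθ / sin θ, cot θ dθ and tan θ dθ are rational combinations of dt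
/ (y - t) with y = 0 or y a fourth root of unity. Hence A is i times a rational combination of level
4 polylogarithms in t of weight w + 1 (`IsParitySeq.exists_isAnglePrimitive`). The second factor b_n
comes from the Wallis integral ∫ sin^{2n+1} θ dθ = b_n / (2n+1) over [0, π/2]. Integrating termwise
and applying Abel's theorem at t = 1 expresses the series by colored multiple zeta values. The
factors i pair off, so the coefficients are rational (`sumIn_evenSeq`, `sumIn_oddSeq`).

A form 2n-1 under a strict inequality becomes 2n+1 under a weak one after n ↦ n+1. Under the chain
condition the correction terms only merge powers of 2n+1, so the weight is kept
(`chainSeq_standard_tail`). If 2n-1 comes first, the shift also changes b_n² into b_{n+1}² = (1 +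
1/(2n+1))² b_n², which adds the weights one and two higher.

In general, partial fractions reduce every pattern to series whose head is a product of powers of
two forms over a standard sum (`chainSeq_mem_outerSpan`, `IsParitySeq.mixedIn`). At total head
exponent 3 partial fractions would create divergent pieces. There summation by parts leads to ∑ τ(n)
(π/2 - b_n²/(2n+1)), the integral of G_τ against (1 - sin θ) dθ. This integral carries only one
factor i, which is the source of the Gaussian coefficients (`sumIn_parity`). -/

noncomputable section

/-! ### Nested sums as iterated partial sums -/

/-- The indices `m ≺ n` admitted after the index `n`: `m < n` if `strict`, and `m ≤ n` otherwise. -/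
def indicesBelow (strict : Prop) (n : ℕ) : Finset ℕ :=
  open Classical in if strict then Finset.range n else Finset.range (n + 1)

theorem mem_indicesBelow {p : Prop} {m n : ℕ} :
    m ∈ indicesBelow p n ↔ (p → m < n) ∧ (¬ p → m ≤ n) := by
  unfold indicesBelow
  split_ifs with h <;> simp [h]

/-- The first entry of a tuple of indices, and `0` for the empty tuple. -/
def headIndex {d : ℕ} (n : Fin d → ℕ) : ℕ := if h : 0 < d then n ⟨0, h⟩ else 0

@[simp] theorem headIndex_succ {d : ℕ} (n : Fin (d + 1) → ℕ) : headIndex n = n 0 := by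
  simp [headIndex]

/-- The nested sum `f₀(n) ∑_{n ≻ n₁} f₁(n₁) ∑_{n₁ ≻ n₂} ⋯` over chains ending with `≻ 0`. -/
def chainSeq {R : Type*} [CommSemiring R] : (d : ℕ) → (Fin d → ℕ → R) → Set (Fin d) → ℕ → R
  -- The indicator of `0` plays the terminal index, so the last relation `≻ 0` is imposed in the
  -- same way as the others.
  | 0, _, _ => fun n => if n = 0 then 1 else 0
  | d + 1, f, S => fun n => f 0 n *
      ∑ m ∈ indicesBelow (0 ∈ S) n, chainSeq d (fun j => f j.succ) (Fin.succ ⁻¹' S) m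

theorem chainSeq_succ {R : Type*} [CommSemiring R] {d : ℕ} (f : Fin (d + 1) → ℕ → R)
    (S : Set (Fin (d + 1))) (n : ℕ) : chainSeq (d + 1) f S n = f 0 n *
      ∑ m ∈ indicesBelow (0 ∈ S) n, chainSeq d (fun j => f j.succ) (Fin.succ ⁻¹' S) m := rfl

/-- The chains of `chainSet S` with given first entry. -/
def chainFinset : (d : ℕ) → Set (Fin d) → ℕ → Finset (Fin d → ℕ)
  | 0, _, n => if n = 0 then Finset.univ else ∅
  | d + 1, S, n => ((indicesBelow (0 ∈ S) n).sigma fun m => chainFinset d (Fin.succ ⁻¹' S) m).image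
      fun q => Fin.cons n q.2

theorem nextIndex_zero {d : ℕ} (n : Fin (d + 1) → ℕ) :
    nextIndex n 0 = headIndex (Fin.tail n) := by
  unfold nextIndex headIndex Fin.tail
  by_cases h : 0 < d
  · simp [h]
  · simp [h]

theorem nextIndex_succ {d : ℕ} (n : Fin (d + 1) → ℕ) (j : Fin d) :
    nextIndex n j.succ = nextIndex (Fin.tail n) j := by
  unfold nextIndex Fin.tail
  by_cases h : (j : ℕ) + 1 < d
  · simp [h]
  · simp [h]

theorem mem_chainSet_succ {d : ℕ} {S : Set (Fin (d + 1))} {n : Fin (d + 1) → ℕ} :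
    n ∈ chainSet S ↔ headIndex (Fin.tail n) ∈ indicesBelow (0 ∈ S) (n 0) ∧
      Fin.tail n ∈ chainSet (Fin.succ ⁻¹' S) := by
  simp only [chainSet, Set.mem_ofPred_eq, Fin.forall_fin_succ, nextIndex_zero, nextIndex_succ,
    mem_indicesBelow, Set.mem_preimage]
  rfl

theorem mem_chainFinset {d : ℕ} {S : Set (Fin d)} {N : ℕ} {n : Fin d → ℕ} :
    n ∈ chainFinset d S N ↔ n ∈ chainSet S ∧ headIndex n = N := by
  induction d generalizing N with
  | zero => 
    have : n ∈ chainSet S := fun j => j.elim0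
    simp only [chainFinset, this, headIndex, true_and, lt_self_iff_false, dite_false]
    split_ifs with h
    · simp [h, Subsingleton.elim n default]
      exact Subsingleton.elim _ _
    · simp [eq_comm, h]
  | succ d ih =>
    simp only [chainFinset, Finset.mem_image, Finset.mem_sigma, Sigma.exists, ih,
      mem_chainSet_succ, headIndex_succ]
    constructor
    · rintro ⟨m, q, ⟨hm, hq, rfl⟩, rfl⟩
      simpa [Fin.tail_cons] using ⟨hm, hq⟩
    · rintro ⟨⟨h1, h2⟩, rfl⟩
      exact ⟨_, Fin.tail n, ⟨h1, h2, rfl⟩, Fin.cons_self_tail n⟩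

theorem sum_chainFinset {R : Type*} [CommSemiring R] {d : ℕ} (f : Fin d → ℕ → R) (S : Set (Fin d))
    (N : ℕ) : ∑ n ∈ chainFinset d S N, ∏ j, f j (n j) = chainSeq d f S N := by
  induction d generalizing N with
  | zero => by_cases h : N = 0 <;> simp [chainFinset, chainSeq, h]
  | succ d ih =>
    rw [chainFinset, Finset.sum_image, Finset.sum_sigma, chainSeq_succ, Finset.mul_sum]
    · refine Finset.sum_congr rfl fun m _ => ?_
      simp only [Fin.prod_univ_succ, Fin.cons_zero, Fin.cons_succ]
      rw [← Finset.mul_sum, ih (fun j => f j.succ)]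
    · rintro ⟨m, q⟩ hq ⟨m', q'⟩ hq' h
      have h2 : q = q' := (Fin.cons_injective2 h).2
      subst h2
      simp only [Finset.coe_sigma, Set.mem_sigma_iff, Finset.mem_coe, mem_chainFinset] at hq hq'
      rw [← hq.2.2, ← hq'.2.2]

/-- Only finitely many chains share a first entry, so the sum over chains may be grouped by it once
the grouped sums of absolute values converge. -/
theorem hasSum_chainSet {d : ℕ} (S : Set (Fin d)) (g : (Fin d → ℕ) → ℝ)
    (hg : Summable fun N => ∑ n ∈ chainFinset d S N, |g n|) :
    Summable (fun n : chainSet S => g n) ∧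
      ∑' n : chainSet S, g n = ∑' N, ∑ n ∈ chainFinset d S N, g n := by
  classical
  have hs : Summable fun n : chainSet S => g n := by
    apply Summable.of_abs
    refine summable_of_sum_le (c := ∑' N, ∑ n ∈ chainFinset d S N, |g n|) (fun _ => abs_nonneg _) ?_
    intro u
    let M := u.sup (fun n => headIndex n.1)
    calc ∑ n ∈ u, |g n| = ∑ n ∈ u.map (Function.Embedding.subtype _), |g n| := by simp
      _ ≤ ∑ n ∈ (Finset.range (M + 1)).biUnion (chainFinset d S), |g n| := by
          refine Finset.sum_le_sum_of_subset_of_nonneg ?_ (fun _ _ _ => abs_nonneg _)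
          intro n hn
          simp only [Finset.mem_map, Function.Embedding.subtype_apply] at hn
          obtain ⟨a, ha, rfl⟩ := hn
          simp only [Finset.mem_biUnion, mem_chainFinset, Finset.mem_range, Nat.lt_succ_iff]
          exact ⟨_, Finset.le_sup (f := fun n : chainSet S => headIndex n.1) ha, a.2, rfl⟩
      _ = ∑ N ∈ Finset.range (M + 1), ∑ n ∈ chainFinset d S N, |g n| := by
          rw [Finset.sum_biUnion]
          intro a _ b _ hab
          rw [Function.onFun, Finset.disjoint_left]
          intro n h1 h2
          rw [mem_chainFinset] at h1 h2
          exact hab (h1.2.symm.trans h2.2)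
      _ ≤ _ := hg.sum_le_tsum _ (fun _ _ => Finset.sum_nonneg fun _ _ => abs_nonneg _)
  refine ⟨hs, ?_⟩
  rw [tsum_subtype]
  have h1 : HasSum ((chainSet S).indicator g) (∑' n, (chainSet S).indicator g n) :=
    (summable_subtype_iff_indicator.1 hs).hasSum
  rw [← (h1.tsum_fiberwise headIndex).tsum_eq]
  refine tsum_congr fun N => ?_
  rw [tsum_subtype, ← Finset.tsum_subtype, ]
  rw [show (∑' x : {x // x ∈ chainFinset d S N}, g ↑x) =
    ∑' x : ((chainFinset d S N : Finset _) : Set (Fin d → ℕ)), g x from rfl, tsum_subtype]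
  refine tsum_congr fun n => ?_
  simp only [Set.indicator_apply, Finset.mem_coe, mem_chainFinset, Set.mem_preimage,
    Set.mem_singleton_iff]
  split_ifs <;> simp_all

theorem mem_chainSet_univ {d : ℕ} {n : Fin d → ℕ} :
    n ∈ chainSet Set.univ ↔ StrictAnti n ∧ ∀ j, 0 < n j := by
  constructor
  · intro h
    have h' : ∀ j, nextIndex n j < n j := fun j => (h j).1 trivial
    refine ⟨?_, fun j => (Nat.zero_le _).trans_lt (h' j)⟩
    cases d with
    | zero => exact fun j => j.elim0
    | succ d =>
      refine Fin.strictAnti_iff_succ_lt.2 fun j => ?_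
      have := h' j.castSucc
      simpa [nextIndex, Fin.succ] using this
  · rintro ⟨h1, h2⟩ j
    refine ⟨fun _ => ?_, fun h => absurd trivial h⟩
    unfold nextIndex
    split_ifs with h
    · exact h1 (by simp [Fin.lt_def])
    · exact h2 j

theorem polylogPartial_eq {d : ℕ} (s : Fin d → ℕ) (z : Fin d → ℂ) (N : ℕ) :
    polylogPartial s z N = ∑ n ∈ Finset.range (N + 1),
      chainSeq d (fun j n => z j ^ n / (n : ℂ) ^ s j) Set.univ n := by
  classical
  simp_rw [← sum_chainFinset]
  rw [← Finset.sum_biUnion, polylogPartial]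
  · refine Finset.sum_congr ?_ fun _ _ => rfl
    ext n
    simp only [Finset.mem_filter, Fintype.mem_piFinset, Finset.mem_Icc, Finset.mem_biUnion,
      Finset.mem_range, mem_chainFinset, mem_chainSet_univ, Nat.lt_succ_iff]
    constructor
    · rintro ⟨h1, h2⟩
      refine ⟨headIndex n, ?_, ⟨h2, fun j => (h1 j).1⟩, rfl⟩
      unfold headIndex
      split_ifs
      · exact (h1 _).2
      · simp
    · rintro ⟨m, hm, ⟨h1, h2⟩, rfl⟩
      refine ⟨fun j => ⟨h2 j, le_trans ?_ hm⟩, h1⟩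
      unfold headIndex
      rw [dif_pos j.pos]
      exact h1.antitone (by simp [Fin.le_def])
  · intro a _ b _ hab
    rw [Function.onFun, Finset.disjoint_left]
    intro n h1 h2
    rw [mem_chainFinset] at h1 h2
    exact hab (h1.2.symm.trans h2.2)

/-! ### Polylogarithmic sequences and their sums -/

/-- The sequence `1, 0, 0, …`. -/
def unitSeq {R : Type*} [CommSemiring R] : ℕ → R := fun n => if n = 0 then 1 else 0

/-- The sequence is `O(n ^ (-1/2))`. -/
def SqrtDecay {E : Type*} [Norm E] (c : ℕ → E) : Prop := ∃ C, 0 ≤ C ∧ ∀ n, ‖c n‖ ≤ C / √(n + 1)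

theorem sqrtDecay_unitSeq : SqrtDecay (unitSeq : ℕ → ℂ) := by
  refine ⟨1, zero_le_one, fun n => ?_⟩
  by_cases h : n = 0
  · simp [unitSeq, h]
  · simp only [unitSeq, h, if_false, norm_zero]; positivity

theorem sqrtDecay_unitSeq_real : SqrtDecay (unitSeq : ℕ → ℝ) := by
  refine ⟨1, zero_le_one, fun n => ?_⟩
  by_cases h : n = 0
  · simp [unitSeq, h]
  · simp only [unitSeq, h, if_false, norm_zero]; positivity

theorem sum_one_div_sqrt_le (n : ℕ) : ∑ m ∈ Finset.range n, 1 / √((m : ℝ) + 1) ≤ 2 * √n := by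
  induction n with
  | zero => simp
  | succ n ih =>
    rw [Finset.sum_range_succ]
    have h1 : 0 < √((n : ℝ) + 1) := by positivity
    have h2 := Real.sq_sqrt (show 0 ≤ (n : ℝ) + 1 by positivity)
    have h3 := Real.sq_sqrt (show 0 ≤ (n : ℝ) by positivity)
    have h4 := Real.sqrt_nonneg (n : ℝ)
    -- Comparison of the term with the increment of 2√x; after clearing denominators it is (√(n+1) -
    -- √n)² ≥ 0.
    have h6 : 1 / √((n : ℝ) + 1) ≤ 2 * √((n : ℝ) + 1) - 2 * √n := by
      rw [div_le_iff₀ h1]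
      nlinarith [sq_nonneg (√((n : ℝ) + 1) - √n)]
    push_cast
    linarith

theorem SqrtDecay.exists_norm_sum_le {E : Type*} [SeminormedAddCommGroup E] {c : ℕ → E}
    (h : SqrtDecay c) :
    ∃ C, 0 ≤ C ∧ ∀ n, ‖∑ m ∈ Finset.range n, c m‖ ≤ C * √n := by
  obtain ⟨C, hC, h⟩ := h
  refine ⟨C * 2, by positivity, fun n => ?_⟩
  calc _ ≤ ∑ m ∈ Finset.range n, ‖c m‖ := norm_sum_le _ _
    _ ≤ ∑ m ∈ Finset.range n, C * (1 / √((m : ℝ) + 1)) :=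
        Finset.sum_le_sum fun m _ => (h m).trans_eq (by ring)
    _ ≤ C * (2 * √n) := by
        rw [← Finset.mul_sum]; exact mul_le_mul_of_nonneg_left (sum_one_div_sqrt_le n) hC
    _ = _ := by ring

theorem SqrtDecay.norm_le {E : Type*} [Norm E] {c : ℕ → E} (h : SqrtDecay c) :
    ∃ C, 0 ≤ C ∧ ∀ n, ‖c n‖ ≤ C := by
  obtain ⟨C, hC, h⟩ := h
  refine ⟨C, hC, fun n => (h n).trans (div_le_self hC ?_)⟩
  rw [Real.one_le_sqrt]
  linarith [n.cast_nonneg (α := ℝ)]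

theorem summable_one_div_mul_sqrt : Summable fun n : ℕ => 1 / (((n : ℝ) + 1) * √(n + 1)) := by
  have h := (summable_nat_add_iff 1).2
    (Real.summable_one_div_nat_rpow.2 (show (1 : ℝ) < 3 / 2 by norm_num))
  refine h.congr fun n => ?_
  rw [Real.sqrt_eq_rpow]
  have h0 : (0 : ℝ) < n + 1 := by positivity
  push_cast
  congr 1
  conv_rhs => rw [show (n : ℝ) + 1 = (n + 1 : ℝ) ^ (1 : ℝ) from (Real.rpow_one _).symm]
  rw [← Real.rpow_mul h0.le, ← Real.rpow_add h0]
  norm_num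

/-- Partial sums of an O(n^{-1/2}) sequence are O(n^{1/2}), and a factor O(1/n) restores the rate.
This stability replaces the sharper bounds with powers of logarithms, and the rate is just what
compensates b_n = O(n^{1/2}). -/
theorem sqrtDecay_mul_sum {𝕜 : Type*} [NormedField 𝕜] {c r : ℕ → 𝕜} {D : ℝ} (h : SqrtDecay c)
    (hr : ∀ n, ‖r n‖ ≤ D / (n + 1)) : SqrtDecay fun n => r n * ∑ m ∈ Finset.range n, c m := by
  obtain ⟨C, hC, h⟩ := h.exists_norm_sum_le
  have hD : 0 ≤ D := by simpa using (norm_nonneg _).trans (hr 0)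
  refine ⟨D * C, by positivity, fun n => ?_⟩
  rw [norm_mul]
  have h1 : 0 < √((n : ℝ) + 1) := by positivity
  calc _ ≤ D / (n + 1) * (C * √n) := by gcongr; exacts [hr n, h n]
    _ ≤ D / (n + 1) * (C * √(n + 1)) := by gcongr; linarith
    _ = D * C / √(n + 1) := by
      have h2 := Real.sq_sqrt (show 0 ≤ (n : ℝ) + 1 by positivity)
      have h3 : (n : ℝ) + 1 ≠ 0 := by positivity
      field_simp
      linear_combination D * C * h2

theorem sqrtDecay_mul_sum_of_pos {𝕜 : Type*} [NormedField 𝕜] {c r : ℕ → 𝕜} {D : ℝ}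
    (h : SqrtDecay c) (hr : ∀ n, 0 < n → ‖r n‖ ≤ D / n) (hD : 0 ≤ D) :
    SqrtDecay fun n => r n * ∑ m ∈ Finset.range n, c m := by
  have := sqrtDecay_mul_sum (r := fun n => if n = 0 then 0 else r n) (D := 2 * D) h ?_
  · convert this using 2 with n
    by_cases hn : n = 0 <;> simp [hn]
  · intro n
    by_cases hn : n = 0
    · simp [hn, hD]
    · simp only [hn, if_false]
      have hn' : (1 : ℝ) ≤ n := by exact_mod_cast Nat.one_le_iff_ne_zero.2 hn
      refine (hr n (Nat.pos_of_ne_zero hn)).trans ?_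
      rw [div_le_div_iff₀ (by positivity) (by positivity)]
      nlinarith

/-- The coefficient sequences `n ↦ z₁ⁿ / n^{k₁} ∑_{n > n₂ > ⋯ > 0} z₂^{n₂} / n₂^{k₂} ⋯` of the
multiple polylogarithms of weight `w` at fourth roots of unity. -/
inductive IsPolylogSeq : ℕ → (ℕ → ℂ) → Prop
  | unit : IsPolylogSeq 0 unitSeq
  | cons {w : ℕ} {c : ℕ → ℂ} (k : ℕ) (z : ℂ) (w' : ℕ) : IsPolylogSeq w c → 1 ≤ k → z ^ 4 = 1 →
      w' = w + k → IsPolylogSeq w' fun n => z ^ n / (n : ℂ) ^ k * ∑ m ∈ Finset.range n, c m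

/-- The sequences `IsPolylogSeq` with `(k₁, z₁) ≠ (1, 1)`. -/
inductive IsConvPolylogSeq : ℕ → (ℕ → ℂ) → Prop
  | unit : IsConvPolylogSeq 0 unitSeq
  | cons {w : ℕ} {c : ℕ → ℂ} (k : ℕ) (z : ℂ) (w' : ℕ) : IsPolylogSeq w c → 1 ≤ k → z ^ 4 = 1 →
      w' = w + k → ¬(k = 1 ∧ z = 1) →
      IsConvPolylogSeq w' fun n => z ^ n / (n : ℂ) ^ k * ∑ m ∈ Finset.range n, c m

/-- The rational span of the polylogarithm sequences of weight `w`. -/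
def polylogSpan (w : ℕ) : Submodule ℚ (ℕ → ℂ) := Submodule.span ℚ {c | IsPolylogSeq w c}

/-- The rational span of the convergent polylogarithm sequences of weight `w`. -/
def convPolylogSpan (w : ℕ) : Submodule ℚ (ℕ → ℂ) := Submodule.span ℚ {c | IsConvPolylogSeq w c}

theorem IsConvPolylogSeq.isPolylogSeq {w : ℕ} {c : ℕ → ℂ} (h : IsConvPolylogSeq w c) :
    IsPolylogSeq w c := by
  cases h with
  | unit => exact .unit
  | cons k z _ h hk hz hw _ => exact .cons k z _ h hk hz hw

theorem convPolylogSpan_le (w : ℕ) : convPolylogSpan w ≤ polylogSpan w :=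
  Submodule.span_mono fun _ h => h.isPolylogSeq

theorem norm_eq_one_of_pow_four {z : ℂ} (hz : z ^ 4 = 1) : ‖z‖ = 1 :=
  Complex.norm_eq_one_of_pow_eq_one hz (by norm_num)

theorem IsPolylogSeq.sqrtDecay {w : ℕ} {c : ℕ → ℂ} (h : IsPolylogSeq w c) : SqrtDecay c := by
  induction h with
  | unit => exact sqrtDecay_unitSeq
  | cons k z w' h hk hz hw ih =>
    refine sqrtDecay_mul_sum_of_pos (D := 1) ih (fun n hn => ?_) zero_le_one
    rw [norm_div, norm_pow, norm_pow, norm_eq_one_of_pow_four hz, one_pow, Complex.norm_natCast]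
    have hn' : (1 : ℝ) ≤ n := by exact_mod_cast hn
    gcongr
    exact le_self_pow₀ hn' (by omega)

theorem SqrtDecay.add {c c' : ℕ → ℂ} (h : SqrtDecay c) (h' : SqrtDecay c') : SqrtDecay (c + c') := by
  obtain ⟨C, hC, h⟩ := h
  obtain ⟨C', hC', h'⟩ := h'
  refine ⟨C + C', by positivity, fun n => (norm_add_le _ _).trans ?_⟩
  rw [add_div]
  exact add_le_add (h n) (h' n)

theorem SqrtDecay.smul {c : ℕ → ℂ} (q : ℚ) (h : SqrtDecay c) : SqrtDecay (q • c) := by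
  obtain ⟨C, hC, h⟩ := h
  refine ⟨‖(q : ℂ)‖ * C, by positivity, fun n => ?_⟩
  rw [Pi.smul_apply, Rat.smul_def, norm_mul, mul_div_assoc]
  exact mul_le_mul_of_nonneg_left (h n) (norm_nonneg _)

theorem sqrtDecay_of_mem_polylogSpan {w : ℕ} {c : ℕ → ℂ} (h : c ∈ polylogSpan w) :
    SqrtDecay c := by
  induction h using Submodule.span_induction with
  | mem c h => exact IsPolylogSeq.sqrtDecay h
  | zero => exact ⟨0, le_rfl, by simp⟩
  | add _ _ _ _ h h' => exact h.add h'
  | smul q _ _ h => exact h.smul q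

/-- The twist only changes the outermost root of unity; it converts iterated integral letters into
the arguments of nested sums. -/
theorem IsPolylogSeq.twist {w : ℕ} {c : ℕ → ℂ} (h : IsPolylogSeq w c) {u : ℂ} (hu : u ^ 4 = 1) :
    IsPolylogSeq w fun n => u ^ n * c n := by
  cases h with
  | unit =>
    convert IsPolylogSeq.unit using 2 with n
    by_cases h : n = 0 <;> simp [unitSeq, h]
  | cons k z w' h hk hz hw =>
    convert IsPolylogSeq.cons k (u * z) _ h hk (by rw [mul_pow, hu, hz, one_mul]) hw using 2 with n
    ring

theorem IsPolylogSeq.apply_zero {w : ℕ} {c : ℕ → ℂ} (h : IsPolylogSeq w c) (hw : 1 ≤ w) :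
    c 0 = 0 := by
  cases h with
  | unit => omega
  | cons => simp

theorem apply_zero_of_mem_polylogSpan {w : ℕ} {c : ℕ → ℂ} (h : c ∈ polylogSpan w) (hw : 1 ≤ w) :
    c 0 = 0 := by
  induction h using Submodule.span_induction with
  | mem c h => exact IsPolylogSeq.apply_zero h hw
  | zero => rfl
  | add _ _ _ _ h h' => simp [h, h']
  | smul q _ _ h => simp [h]

/-- The leading exponent becomes at least 2, so the divergent case (k₁, z₁) = (1, 1) cannot occur.
-/
theorem div_mem_convPolylogSpan {w : ℕ} {c : ℕ → ℂ} (h : c ∈ polylogSpan w) (hw : 1 ≤ w) :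
    (fun n => c n / (n : ℂ)) ∈ convPolylogSpan (w + 1) := by
  induction h using Submodule.span_induction with
  | mem c h =>
    refine Submodule.subset_span ?_
    rcases h with _ | ⟨k, z, _, h, hk, hz, hw'⟩
    · omega
    · rw [Set.mem_ofPred_eq]
      convert IsConvPolylogSeq.cons (k + 1) z (w + 1) h (by omega) hz (by omega) (by omega) using 2
      simp only [div_mul_eq_mul_div, div_div, pow_succ]
  | zero =>
    convert (convPolylogSpan (w + 1)).zero_mem using 1
    funext n
    simp
  | add c c' _ _ h h' =>
    convert (convPolylogSpan (w + 1)).add_mem h h' using 1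
    funext n
    simp [add_div]
  | smul q c _ h =>
    convert (convPolylogSpan (w + 1)).smul_mem q h using 1
    funext n
    simp [Rat.smul_def, mul_div_assoc]

/-- The coefficients of `∫ f(t) dt / (y - t)` in terms of those of `f`. -/
def letterSeq (y : ℂ) (c : ℕ → ℂ) : ℕ → ℂ :=
  fun n => (y⁻¹) ^ n / (n : ℂ) ^ 1 * ∑ m ∈ Finset.range n, y ^ m * c m

theorem letterSeq_add (y : ℂ) (c c' : ℕ → ℂ) :
    letterSeq y (c + c') = letterSeq y c + letterSeq y c' := by
  funext n
  simp [letterSeq, mul_add, Finset.sum_add_distrib]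

theorem letterSeq_smul (y : ℂ) (q : ℚ) (c : ℕ → ℂ) :
    letterSeq y (q • c) = q • letterSeq y c := by
  funext n
  simp only [letterSeq, Pi.smul_apply, Rat.smul_def, Finset.mul_sum]
  exact Finset.sum_congr rfl fun _ _ => by ring

theorem letterSeq_zero (y : ℂ) : letterSeq y 0 = 0 := by
  funext n
  simp [letterSeq]

theorem letterSeq_mem_polylogSpan {w : ℕ} {c : ℕ → ℂ} (h : c ∈ polylogSpan w) {y : ℂ}
    (hy : y ^ 4 = 1) : letterSeq y c ∈ polylogSpan (w + 1) := by
  induction h using Submodule.span_induction with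
  | mem c h => exact Submodule.subset_span (.cons 1 y⁻¹ _ (IsPolylogSeq.twist h hy) le_rfl
      (by rw [inv_pow, hy, inv_one]) rfl)
  | zero => rw [letterSeq_zero]; exact Submodule.zero_mem _
  | add _ _ _ _ h h' => rw [letterSeq_add]; exact Submodule.add_mem _ h h'
  | smul q _ _ h => rw [letterSeq_smul]; exact Submodule.smul_mem _ _ h

theorem letterSeq_mem_convPolylogSpan {w : ℕ} {c : ℕ → ℂ} (h : c ∈ polylogSpan w) {y : ℂ}
    (hy : y ^ 4 = 1) (hy1 : y ≠ 1) : letterSeq y c ∈ convPolylogSpan (w + 1) := by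
  induction h using Submodule.span_induction with
  | mem c h => exact Submodule.subset_span (.cons 1 y⁻¹ _ (IsPolylogSeq.twist h hy) le_rfl
      (by rw [inv_pow, hy, inv_one]) rfl (by simpa using hy1))
  | zero => rw [letterSeq_zero]; exact Submodule.zero_mem _
  | add _ _ _ _ h h' => rw [letterSeq_add]; exact Submodule.add_mem _ h h'
  | smul q _ _ h => rw [letterSeq_smul]; exact Submodule.smul_mem _ _ h

theorem indicesBelow_of_true {p : Prop} (h : p) (n : ℕ) : indicesBelow p n = Finset.range n := by
  simp [indicesBelow, h]

theorem indicesBelow_of_false {p : Prop} (h : ¬ p) (n : ℕ) :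
    indicesBelow p n = Finset.range (n + 1) := by
  simp [indicesBelow, h]

theorem chainSeq_polylog_cons {d : ℕ} (s : Fin d → ℕ) (z : Fin d → ℂ) (k : ℕ) (u : ℂ) :
    chainSeq (d + 1) (fun j n => (Fin.cons u z : Fin (d + 1) → ℂ) j ^ n /
      (n : ℂ) ^ (Fin.cons k s : Fin (d + 1) → ℕ) j) Set.univ =
    fun n : ℕ => u ^ n / (n : ℂ) ^ k *
      ∑ m ∈ Finset.range n, chainSeq d (fun j n => z j ^ n / (n : ℂ) ^ s j) Set.univ m := by
  funext n
  rw [chainSeq_succ, indicesBelow_of_true (Set.mem_univ _)]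
  simp

theorem IsPolylogSeq.exists_chainSeq {w : ℕ} {c : ℕ → ℂ} (h : IsPolylogSeq w c) :
    ∃ (d : ℕ) (s : Fin d → ℕ) (z : Fin d → ℂ), (∀ j, 1 ≤ s j) ∧ ∑ j, s j = w ∧ (∀ j, z j ^ 4 = 1) ∧
      c = chainSeq d (fun j n => z j ^ n / (n : ℂ) ^ s j) Set.univ := by
  induction h with
  | unit => exact ⟨0, fun _ => 0, fun _ => 0, fun j => j.elim0, by simp, fun j => j.elim0, rfl⟩
  | cons k u w' h hk hz hw ih =>
    obtain ⟨d, s, z, hs, hsum, hz', rfl⟩ := ih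
    refine ⟨d + 1, Fin.cons k s, Fin.cons u z, ?_, ?_, ?_, (chainSeq_polylog_cons s z k u).symm⟩
    · simpa [Fin.forall_fin_succ] using ⟨hk, hs⟩
    · simp [Fin.sum_univ_succ, hsum, hw, add_comm]
    · simpa [Fin.forall_fin_succ] using ⟨hz, hz'⟩

theorem IsConvPolylogSeq.isCMZV {w : ℕ} {c : ℕ → ℂ} (h : IsConvPolylogSeq w c) {v : ℂ}
    (hv : Tendsto (fun N => ∑ n ∈ Finset.range N, c n) atTop (𝓝 v)) : IsCMZV 4 w v := by
  have hv' := (tendsto_add_atTop_iff_nat 1).2 hv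
  cases h with
  | unit =>
    refine ⟨0, fun _ => 0, fun _ => 0, fun j => j.elim0, by simp, fun j => j.elim0,
      fun h => absurd h (lt_irrefl 0), ?_⟩
    rw [funext (polylogPartial_eq _ _)]
    exact hv'
  | cons k u w' h hk hz hw hne =>
    obtain ⟨d, s, z, hs, hsum, hz', rfl⟩ := h.exists_chainSeq
    refine ⟨d + 1, Fin.cons k s, Fin.cons u z, ?_, ?_, ?_, ?_, ?_⟩
    · simpa [Fin.forall_fin_succ] using ⟨hk, hs⟩
    · simp [Fin.sum_univ_succ, hsum, hw, add_comm]
    · simpa [Fin.forall_fin_succ] using ⟨hz, hz'⟩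
    · intro _
      simpa using hne
    · rw [funext (polylogPartial_eq _ _), chainSeq_polylog_cons]
      exact hv'

/-! ### Convergence of the polylogarithm series at 1. -/

theorem tendsto_one_div_sqrt : Tendsto (fun n : ℕ => 1 / √((n : ℝ) + 1)) atTop (𝓝 0) := by
  have h : Tendsto (fun n : ℕ => √((n : ℝ) + 1)) atTop atTop :=
    Real.tendsto_sqrt_atTop.comp (tendsto_atTop_add_const_right _ _ tendsto_natCast_atTop_atTop)
  simp_rw [one_div]
  exact h.inv_tendsto_atTop

/-- Dirichlet's test for the series `∑ zⁿ aₙ` with `z ≠ 1` and `a` of bounded variation. -/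
theorem exists_tendsto_sum_pow_mul {z : ℂ} (hz : ‖z‖ = 1) (hz1 : z ≠ 1) {a : ℕ → ℂ}
    (ha : Tendsto a atTop (𝓝 0)) (hv : Summable fun n => ‖a (n + 1) - a n‖) :
    ∃ v, Tendsto (fun N => ∑ n ∈ Finset.range N, z ^ n * a n) atTop (𝓝 v) := by
  have hz' : z - 1 ≠ 0 := sub_ne_zero.2 hz1
  have hs : Summable fun n => z ^ (n + 1) * (a (n + 1) - a n) := by
    refine Summable.of_norm (hv.congr fun n => ?_)
    rw [norm_mul, norm_pow, hz, one_pow, one_mul]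
  -- Abel summation: z^n = (z^{n+1} - z^n) / (z - 1), so the differences move onto `a`.
  have key : ∀ N, ∑ n ∈ Finset.range N, z ^ n * a n =
      (z ^ N * a N - a 0 - ∑ n ∈ Finset.range N, z ^ (n + 1) * (a (n + 1) - a n)) / (z - 1) := by
    intro N
    induction N with
    | zero => simp
    | succ N ih =>
      rw [Finset.sum_range_succ, ih, Finset.sum_range_succ]
      field_simp
      ring
  have h0 : Tendsto (fun N => z ^ N * a N) atTop (𝓝 0) := by
    rw [tendsto_zero_iff_norm_tendsto_zero] at ha ⊢
    refine ha.congr fun n => ?_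
    rw [norm_mul, norm_pow, hz, one_pow, one_mul]
  simp_rw [key]
  exact ⟨_, ((h0.sub_const _).sub hs.hasSum.tendsto_sum_nat).div_const _⟩

/-- Leading exponent at least 2 gives absolute convergence with terms O(n^{-3/2}). For exponent 1
the root of unity is not 1, and Dirichlet's test applies to the inner sums divided by n, whose
increments are also O(n^{-3/2}). -/
theorem IsConvPolylogSeq.exists_tendsto {w : ℕ} {c : ℕ → ℂ} (h : IsConvPolylogSeq w c) :
    ∃ v, Tendsto (fun N => ∑ n ∈ Finset.range N, c n) atTop (𝓝 v) := by
  cases h with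
  | unit =>
    refine ⟨1, tendsto_const_nhds.congr' ?_⟩
    filter_upwards [eventually_ge_atTop 1] with N hN
    simp only [unitSeq]
    rw [Finset.sum_ite_eq', if_pos (Finset.mem_range.2 hN)]
  | @cons w c k z w' h hk hz hw hne =>
    have hz1 := norm_eq_one_of_pow_four hz
    obtain ⟨C, hC, hB⟩ := h.sqrtDecay.exists_norm_sum_le
    obtain ⟨C', hC', hB'⟩ := h.sqrtDecay
    by_cases hk2 : 2 ≤ k
    · have : Summable fun n : ℕ => z ^ n / (n : ℂ) ^ k * ∑ m ∈ Finset.range n, c m := by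
        refine (summable_nat_add_iff 1).1 (Summable.of_norm_bounded
          (summable_one_div_mul_sqrt.mul_left C) fun n => ?_)
        rw [norm_mul, norm_div, norm_pow, norm_pow, hz1, one_pow, Complex.norm_natCast]
        push_cast
        have h1 : (1 : ℝ) ≤ n + 1 := by linarith [n.cast_nonneg (α := ℝ)]
        have h2 : ((n : ℝ) + 1) ^ 2 ≤ (n + 1) ^ k := pow_le_pow_right₀ h1 hk2
        have h3 := hB (n + 1)
        push_cast at h3
        calc _ ≤ 1 / ((n : ℝ) + 1) ^ 2 * (C * √(n + 1)) := by gcongr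
          _ = _ := by
            have h4 := Real.sq_sqrt (show 0 ≤ (n : ℝ) + 1 by positivity)
            have h5 : 0 < √((n : ℝ) + 1) := by positivity
            field_simp
            linear_combination C * h4
      exact ⟨_, this.hasSum.tendsto_sum_nat⟩
    · obtain rfl : k = 1 := by omega
      have hz2 : z ≠ 1 := fun h => hne ⟨rfl, h⟩
      have := exists_tendsto_sum_pow_mul hz1 hz2
        (a := fun n => 1 / (n : ℂ) * ∑ m ∈ Finset.range n, c m) ?_ ?_
      · simpa only [pow_one, div_eq_mul_inv, one_mul, mul_assoc] using this
      · rw [tendsto_zero_iff_norm_tendsto_zero]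
        refine squeeze_zero (fun _ => norm_nonneg _) (fun n => ?_)
          (by simpa only [mul_zero] using tendsto_one_div_sqrt.const_mul (2 * C))
        rcases Nat.eq_zero_or_pos n with rfl | hn
        · simp; positivity
        have hn' : (1 : ℝ) ≤ n := by exact_mod_cast hn
        rw [norm_mul, norm_div, norm_one, Complex.norm_natCast]
        have h4 := Real.sq_sqrt (show 0 ≤ (n : ℝ) + 1 by positivity)
        have h5 : 0 < √((n : ℝ) + 1) := by positivity
        have h6 : √(n : ℝ) ≤ √((n : ℝ) + 1) := Real.sqrt_le_sqrt (by linarith)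
        calc _ ≤ 1 / (n : ℝ) * (C * √(n + 1)) := by
              gcongr; exact (hB n).trans (by gcongr)
          _ ≤ 2 * C * (1 / √(n + 1)) := by
              rw [div_mul_eq_mul_div, mul_one_div, div_le_div_iff₀ (by positivity) h5]
              nlinarith
      · refine (summable_nat_add_iff 1).1 (Summable.of_nonneg_of_le (fun _ => norm_nonneg _)
          (fun n => ?_) (summable_one_div_mul_sqrt.mul_left (C' + C)))
        have hn1 : (n : ℂ) + 1 ≠ 0 := by exact_mod_cast n.succ_ne_zero
        have hn2 : (n : ℂ) + 1 + 1 ≠ 0 := by exact_mod_cast (n + 1).succ_ne_zero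
        have e : 1 / (((n + 1 + 1 : ℕ) : ℂ)) * ∑ m ∈ Finset.range (n + 1 + 1), c m -
            1 / (((n + 1 : ℕ) : ℂ)) * ∑ m ∈ Finset.range (n + 1), c m =
            1 / (((n + 1 + 1 : ℕ) : ℂ)) * c (n + 1) - 1 / (((n + 1 + 1 : ℕ) : ℂ)) *
              (1 / (((n + 1 : ℕ) : ℂ)) * ∑ m ∈ Finset.range (n + 1), c m) := by
          rw [Finset.sum_range_succ c (n + 1)]
          push_cast
          field_simp
          ring
        rw [e]
        have h3 := hB (n + 1)
        have h3' := hB' (n + 1)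
        push_cast at h3 h3'
        have h4 := Real.sq_sqrt (show 0 ≤ (n : ℝ) + 1 by positivity)
        have h5 : 0 < √((n : ℝ) + 1) := by positivity
        have h7 : ‖1 / (((n + 1 + 1 : ℕ) : ℂ))‖ ≤ 1 / ((n : ℝ) + 1) := by
          rw [norm_div, norm_one, Complex.norm_natCast]
          push_cast
          gcongr
          linarith
        have h8 : ‖1 / (((n + 1 : ℕ) : ℂ))‖ = 1 / ((n : ℝ) + 1) := by
          rw [norm_div, norm_one, Complex.norm_natCast]
          push_cast
          rfl
        have h9 : ‖c (n + 1)‖ ≤ C' / √((n : ℝ) + 1) := by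
          refine h3'.trans ?_
          gcongr
          linarith
        calc _ ≤ 1 / ((n : ℝ) + 1) * (C' / √((n : ℝ) + 1)) +
              1 / ((n : ℝ) + 1) * (1 / ((n : ℝ) + 1) * (C * √((n : ℝ) + 1))) := by
              refine (norm_sub_le _ _).trans ?_
              rw [norm_mul, norm_mul, norm_mul, h8]
              gcongr
          _ = _ := by
              field_simp
              linear_combination C * h4

theorem exists_tendsto_of_mem_convPolylogSpan {w : ℕ} {c : ℕ → ℂ} (h : c ∈ convPolylogSpan w) :
    ∃ v ∈ CMZV 4 w, Tendsto (fun N => ∑ n ∈ Finset.range N, c n) atTop (𝓝 v) := by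
  induction h using Submodule.span_induction with
  | mem c h =>
    obtain ⟨v, hv⟩ := IsConvPolylogSeq.exists_tendsto h
    exact ⟨v, Submodule.subset_span (IsConvPolylogSeq.isCMZV h hv), hv⟩
  | zero => exact ⟨0, Submodule.zero_mem _, by simp⟩
  | add _ _ _ _ h h' =>
    obtain ⟨v, hv, h⟩ := h
    obtain ⟨v', hv', h'⟩ := h'
    exact ⟨v + v', Submodule.add_mem _ hv hv', by simpa [Finset.sum_add_distrib] using h.add h'⟩
  | smul q _ _ h =>
    obtain ⟨v, hv, h⟩ := h
    refine ⟨q • v, Submodule.smul_mem _ _ hv, ?_⟩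
    simpa [Rat.smul_def, Finset.mul_sum] using h.const_mul (q : ℂ)

/-! ### Power series and their primitives -/

/-- The sum of a power series at a real point. -/
def psum (c : ℕ → ℂ) (t : ℝ) : ℂ := ∑' n, c n * (t : ℂ) ^ n

/-- Linear growth is allowed so that termwise derivatives of series with bounded coefficients are
covered. -/
theorem summable_psum {c : ℕ → ℂ} {C : ℝ} (hc : ∀ n, ‖c n‖ ≤ C * (n + 1)) {t : ℝ} (ht : |t| < 1) :
    Summable fun n => c n * (t : ℂ) ^ n := by
  have h0 : Summable fun n : ℕ => ((n : ℝ) + 1) * |t| ^ n := by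
    have := (summable_pow_mul_geometric_of_norm_lt_one 1 (r := |t|) (by simpa using ht)).add
      (summable_geometric_of_lt_one (abs_nonneg t) ht)
    exact this.congr fun n => by ring
  refine Summable.of_norm_bounded (h0.mul_left C) fun n => ?_
  rw [norm_mul, norm_pow, Complex.norm_real, Real.norm_eq_abs, ← mul_assoc]
  exact mul_le_mul_of_nonneg_right (hc n) (by positivity)

theorem le_mul_succ_of_le {c : ℕ → ℂ} {C : ℝ} (hc : ∀ n, ‖c n‖ ≤ C) (n : ℕ) :
    ‖c n‖ ≤ C * (n + 1) := by
  have := (norm_nonneg _).trans (hc n)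
  nlinarith [hc n, n.cast_nonneg (α := ℝ)]

theorem psum_eq_add {c : ℕ → ℂ} {C : ℝ} (hc : ∀ n, ‖c n‖ ≤ C * (n + 1)) {t : ℝ} (ht : |t| < 1) :
    psum c t = c 0 + t * psum (fun n => c (n + 1)) t := by
  rw [psum, (summable_psum hc ht).tsum_eq_zero_add, psum, ← tsum_mul_left]
  simp only [pow_zero, mul_one, pow_succ]
  congr 1
  exact tsum_congr fun n => by ring

theorem psum_add {c c' : ℕ → ℂ} {C C' : ℝ} (hc : ∀ n, ‖c n‖ ≤ C * (n + 1))
    (hc' : ∀ n, ‖c' n‖ ≤ C' * (n + 1)) {t : ℝ} (ht : |t| < 1) :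
    psum (c + c') t = psum c t + psum c' t := by
  simp only [psum, Pi.add_apply, add_mul]
  exact (summable_psum hc ht).tsum_add (summable_psum hc' ht)

theorem psum_mul_left (a : ℂ) (c : ℕ → ℂ) (t : ℝ) :
    psum (fun n => a * c n) t = a * psum c t := by
  simp only [psum, mul_assoc, tsum_mul_left]

theorem psum_smul (q : ℚ) (c : ℕ → ℂ) (t : ℝ) : psum (q • c) t = q • psum c t := by
  rw [Rat.smul_def, ← psum_mul_left]
  congr 1

theorem psum_zero (t : ℝ) : psum 0 t = 0 := by simp [psum]

theorem hasDerivAt_psum {c : ℕ → ℂ} {C : ℝ} (hc : ∀ n, ‖c n‖ ≤ C) {t : ℝ} (ht : |t| < 1) :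
    HasDerivAt (psum c) (psum (fun n => ((n : ℂ) + 1) * c (n + 1)) t) t := by
  have hC : 0 ≤ C := (norm_nonneg _).trans (hc 0)
  -- The derivative series converges uniformly only on smaller intervals, hence the intermediate
  -- radius.
  obtain ⟨r, htr, hr⟩ := exists_between ht
  have hr0 : 0 < r := (abs_nonneg t).trans_lt htr
  have hsum : Summable fun n : ℕ => C * (n * r ^ (n - 1)) := by
    refine (summable_nat_add_iff 1).1 (Summable.mul_left C ?_)
    have := (summable_pow_mul_geometric_of_norm_lt_one 1 (r := r)
      (by rwa [Real.norm_eq_abs, abs_of_pos hr0])).add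
      (summable_geometric_of_lt_one hr0.le hr)
    exact this.congr fun n => by simp; ring
  have h := hasDerivAt_tsum_of_isPreconnected (𝕜 := ℝ) (t := Set.Ioo (-r) r)
    (g := fun n y => c n * (y : ℂ) ^ n) (g' := fun n y => c n * (n * (y : ℂ) ^ (n - 1)))
    hsum isOpen_Ioo isPreconnected_Ioo ?_ ?_ (y₀ := 0) (by simp [hr0]) ?_ (abs_lt.1 htr)
  · have e : psum (fun n => ((n : ℂ) + 1) * c (n + 1)) t =
        ∑' n : ℕ, c n * (n * (t : ℂ) ^ (n - 1)) := by
      rw [(Summable.of_norm_bounded hsum ?_).tsum_eq_zero_add]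
      · simp only [psum, Nat.cast_zero, zero_mul, mul_zero, zero_add, Nat.add_sub_cancel]
        refine tsum_congr fun n => ?_
        push_cast
        ring
      · intro n
        rw [norm_mul, norm_mul, norm_pow, Complex.norm_real, Complex.norm_natCast,
          Real.norm_eq_abs]
        gcongr
        exact hc n
    rw [e]
    exact h
  · intro n y _
    have := ((hasDerivAt_pow n (y : ℂ)).comp_ofReal).const_mul (c n)
    exact this
  · intro n y hy
    rw [norm_mul, norm_mul, norm_pow, Complex.norm_real, Complex.norm_natCast, Real.norm_eq_abs]
    gcongr
    · exact hc n
    · exact (abs_lt.2 hy).le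
  · exact summable_psum (le_mul_succ_of_le hc) (by simp)

theorem hasDerivAt_psum_div {c : ℕ → ℂ} {C : ℝ} (hc : ∀ n, ‖c n‖ ≤ C) (h0 : c 0 = 0) {t : ℝ}
    (ht : t ∈ Set.Ioo (0 : ℝ) 1) :
    HasDerivAt (psum fun n => c n / (n : ℂ)) (1 / (t : ℂ) * psum c t) t := by
  have ht' : |t| < 1 := by rw [abs_of_pos ht.1]; exact ht.2
  have htc : (t : ℂ) ≠ 0 := by exact_mod_cast ht.1.ne'
  have hb : ∀ n : ℕ, ‖c n / (n : ℂ)‖ ≤ C := by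
    intro n
    rcases Nat.eq_zero_or_pos n with rfl | hn
    · simpa using (norm_nonneg _).trans (hc 0)
    · rw [norm_div, Complex.norm_natCast]
      exact (div_le_self (norm_nonneg _) (by exact_mod_cast hn)).trans (hc n)
  convert hasDerivAt_psum hb ht' using 1
  rw [psum_eq_add (le_mul_succ_of_le hc) ht', h0, zero_add, one_div, inv_mul_cancel_left₀ htc]
  congr 1
  funext n
  have : (n : ℂ) + 1 ≠ 0 := by exact_mod_cast n.succ_ne_zero
  push_cast
  field_simp

theorem hasDerivAt_psum_letterSeq {c : ℕ → ℂ} {C : ℝ} (hc : ∀ n, ‖c n‖ ≤ C) {y : ℂ}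
    (hy : y ^ 4 = 1) {t : ℝ} (ht : |t| < 1) :
    HasDerivAt (psum (letterSeq y c)) (1 / (y - t) * psum c t) t := by
  have hy1 := norm_eq_one_of_pow_four hy
  have hy0 : y ≠ 0 := by
    rintro rfl
    simp at hy1
  have hyt : y - t ≠ 0 := by
    intro h
    rw [sub_eq_zero] at h
    rw [h, Complex.norm_real, Real.norm_eq_abs] at hy1
    exact ht.ne hy1
  have hC : 0 ≤ C := (norm_nonneg _).trans (hc 0)
  have hs : ∀ n : ℕ, ‖∑ m ∈ Finset.range n, y ^ m * c m‖ ≤ C * n := by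
    intro n
    refine (norm_sum_le _ _).trans ?_
    refine (Finset.sum_le_sum (g := fun _ => C) fun m _ => ?_).trans (by simp [mul_comm])
    rw [norm_mul, norm_pow, hy1, one_pow, one_mul]
    exact hc m
  have hb : ∀ n : ℕ, ‖letterSeq y c n‖ ≤ C := by
    intro n
    rcases Nat.eq_zero_or_pos n with rfl | hn
    · simpa [letterSeq] using hC
    · rw [letterSeq, norm_mul, norm_div, norm_pow, norm_pow, norm_inv, hy1, Complex.norm_natCast]
      have hn' : (0 : ℝ) < n := by exact_mod_cast hn
      rw [inv_one, one_pow, pow_one, div_mul_eq_mul_div, one_mul, div_le_iff₀ hn']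
      exact hs n
  -- The coefficients D_n of the derivative satisfy y D_{n+1} - D_n = c_{n+1} and y D_0 = c_0. This
  -- says (y - t) ∑ D_n t^n = ∑ c_n t^n.
  convert hasDerivAt_psum hb ht using 1
  set D : ℕ → ℂ := fun n => ((n : ℂ) + 1) * letterSeq y c (n + 1) with hD
  have hDe : ∀ n, D n = y⁻¹ ^ (n + 1) * ∑ m ∈ Finset.range (n + 1), y ^ m * c m := by
    intro n
    have : (n : ℂ) + 1 ≠ 0 := by exact_mod_cast n.succ_ne_zero
    simp only [hD, letterSeq]
    push_cast
    field_simp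
  have hDb : ∀ n : ℕ, ‖D n‖ ≤ C * (n + 1) := by
    intro n
    rw [hDe, norm_mul, norm_pow, norm_inv, hy1, inv_one, one_pow, one_mul]
    exact_mod_cast hs (n + 1)
  have hDb' : ∀ n : ℕ, ‖D (n + 1)‖ ≤ (2 * C) * (n + 1) := by
    intro n
    refine (hDb _).trans ?_
    push_cast
    nlinarith [n.cast_nonneg (α := ℝ)]
  have hrec : (fun n => c (n + 1)) = fun n => y * D (n + 1) + (-1) * D n := by
    funext n
    rw [hDe, hDe, Finset.sum_range_succ _ (n + 1)]
    rw [inv_pow, inv_pow]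
    field_simp
    ring
  have h0 : c 0 = y * D 0 := by
    rw [hDe]
    simp [hy0]
  have e1 : psum (fun n => c (n + 1)) t =
      y * psum (fun n => D (n + 1)) t + (-1) * psum D t := by
    rw [hrec, ← psum_mul_left, ← psum_mul_left]
    refine psum_add (C := 2 * C) (C' := C) (fun n => ?_) (fun n => ?_) ht
    · rw [norm_mul, hy1, one_mul]; exact hDb' n
    · rw [norm_mul]; simpa using hDb n
  have e2 := psum_eq_add (le_mul_succ_of_le hc) ht
  have e3 := psum_eq_add hDb ht
  rw [e2, e1, h0]
  field_simp
  linear_combination (-y) * e3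

/-- The form `dt / (y - t)` of a letter `y`. -/
def letterForm (y : ℂ) : ℝ → ℂ := fun t => 1 / (y - t)

/-- The forms `dt / (y - t)` with `y = 0` or `y ^ 4 = 1`. -/
def letterForms : Submodule ℚ (ℝ → ℂ) :=
  Submodule.span ℚ {φ | ∃ y : ℂ, (y = 0 ∨ y ^ 4 = 1) ∧ φ = letterForm y}

/-- The forms `dt / (y - t)` with `y = 0` or `y ^ 4 = 1`, and `y ≠ 1`. -/
def convLetterForms : Submodule ℚ (ℝ → ℂ) :=
  Submodule.span ℚ {φ | ∃ y : ℂ, (y = 0 ∨ y ^ 4 = 1) ∧ y ≠ 1 ∧ φ = letterForm y}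

theorem norm_le_of_mem_polylogSpan {w : ℕ} {c : ℕ → ℂ} (h : c ∈ polylogSpan w) :
    ∃ C, ∀ n, ‖c n‖ ≤ C := by
  obtain ⟨C, _, h⟩ := (sqrtDecay_of_mem_polylogSpan h).norm_le
  exact ⟨C, h⟩

theorem hasDerivAt_psum_smul {c : ℕ → ℂ} (q : ℚ) {t : ℝ} {a : ℂ}
    (hd : HasDerivAt (psum c) a t) : HasDerivAt (psum (q • c)) (q • a) t := by
  rw [show psum (q • c) = q • psum c from funext fun x => psum_smul q c x]
  exact hd.const_smul q

/-- Integration against one letter raises the weight by one, and only the letter 1 can spoil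
convergence at t = 1. Positive weight makes the constant term vanish, as the letter 0, with form -dt
/ t, requires. -/
theorem exists_primitive_letter {w : ℕ} {c : ℕ → ℂ} (h : c ∈ polylogSpan w) (hw : 1 ≤ w) {y : ℂ}
    (hy : y = 0 ∨ y ^ 4 = 1) : ∃ c' ∈ polylogSpan (w + 1), (y ≠ 1 → c' ∈ convPolylogSpan (w + 1)) ∧
      ∀ t ∈ Set.Ioo (0 : ℝ) 1, HasDerivAt (psum c') (letterForm y t * psum c t) t := by
  obtain ⟨C, hC⟩ := norm_le_of_mem_polylogSpan h
  rcases hy with rfl | hy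
  · have hm := (convPolylogSpan (w + 1)).smul_mem (-1 : ℚ) (div_mem_convPolylogSpan h hw)
    refine ⟨_, convPolylogSpan_le _ hm, fun _ => hm, fun t ht => ?_⟩
    have := hasDerivAt_psum_smul (-1) (hasDerivAt_psum_div hC (apply_zero_of_mem_polylogSpan h hw) ht)
    exact this.congr_deriv (by simp [letterForm, div_neg])
  · refine ⟨_, letterSeq_mem_polylogSpan h hy, letterSeq_mem_convPolylogSpan h hy, fun t ht => ?_⟩
    exact hasDerivAt_psum_letterSeq hC hy (by rw [abs_of_pos ht.1]; exact ht.2)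

theorem psum_add_of_mem {w w' : ℕ} {c c' : ℕ → ℂ} (h : c ∈ polylogSpan w) (h' : c' ∈ polylogSpan w')
    {t : ℝ} (ht : |t| < 1) : psum (c + c') t = psum c t + psum c' t := by
  obtain ⟨C, hC⟩ := norm_le_of_mem_polylogSpan h
  obtain ⟨C', hC'⟩ := norm_le_of_mem_polylogSpan h'
  exact psum_add (le_mul_succ_of_le hC) (le_mul_succ_of_le hC') ht

theorem hasDerivAt_psum_add {w w' : ℕ} {c c' : ℕ → ℂ} (h : c ∈ polylogSpan w)
    (h' : c' ∈ polylogSpan w') {t : ℝ} (ht : t ∈ Set.Ioo (0 : ℝ) 1) {a a' : ℂ}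
    (hd : HasDerivAt (psum c) a t) (hd' : HasDerivAt (psum c') a' t) :
    HasDerivAt (psum (c + c')) (a + a') t := by
  refine (hd.add hd').congr_of_eventuallyEq ?_
  filter_upwards [isOpen_Ioo.mem_nhds ht] with x hx
  exact psum_add_of_mem h h' (by rw [abs_of_pos hx.1]; exact hx.2)

theorem exists_primitive {w : ℕ} {c : ℕ → ℂ} (h : c ∈ polylogSpan w) (hw : 1 ≤ w) {φ : ℝ → ℂ}
    (hφ : φ ∈ letterForms) : ∃ c' ∈ polylogSpan (w + 1),
      ∀ t ∈ Set.Ioo (0 : ℝ) 1, HasDerivAt (psum c') (φ t * psum c t) t := by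
  induction hφ using Submodule.span_induction with
  | mem φ hφ =>
    obtain ⟨y, hy, rfl⟩ := hφ
    obtain ⟨c', h1, _, h2⟩ := exists_primitive_letter h hw hy
    exact ⟨c', h1, h2⟩
  | zero => exact ⟨0, Submodule.zero_mem _, fun t _ => by
      rw [show psum 0 = fun _ => 0 from funext psum_zero]; simpa using hasDerivAt_const t (0 : ℂ)⟩
  | add _ _ _ _ h1 h2 =>
    obtain ⟨c1, hc1, h1⟩ := h1
    obtain ⟨c2, hc2, h2⟩ := h2
    refine ⟨c1 + c2, Submodule.add_mem _ hc1 hc2, fun t ht => ?_⟩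
    rw [Pi.add_apply, add_mul]
    exact hasDerivAt_psum_add hc1 hc2 ht (h1 t ht) (h2 t ht)
  | smul q _ _ h1 =>
    obtain ⟨c1, hc1, h1⟩ := h1
    refine ⟨q • c1, Submodule.smul_mem _ _ hc1, fun t ht => ?_⟩
    rw [Pi.smul_apply, smul_mul_assoc]
    exact hasDerivAt_psum_smul q (h1 t ht)

theorem exists_conv_primitive {w : ℕ} {c : ℕ → ℂ} (h : c ∈ polylogSpan w) (hw : 1 ≤ w) {φ : ℝ → ℂ}
    (hφ : φ ∈ convLetterForms) : ∃ c' ∈ convPolylogSpan (w + 1),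
      ∀ t ∈ Set.Ioo (0 : ℝ) 1, HasDerivAt (psum c') (φ t * psum c t) t := by
  induction hφ using Submodule.span_induction with
  | mem φ hφ =>
    obtain ⟨y, hy, hy1, rfl⟩ := hφ
    obtain ⟨c', _, h1, h2⟩ := exists_primitive_letter h hw hy
    exact ⟨c', h1 hy1, h2⟩
  | zero => exact ⟨0, Submodule.zero_mem _, fun t _ => by
      rw [show psum 0 = fun _ => 0 from funext psum_zero]; simpa using hasDerivAt_const t (0 : ℂ)⟩
  | add _ _ _ _ h1 h2 =>
    obtain ⟨c1, hc1, h1⟩ := h1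
    obtain ⟨c2, hc2, h2⟩ := h2
    refine ⟨c1 + c2, Submodule.add_mem _ hc1 hc2, fun t ht => ?_⟩
    rw [Pi.add_apply, add_mul]
    exact hasDerivAt_psum_add (convPolylogSpan_le _ hc1) (convPolylogSpan_le _ hc2) ht
      (h1 t ht) (h2 t ht)
  | smul q _ _ h1 =>
    obtain ⟨c1, hc1, h1⟩ := h1
    refine ⟨q • c1, Submodule.smul_mem _ _ hc1, fun t ht => ?_⟩
    rw [Pi.smul_apply, smul_mul_assoc]
    exact hasDerivAt_psum_smul q (h1 t ht)

theorem tendsto_psum_zero {c : ℕ → ℂ} {C : ℝ} (hc : ∀ n, ‖c n‖ ≤ C) (h0 : c 0 = 0) :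
    Tendsto (psum c) (𝓝[>] 0) (𝓝 0) := by
  have h := (hasDerivAt_psum hc (t := 0) (by simp)).continuousAt.tendsto
  have e : psum c 0 = 0 := by
    rw [psum_eq_add (le_mul_succ_of_le hc) (by simp), h0]
    simp
  rw [e] at h
  exact h.mono_left nhdsWithin_le_nhds

theorem tendsto_psum_zero_of_mem {w : ℕ} {c : ℕ → ℂ} (h : c ∈ polylogSpan w) (hw : 1 ≤ w) :
    Tendsto (psum c) (𝓝[>] 0) (𝓝 0) := by
  obtain ⟨C, hC⟩ := norm_le_of_mem_polylogSpan h
  exact tendsto_psum_zero hC (apply_zero_of_mem_polylogSpan h hw)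

/-- Abel's limit theorem: the conditionally convergent sum at 1 is the left limit of the power
series. -/
theorem exists_tendsto_psum_one {w : ℕ} {c : ℕ → ℂ} (h : c ∈ convPolylogSpan w) :
    ∃ v ∈ CMZV 4 w, Tendsto (psum c) (𝓝[<] 1) (𝓝 v) := by
  obtain ⟨v, hv, h⟩ := exists_tendsto_of_mem_convPolylogSpan h
  refine ⟨v, hv, ?_⟩
  have := Complex.tendsto_tsum_powerSeries_nhdsWithin_lt h
  rw [tendsto_map'_iff] at this
  exact this

/-- Primitives are identified by their derivative and their vanishing at 0; this is how generating
functions are matched with polylogarithms. -/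
theorem eqOn_Ioo_of_hasDerivAt {f g φ : ℝ → ℂ}
    (hf : ∀ t ∈ Set.Ioo (0 : ℝ) 1, HasDerivAt f (φ t) t)
    (hg : ∀ t ∈ Set.Ioo (0 : ℝ) 1, HasDerivAt g (φ t) t)
    (hf0 : Tendsto f (𝓝[>] 0) (𝓝 0)) (hg0 : Tendsto g (𝓝[>] 0) (𝓝 0)) :
    Set.EqOn f g (Set.Ioo 0 1) := by
  intro t ht
  have hconst : ∀ x ∈ Set.Ioo (0 : ℝ) 1, (f - g) x = (f - g) t := by
    intro x hx
    refine isOpen_Ioo.is_const_of_deriv_eq_zero isPreconnected_Ioo ?_ ?_ hx ht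
    · exact fun y hy => ((hf y hy).sub (hg y hy)).differentiableAt.differentiableWithinAt
    · intro y hy
      simpa using ((hf y hy).sub (hg y hy)).deriv
  have h1 : Tendsto (f - g) (𝓝[>] 0) (𝓝 ((f - g) t)) := by
    refine tendsto_const_nhds.congr' ?_
    filter_upwards [Ioo_mem_nhdsGT (show (0 : ℝ) < 1 by norm_num)] with x hx
    exact (hconst x hx).symm
  have h2 : Tendsto (f - g) (𝓝[>] 0) (𝓝 0) := by
    have := hf0.sub hg0
    rwa [sub_zero] at this
  exact sub_eq_zero.1 (tendsto_nhds_unique h1 h2)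

/-! ### The half-angle substitution -/

/-- `sin θ` as a function of `t = tan (θ / 2)`. -/
def tanHalfSin (t : ℝ) : ℝ := 2 * t / (1 + t ^ 2)

/-- `cos θ` as a function of `t = tan (θ / 2)`. -/
def tanHalfCos (t : ℝ) : ℝ := (1 - t ^ 2) / (1 + t ^ 2)

/-- `dθ / dt` as a function of `t = tan (θ / 2)`. -/
def tanHalfDeriv (t : ℝ) : ℝ := 2 / (1 + t ^ 2)

theorem one_add_sq_ne_zero (t : ℝ) : 1 + t ^ 2 ≠ 0 := by positivity

theorem tanHalf_sq_add_sq (t : ℝ) : tanHalfSin t ^ 2 + tanHalfCos t ^ 2 = 1 := by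
  have := one_add_sq_ne_zero t
  unfold tanHalfSin tanHalfCos
  field_simp
  ring

theorem hasDerivAt_tanHalfSin (t : ℝ) :
    HasDerivAt tanHalfSin (tanHalfCos t * tanHalfDeriv t) t := by
  have h := one_add_sq_ne_zero t
  have h1 := ((hasDerivAt_id t).const_mul 2).div (((hasDerivAt_id t).pow 2).const_add 1) h
  refine h1.congr_deriv ?_
  unfold tanHalfCos tanHalfDeriv
  simp only [Pi.pow_apply, id]
  field_simp
  ring

theorem hasDerivAt_tanHalfCos (t : ℝ) :
    HasDerivAt tanHalfCos (-tanHalfSin t * tanHalfDeriv t) t := by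
  have h := one_add_sq_ne_zero t
  have h1 := (((hasDerivAt_id t).pow 2).const_sub 1).div (((hasDerivAt_id t).pow 2).const_add 1) h
  refine h1.congr_deriv ?_
  unfold tanHalfSin tanHalfDeriv
  simp only [Pi.pow_apply, id]
  field_simp
  ring

theorem tanHalfSin_pos {t : ℝ} (ht : 0 < t) : 0 < tanHalfSin t := by
  unfold tanHalfSin; positivity

theorem tanHalfSin_nonneg {t : ℝ} (ht : 0 ≤ t) : 0 ≤ tanHalfSin t := by
  unfold tanHalfSin; positivity

theorem tanHalfDeriv_pos (t : ℝ) : 0 < tanHalfDeriv t := by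
  unfold tanHalfDeriv; positivity

theorem tanHalfCos_pos {t : ℝ} (ht : t ∈ Set.Ioo (0 : ℝ) 1) : 0 < tanHalfCos t := by
  have := ht.1
  have := ht.2
  unfold tanHalfCos
  have : 0 < 1 - t ^ 2 := by nlinarith
  positivity

theorem one_sub_tanHalfSin (t : ℝ) : 1 - tanHalfSin t = (1 - t) ^ 2 / (1 + t ^ 2) := by
  have := one_add_sq_ne_zero t
  unfold tanHalfSin
  field_simp
  ring

theorem tanHalfSin_le_one (t : ℝ) : tanHalfSin t ≤ 1 := by
  have : 0 ≤ 1 - tanHalfSin t := by rw [one_sub_tanHalfSin]; positivity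
  linarith

theorem tanHalfSin_sq_lt_one {t : ℝ} (ht : t ∈ Set.Ioo (0 : ℝ) 1) : |tanHalfSin t ^ 2| < 1 := by
  rw [abs_of_nonneg (sq_nonneg _)]
  nlinarith [tanHalf_sq_add_sq t, sq_pos_of_pos (tanHalfCos_pos ht)]

/-! ### The trigonometric differential forms as rational combinations of letters. -/

theorem letterForm_mem {y : ℂ} (hy : y = 0 ∨ y ^ 4 = 1) : letterForm y ∈ letterForms :=
  Submodule.subset_span ⟨y, hy, rfl⟩

theorem letterForm_mem_conv {y : ℂ} (hy : y = 0 ∨ y ^ 4 = 1) (hy1 : y ≠ 1) :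
    letterForm y ∈ convLetterForms :=
  Submodule.subset_span ⟨y, hy, hy1, rfl⟩

theorem convLetterForms_le : convLetterForms ≤ letterForms :=
  Submodule.span_mono fun _ ⟨y, h, _, h'⟩ => ⟨y, h, h'⟩

theorem neg_I_pow_four : (-Complex.I) ^ 4 = 1 := by
  rw [Even.neg_pow (by decide), Complex.I_pow_four]

theorem I_ne_one : Complex.I ≠ 1 := fun h => by simpa using congrArg Complex.re h

theorem neg_I_ne_one : -Complex.I ≠ 1 := fun h => by simpa using congrArg Complex.re h

theorem letterForm_I_mem : letterForm Complex.I ∈ convLetterForms :=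
  letterForm_mem_conv (.inr Complex.I_pow_four) I_ne_one

theorem letterForm_neg_I_mem : letterForm (-Complex.I) ∈ convLetterForms :=
  letterForm_mem_conv (.inr neg_I_pow_four) neg_I_ne_one

theorem letterForm_neg_one_mem : letterForm (-1) ∈ convLetterForms :=
  letterForm_mem_conv (.inr (by norm_num)) (by norm_num)

theorem letterForm_zero_mem : letterForm 0 ∈ convLetterForms :=
  letterForm_mem_conv (.inl rfl) (by norm_num)

theorem letterForm_one_mem : letterForm 1 ∈ letterForms :=
  letterForm_mem (.inr (by norm_num))

theorem one_add_sq_ne_zero_complex (t : ℝ) : 1 + (t : ℂ) ^ 2 ≠ 0 := by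
  exact_mod_cast one_add_sq_ne_zero t

theorem I_sub_ne_zero (t : ℝ) : Complex.I - t ≠ 0 := fun h => by
  simpa using congrArg Complex.im h

theorem neg_I_sub_ne_zero (t : ℝ) : -Complex.I - t ≠ 0 := fun h => by
  simpa using congrArg Complex.im h

theorem letterForm_I_sub (t : ℝ) :
    letterForm Complex.I t - letterForm (-Complex.I) t = -Complex.I * tanHalfDeriv t := by
  have h1 := I_sub_ne_zero t
  have h2 := neg_I_sub_ne_zero t
  have h3 := one_add_sq_ne_zero_complex t
  unfold letterForm tanHalfDeriv
  push_cast
  rw [div_sub_div _ _ h1 h2, mul_div_assoc', div_eq_div_iff (mul_ne_zero h1 h2) h3]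
  linear_combination (-2 * Complex.I) * Complex.I_sq

theorem letterForm_I_add (t : ℝ) :
    letterForm Complex.I t + letterForm (-Complex.I) t = -(2 * t / (1 + t ^ 2) : ℂ) := by
  have h1 := I_sub_ne_zero t
  have h2 := neg_I_sub_ne_zero t
  have h3 := one_add_sq_ne_zero_complex t
  unfold letterForm
  rw [div_add_div _ _ h1 h2, ← neg_div, div_eq_div_iff (mul_ne_zero h1 h2) h3]
  linear_combination (-2 * t) * Complex.I_sq

/-- It is i dθ, not dθ, that is rational in the letters ±i; the powers of i are tracked from here on
in order to keep rational coefficients. -/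
theorem exists_angle_form : ∃ φ ∈ convLetterForms, ∀ t ∈ Set.Ioo (0 : ℝ) 1,
    φ t = Complex.I * tanHalfDeriv t := by
  refine ⟨_, Submodule.sub_mem _ letterForm_neg_I_mem letterForm_I_mem, fun t _ => ?_⟩
  rw [Pi.sub_apply, ← neg_sub, letterForm_I_sub]
  ring

theorem exists_csc_form : ∃ φ ∈ convLetterForms, ∀ t ∈ Set.Ioo (0 : ℝ) 1,
    φ t = tanHalfDeriv t / tanHalfSin t := by
  refine ⟨_, Submodule.neg_mem _ letterForm_zero_mem, fun t ht => ?_⟩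
  have h0 : (t : ℂ) ≠ 0 := by exact_mod_cast ht.1.ne'
  have h3 := one_add_sq_ne_zero_complex t
  simp only [Pi.neg_apply, letterForm, tanHalfDeriv, tanHalfSin]
  push_cast
  field_simp
  ring

theorem exists_cot_form : ∃ φ ∈ convLetterForms, ∀ t ∈ Set.Ioo (0 : ℝ) 1,
    φ t = tanHalfCos t / tanHalfSin t * tanHalfDeriv t := by
  refine ⟨_, Submodule.sub_mem _ (Submodule.add_mem _ letterForm_I_mem letterForm_neg_I_mem)
    letterForm_zero_mem, fun t ht => ?_⟩
  have h0 : (t : ℂ) ≠ 0 := by exact_mod_cast ht.1.ne'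
  have h3 := one_add_sq_ne_zero_complex t
  rw [Pi.sub_apply, Pi.add_apply, letterForm_I_add]
  simp only [letterForm, tanHalfDeriv, tanHalfSin, tanHalfCos]
  push_cast
  field_simp
  ring

/-- The pole of tan θ at θ = π/2 is the letter 1, so primitives against this form may diverge at t =
1. -/
theorem exists_tan_form : ∃ φ ∈ letterForms, ∀ t ∈ Set.Ioo (0 : ℝ) 1,
    φ t = tanHalfSin t / tanHalfCos t * tanHalfDeriv t := by
  refine ⟨_, Submodule.sub_mem _ (Submodule.add_mem _ letterForm_one_mem
    (convLetterForms_le letterForm_neg_one_mem)) (convLetterForms_le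
    (Submodule.add_mem _ letterForm_I_mem letterForm_neg_I_mem)), fun t ht => ?_⟩
  have h1 : (1 : ℂ) - t ≠ 0 := by exact_mod_cast (sub_pos.2 ht.2).ne'
  have h2 : (1 : ℂ) + t ≠ 0 := by exact_mod_cast (add_pos one_pos ht.1).ne'
  have h3 := one_add_sq_ne_zero_complex t
  have h4 : (-1 : ℂ) - t ≠ 0 := by rw [← neg_add']; exact neg_ne_zero.2 h2
  have h5 : (1 : ℂ) - t ^ 2 ≠ 0 := by
    rw [show (1 : ℂ) - t ^ 2 = (1 - t) * (1 + t) by ring]; exact mul_ne_zero h1 h2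
  rw [Pi.sub_apply, Pi.add_apply, Pi.add_apply, letterForm_I_add]
  simp only [letterForm, tanHalfDeriv, tanHalfSin, tanHalfCos]
  push_cast
  rw [show (-1 : ℂ) - t = -(1 + t) by ring]
  field_simp
  ring

theorem exists_csc_sec_form : ∃ φ ∈ letterForms, ∀ t ∈ Set.Ioo (0 : ℝ) 1,
    φ t = tanHalfDeriv t / (tanHalfSin t * tanHalfCos t) := by
  obtain ⟨φ, hφ, h⟩ := exists_tan_form
  obtain ⟨ψ, hψ, h'⟩ := exists_cot_form
  refine ⟨φ + ψ, Submodule.add_mem _ hφ (convLetterForms_le hψ), fun t ht => ?_⟩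
  rw [Pi.add_apply, h t ht, h' t ht]
  have h1 : (tanHalfSin t : ℂ) ≠ 0 := by exact_mod_cast (tanHalfSin_pos ht.1).ne'
  have h2 : (tanHalfCos t : ℂ) ≠ 0 := by exact_mod_cast (tanHalfCos_pos ht).ne'
  have h3 : (tanHalfSin t : ℂ) ^ 2 + tanHalfCos t ^ 2 = 1 := by
    exact_mod_cast tanHalf_sq_add_sq t
  field_simp
  linear_combination (tanHalfDeriv t : ℂ) * h3

/-- The double zero of 1 - sin θ at t = 1 removes the pole of 1 / cos θ, so the letter 1 disappears.
-/
theorem exists_tan_sub_sec_form : ∃ φ ∈ convLetterForms, ∀ t ∈ Set.Ioo (0 : ℝ) 1,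
    φ t = (tanHalfSin t - 1) / tanHalfCos t * tanHalfDeriv t := by
  refine ⟨_, Submodule.sub_mem _ (Submodule.smul_mem _ (2 : ℚ) letterForm_neg_one_mem)
    (Submodule.add_mem _ letterForm_I_mem letterForm_neg_I_mem), fun t ht => ?_⟩
  have h1 : (1 : ℂ) - t ≠ 0 := by exact_mod_cast (sub_pos.2 ht.2).ne'
  have h2 : (1 : ℂ) + t ≠ 0 := by exact_mod_cast (add_pos one_pos ht.1).ne'
  have h3 := one_add_sq_ne_zero_complex t
  have h5 : (1 : ℂ) - t ^ 2 ≠ 0 := by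
    rw [show (1 : ℂ) - t ^ 2 = (1 - t) * (1 + t) by ring]; exact mul_ne_zero h1 h2
  rw [Pi.sub_apply, Pi.add_apply, letterForm_I_add, Pi.smul_apply, Rat.smul_def]
  simp only [letterForm, tanHalfDeriv, tanHalfSin, tanHalfCos]
  push_cast
  rw [show (-1 : ℂ) - t = -(1 + t) by ring]
  field_simp
  ring

/-- The function is cot θ + (sin θ - 1) / cos θ, and both summands are free of the letter 1. -/
theorem exists_csc_sec_sub_sec_form : ∃ φ ∈ convLetterForms, ∀ t ∈ Set.Ioo (0 : ℝ) 1,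
    φ t = (1 - tanHalfSin t) / (tanHalfSin t * tanHalfCos t) * tanHalfDeriv t := by
  obtain ⟨φ, hφ, h⟩ := exists_tan_sub_sec_form
  obtain ⟨ψ, hψ, h'⟩ := exists_cot_form
  refine ⟨φ + ψ, Submodule.add_mem _ hφ hψ, fun t ht => ?_⟩
  rw [Pi.add_apply, h t ht, h' t ht]
  have h1 : (tanHalfSin t : ℂ) ≠ 0 := by exact_mod_cast (tanHalfSin_pos ht.1).ne'
  have h2 : (tanHalfCos t : ℂ) ≠ 0 := by exact_mod_cast (tanHalfCos_pos ht).ne'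
  have h3 : (tanHalfSin t : ℂ) ^ 2 + tanHalfCos t ^ 2 = 1 := by
    exact_mod_cast tanHalf_sq_add_sq t
  field_simp
  linear_combination (tanHalfDeriv t : ℂ) * h3

/-! ### The coefficients `aperyB` -/

theorem aperyB_zero : aperyB 0 = 1 := by simp [aperyB]

theorem aperyB_pos (n : ℕ) : 0 < aperyB n := by
  have : 0 < Nat.choose (2 * n) n := Nat.choose_pos (by omega)
  unfold aperyB
  positivity

theorem aperyB_succ (n : ℕ) : (2 * n + 1) * aperyB (n + 1) = (2 * n + 2) * aperyB n := by
  have h := Nat.succ_mul_centralBinom_succ n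
  rw [Nat.centralBinom, Nat.centralBinom] at h
  have h' : ((n : ℝ) + 1) * (Nat.choose (2 * (n + 1)) (n + 1)) =
    2 * (2 * n + 1) * (Nat.choose (2 * n) n) := by exact_mod_cast h
  have h0 : (0 : ℝ) < Nat.choose (2 * n) n := by exact_mod_cast Nat.choose_pos (by omega)
  have h1 : (0 : ℝ) < Nat.choose (2 * (n + 1)) (n + 1) := by
    exact_mod_cast Nat.choose_pos (by omega)
  unfold aperyB
  rw [pow_succ]
  field_simp
  linear_combination (-2 : ℝ) * h'

/-- The link with the Wallis product yields both the growth b_n = O(√n) and the rate of approach to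
π/2. -/
theorem aperyB_sq_div (n : ℕ) : aperyB n ^ 2 / (2 * n + 1) = Real.Wallis.W n := by
  induction n with
  | zero => simp [aperyB_zero, Real.Wallis.W]
  | succ n ih =>
    rw [Real.Wallis.W_succ, ← ih]
    have h := aperyB_succ n
    have h1 : (2 * (n : ℝ) + 1) ≠ 0 := by positivity
    have h2 : (2 * (n : ℝ) + 3) ≠ 0 := by positivity
    have h' : aperyB (n + 1) = (2 * n + 2) * aperyB n / (2 * n + 1) := by
      rw [eq_div_iff h1, ← h]; ring
    rw [h']
    push_cast
    rw [show 2 * ((n : ℝ) + 1) + 1 = 2 * n + 3 by ring]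
    field_simp

theorem aperyB_le (n : ℕ) : aperyB n ≤ 2 * √(n + 1) := by
  have h := Real.Wallis.W_le n
  rw [← aperyB_sq_div, div_le_iff₀ (by positivity)] at h
  refine abs_le_of_sq_le_sq' ?_ (by positivity) |>.2
  rw [mul_pow, Real.sq_sqrt (by positivity)]
  nlinarith [Real.pi_le_four, n.cast_nonneg (α := ℝ)]

/-! ### The nested sums over `2n` and `2n + 1` -/

/-- `(2n)^{-s} ∑_{m < n} τ(m)`. -/
def evenSeq (s : ℕ) (τ : ℕ → ℝ) (n : ℕ) : ℝ :=
  1 / (2 * (n : ℝ)) ^ s * ∑ m ∈ Finset.range n, τ m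

/-- `(2n + 1)^{-s} ∑_{m ≤ n} τ(m)`. -/
def oddSeq (s : ℕ) (τ : ℕ → ℝ) (n : ℕ) : ℝ :=
  1 / (2 * (n : ℝ) + 1) ^ s * ∑ m ∈ Finset.range (n + 1), τ m

/-- The nested sums of weight `w` over the forms `2n` and `2n + 1` in the standard pattern. -/
inductive IsParitySeq : ℕ → (ℕ → ℝ) → Prop
  | unit : IsParitySeq 0 unitSeq
  | even {w : ℕ} {τ : ℕ → ℝ} (s w' : ℕ) : IsParitySeq w τ → 1 ≤ s → w' = w + s →
      IsParitySeq w' (evenSeq s τ)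
  | odd {w : ℕ} {τ : ℕ → ℝ} (s w' : ℕ) : IsParitySeq w τ → 1 ≤ s → w' = w + s →
      IsParitySeq w' (oddSeq s τ)

theorem IsParitySeq.nonneg {w : ℕ} {τ : ℕ → ℝ} (h : IsParitySeq w τ) (n : ℕ) : 0 ≤ τ n := by
  induction h generalizing n with
  | unit => unfold unitSeq; split_ifs <;> norm_num
  | even s w' h hs hw ih =>
    have := Finset.sum_nonneg fun m (_ : m ∈ Finset.range n) => ih m
    unfold evenSeq
    positivity
  | odd s w' h hs hw ih =>
    have := Finset.sum_nonneg fun m (_ : m ∈ Finset.range (n + 1)) => ih m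
    unfold oddSeq
    positivity

theorem sqrtDecay_evenSeq {τ : ℕ → ℝ} (h : SqrtDecay τ) {s : ℕ} (hs : 1 ≤ s) :
    SqrtDecay (evenSeq s τ) := by
  refine sqrtDecay_mul_sum_of_pos (D := 1) h (fun n hn => ?_) zero_le_one
  have hn' : (1 : ℝ) ≤ n := by exact_mod_cast hn
  rw [Real.norm_of_nonneg (by positivity)]
  refine one_div_le_one_div_of_le (by positivity) ?_
  exact le_trans (by linarith) (le_self_pow₀ (show (1 : ℝ) ≤ 2 * n by linarith) (by omega))

theorem sqrtDecay_oddSeq {τ : ℕ → ℝ} (h : SqrtDecay τ) {s : ℕ} (hs : 1 ≤ s) :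
    SqrtDecay (oddSeq s τ) := by
  obtain ⟨C, hC, h⟩ := h.exists_norm_sum_le
  refine ⟨C, hC, fun n => ?_⟩
  have h0 := n.cast_nonneg (α := ℝ)
  have h1 : (n : ℝ) + 1 ≤ (2 * (n : ℝ) + 1) ^ s :=
    le_trans (by linarith) (le_self_pow₀ (show (1 : ℝ) ≤ 2 * n + 1 by linarith) (by omega))
  have h2 := h (n + 1)
  push_cast at h2
  unfold oddSeq
  rw [norm_mul, Real.norm_of_nonneg (by positivity)]
  have h3 : 0 < √((n : ℝ) + 1) := by positivity
  calc _ ≤ 1 / ((n : ℝ) + 1) * (C * √(n + 1)) := by gcongr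
    _ = _ := by
      have h4 := Real.sq_sqrt (show 0 ≤ (n : ℝ) + 1 by positivity)
      field_simp
      linear_combination C * h4

theorem IsParitySeq.sqrtDecay {w : ℕ} {τ : ℕ → ℝ} (h : IsParitySeq w τ) : SqrtDecay τ := by
  induction h with
  | unit => exact sqrtDecay_unitSeq_real
  | even s w' h hs hw ih => exact sqrtDecay_evenSeq ih hs
  | odd s w' h hs hw ih => exact sqrtDecay_oddSeq ih hs

/-- The coefficients `b_n τ(n)`. -/
def aperyCoeff (τ : ℕ → ℝ) (n : ℕ) : ℂ := (aperyB n * τ n : ℝ)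

theorem SqrtDecay.aperyCoeff_le {τ : ℕ → ℝ} (h : SqrtDecay τ) : ∃ C, ∀ n, ‖aperyCoeff τ n‖ ≤ C := by
  obtain ⟨C, hC, h⟩ := h
  refine ⟨2 * C, fun n => ?_⟩
  have h1 : 0 < √((n : ℝ) + 1) := by positivity
  rw [aperyCoeff, Complex.norm_real, norm_mul, Real.norm_of_nonneg (aperyB_pos n).le]
  calc _ ≤ 2 * √(n + 1) * (C / √(n + 1)) := by
        have := aperyB_le n
        gcongr
        exact h n
    _ = _ := by field_simp

/-- The generating function `∑ b_n τ(n) x ^ (2n)` at `x = 2t / (1 + t²)`. -/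
def aperyGen (τ : ℕ → ℝ) (t : ℝ) : ℂ := psum (aperyCoeff τ) (tanHalfSin t ^ 2)

theorem hasDerivAt_psum_sin_sq {c : ℕ → ℂ} {C : ℝ} (hc : ∀ n, ‖c n‖ ≤ C) {t : ℝ}
    (ht : t ∈ Set.Ioo (0 : ℝ) 1) : HasDerivAt (fun t => psum c (tanHalfSin t ^ 2))
      (2 * tanHalfSin t * tanHalfCos t * tanHalfDeriv t *
        psum (fun n => ((n : ℂ) + 1) * c (n + 1)) (tanHalfSin t ^ 2)) t := by
  have h := (hasDerivAt_psum hc (tanHalfSin_sq_lt_one ht)).scomp t ((hasDerivAt_tanHalfSin t).pow 2)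
  refine h.congr_deriv ?_
  rw [Complex.real_smul]
  push_cast
  ring

theorem tendsto_tanHalfSin_zero : Tendsto tanHalfSin (𝓝[>] 0) (𝓝 0) := by
  have h := (hasDerivAt_tanHalfSin 0).continuousAt.tendsto
  rw [show tanHalfSin 0 = 0 by simp [tanHalfSin]] at h
  exact h.mono_left nhdsWithin_le_nhds

theorem tendsto_psum_sin_sq {c : ℕ → ℂ} {C : ℝ} (hc : ∀ n, ‖c n‖ ≤ C) :
    Tendsto (fun t => psum c (tanHalfSin t ^ 2)) (𝓝[>] 0) (𝓝 (c 0)) := by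
  have h := (hasDerivAt_psum hc (t := 0) (by simp)).continuousAt.tendsto
  have e : psum c 0 = c 0 := by
    rw [psum_eq_add (le_mul_succ_of_le hc) (by simp)]
    simp
  rw [e] at h
  exact h.comp (by simpa using tendsto_tanHalfSin_zero.pow 2)

theorem aperyCoeff_evenSeq_zero (s : ℕ) (τ : ℕ → ℝ) : aperyCoeff (evenSeq s τ) 0 = 0 := by
  simp [aperyCoeff, evenSeq]

theorem aperyCoeff_evenSeq_succ (s : ℕ) (τ : ℕ → ℝ) (n : ℕ) :
    2 * ((n : ℂ) + 1) * aperyCoeff (evenSeq (s + 1) τ) (n + 1) =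
      aperyCoeff (evenSeq s τ) (n + 1) := by
  unfold aperyCoeff evenSeq
  push_cast
  have : (n : ℂ) + 1 ≠ 0 := by exact_mod_cast n.succ_ne_zero
  rw [pow_succ]
  field_simp

theorem aperyCoeff_oddSeq_succ (s : ℕ) (τ : ℕ → ℝ) (n : ℕ) :
    (2 * (n : ℂ) + 1) * aperyCoeff (oddSeq (s + 1) τ) n = aperyCoeff (oddSeq s τ) n := by
  unfold aperyCoeff oddSeq
  push_cast
  have : 2 * (n : ℂ) + 1 ≠ 0 := by exact_mod_cast (2 * n).succ_ne_zero
  rw [pow_succ]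
  field_simp

theorem aperyCoeff_evenSeq_one_succ (τ : ℕ → ℝ) (n : ℕ) :
    aperyCoeff (evenSeq 1 τ) (n + 1) = aperyCoeff (oddSeq 1 τ) n := by
  unfold aperyCoeff evenSeq oddSeq
  congr 1
  have h := aperyB_succ n
  have h1 : (2 * (n : ℝ) + 1) ≠ 0 := by positivity
  push_cast
  have h' : aperyB (n + 1) = (2 * n + 2) * aperyB n / (2 * n + 1) := by
    rw [eq_div_iff h1, ← h]; ring
  rw [h']
  field_simp

/-! ### Differential equations for the generating functions. -/

theorem hasDerivAt_aperyGen_evenSeq {τ : ℕ → ℝ} (h : SqrtDecay τ) {s : ℕ} (hs : 1 ≤ s) {t : ℝ}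
    (ht : t ∈ Set.Ioo (0 : ℝ) 1) : HasDerivAt (aperyGen (evenSeq (s + 1) τ))
      (tanHalfCos t / tanHalfSin t * tanHalfDeriv t * aperyGen (evenSeq s τ) t) t := by
  obtain ⟨C, hC⟩ := (sqrtDecay_evenSeq h hs).aperyCoeff_le
  obtain ⟨C', hC'⟩ := (sqrtDecay_evenSeq h (Nat.succ_pos s)).aperyCoeff_le
  refine (hasDerivAt_psum_sin_sq hC' ht).congr_deriv ?_
  rw [aperyGen, psum_eq_add (le_mul_succ_of_le hC) (tanHalfSin_sq_lt_one ht),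
    aperyCoeff_evenSeq_zero, zero_add]
  have e : (fun n : ℕ => aperyCoeff (evenSeq s τ) (n + 1)) =
      fun n : ℕ => 2 * (((n : ℂ) + 1) * aperyCoeff (evenSeq (s + 1) τ) (n + 1)) := by
    funext n
    rw [← aperyCoeff_evenSeq_succ, mul_assoc]
  rw [e, psum_mul_left]
  have h1 : (tanHalfSin t : ℂ) ≠ 0 := by exact_mod_cast (tanHalfSin_pos ht.1).ne'
  push_cast
  field_simp

theorem hasDerivAt_ofReal {f : ℝ → ℝ} {a t : ℝ} (h : HasDerivAt f a t) :
    HasDerivAt (fun t => (f t : ℂ)) (a : ℂ) t := h.ofReal_comp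

theorem hasDerivAt_aperyGen_oddSeq {τ : ℕ → ℝ} (h : SqrtDecay τ) {s : ℕ} (hs : 1 ≤ s) {t : ℝ}
    (ht : t ∈ Set.Ioo (0 : ℝ) 1) :
    HasDerivAt (fun t => tanHalfSin t * aperyGen (oddSeq (s + 1) τ) t)
      (tanHalfCos t * tanHalfDeriv t * aperyGen (oddSeq s τ) t) t := by
  obtain ⟨C, hC⟩ := (sqrtDecay_oddSeq h hs).aperyCoeff_le
  obtain ⟨C', hC'⟩ := (sqrtDecay_oddSeq h (Nat.succ_pos s)).aperyCoeff_le
  refine ((hasDerivAt_ofReal (hasDerivAt_tanHalfSin t)).mul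
    (hasDerivAt_psum_sin_sq hC' ht)).congr_deriv ?_
  have ht' := tanHalfSin_sq_lt_one ht
  have e : psum (fun n => aperyCoeff (oddSeq s τ) (n + 1)) (tanHalfSin t ^ 2) =
      2 * psum (fun n => ((n : ℂ) + 1) * aperyCoeff (oddSeq (s + 1) τ) (n + 1)) (tanHalfSin t ^ 2) +
        psum (fun n => aperyCoeff (oddSeq (s + 1) τ) (n + 1)) (tanHalfSin t ^ 2) := by
    rw [← psum_mul_left, ← psum_add (C := 2 * C') (C' := C') ?_
      (le_mul_succ_of_le fun n => hC' (n + 1)) ht']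
    · congr 1
      funext n
      rw [Pi.add_apply, ← aperyCoeff_oddSeq_succ]
      push_cast
      ring
    · intro n
      rw [norm_mul, norm_mul, show (n : ℂ) + 1 = ((n + 1 : ℕ) : ℂ) by push_cast; rfl,
        Complex.norm_natCast]
      have := hC' (n + 1)
      have h0 := (norm_nonneg _).trans this
      push_cast
      simp only [Complex.norm_ofNat]
      nlinarith [n.cast_nonneg (α := ℝ)]
  rw [aperyGen, psum_eq_add (le_mul_succ_of_le hC) ht', e,
    psum_eq_add (le_mul_succ_of_le hC') ht', ← aperyCoeff_oddSeq_succ s τ 0]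
  simp only [Nat.succ_eq_add_one]
  push_cast
  ring

/-- Since b_{n+1} / (2n+2) = b_n / (2n+1), and the sum over m < n+1 is the sum over m ≤ n, the two
coefficient sequences agree up to an index shift. -/
theorem aperyGen_evenSeq_one {τ : ℕ → ℝ} (h : SqrtDecay τ) {t : ℝ} (ht : t ∈ Set.Ioo (0 : ℝ) 1) :
    aperyGen (evenSeq 1 τ) t = tanHalfSin t ^ 2 * aperyGen (oddSeq 1 τ) t := by
  obtain ⟨C, hC⟩ := (sqrtDecay_evenSeq h le_rfl).aperyCoeff_le
  rw [aperyGen, psum_eq_add (le_mul_succ_of_le hC) (tanHalfSin_sq_lt_one ht),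
    aperyCoeff_evenSeq_zero, zero_add]
  simp_rw [aperyCoeff_evenSeq_one_succ]
  rw [aperyGen]
  push_cast
  rfl

/-- This is the place where the nested sum is undone. The coefficients e_n = b_n ∑_{m ≤ n} τ(m) obey
a first order recurrence with inhomogeneity b_{n+1} τ(n+1), and this recurrence is the stated
equation in terms of the generating function. -/
theorem hasDerivAt_aperyGen_oddSeq_one {τ : ℕ → ℝ} (h : SqrtDecay τ) {t : ℝ}
    (ht : t ∈ Set.Ioo (0 : ℝ) 1) :
    HasDerivAt (fun t => tanHalfSin t * tanHalfCos t * aperyGen (oddSeq 1 τ) t)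
      (tanHalfDeriv t * aperyGen τ t) t := by
  obtain ⟨C, hC⟩ := (sqrtDecay_oddSeq h le_rfl).aperyCoeff_le
  obtain ⟨C', hC'⟩ := h.aperyCoeff_le
  have ht' := tanHalfSin_sq_lt_one ht
  set X := tanHalfSin t ^ 2 with hX
  set a := aperyCoeff (oddSeq 1 τ) with ha
  set g := aperyCoeff τ with hg
  set e : ℕ → ℂ := fun n => (2 * n + 1) * a n with he
  have hD : ∀ n : ℕ, ‖2 * (((n : ℂ) + 1) * a (n + 1))‖ ≤ 2 * C * (n + 1) := by
    intro n
    rw [norm_mul, norm_mul, show (n : ℂ) + 1 = ((n + 1 : ℕ) : ℂ) by push_cast; rfl,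
      Complex.norm_natCast]
    have := hC (n + 1)
    have h0 := (norm_nonneg _).trans this
    push_cast
    simp only [Complex.norm_ofNat]
    nlinarith [n.cast_nonneg (α := ℝ)]
  have hC0 : 0 ≤ C := (norm_nonneg _).trans (hC 0)
  have heb : ∀ n : ℕ, ‖e n‖ ≤ 2 * C * (n + 1) := by
    intro n
    rw [he, norm_mul, show 2 * (n : ℂ) + 1 = ((2 * n + 1 : ℕ) : ℂ) by push_cast; rfl,
      Complex.norm_natCast]
    have := hC n
    push_cast
    nlinarith [n.cast_nonneg (α := ℝ), norm_nonneg (a n)]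
  have hee : e = fun n => ((aperyB n * ∑ m ∈ Finset.range (n + 1), τ m : ℝ) : ℂ) := by
    funext n
    simp only [he, ha, aperyCoeff, oddSeq]
    have : 2 * (n : ℂ) + 1 ≠ 0 := by exact_mod_cast (2 * n).succ_ne_zero
    push_cast
    field_simp
  -- From b_{n+1} = (2n+2) / (2n+1) b_n: the factor is 1 + 1/(2n+1), and e_n / (2n+1) = a_n.
  have hrec : (fun n => e (n + 1)) = (fun n => g (n + 1)) + (e + a) := by
    funext n
    have h1 : e n + a n = (((2 * n + 2) / (2 * n + 1) * (aperyB n *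
        ∑ m ∈ Finset.range (n + 1), τ m) : ℝ) : ℂ) := by
      simp only [he, ha, aperyCoeff, oddSeq]
      have : 2 * (n : ℂ) + 1 ≠ 0 := by exact_mod_cast (2 * n).succ_ne_zero
      push_cast
      field_simp
      ring
    rw [Pi.add_apply, Pi.add_apply, h1, hee]
    simp only [hg, aperyCoeff]
    rw [← Complex.ofReal_add]
    congr 1
    have h2 := aperyB_succ n
    have h3 : (2 * (n : ℝ) + 1) ≠ 0 := by positivity
    have h' : aperyB (n + 1) = (2 * n + 2) * aperyB n / (2 * n + 1) := by
      rw [eq_div_iff h3, ← h2]; ring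
    rw [Finset.sum_range_succ _ (n + 1), h']
    field_simp
    ring
  have e1 : psum (fun n => e (n + 1)) X = psum (fun n => g (n + 1)) X + (psum e X + psum a X) := by
    rw [hrec, psum_add (le_mul_succ_of_le fun n => hC' (n + 1)) (C' := 2 * C + C) ?_ ht',
      psum_add heb (le_mul_succ_of_le hC) ht']
    intro n
    rw [add_mul]
    exact (norm_add_le _ _).trans (add_le_add (heb n) (le_mul_succ_of_le hC n))
  have e2 : psum (fun n => e (n + 1)) X =
      2 * psum (fun n => ((n : ℂ) + 1) * a (n + 1)) X + psum (fun n => a (n + 1)) X := by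
    rw [← psum_mul_left, ← psum_add hD (le_mul_succ_of_le fun n => hC (n + 1)) ht']
    congr 1
    funext n
    simp only [he, Pi.add_apply]
    push_cast
    ring
  have e3 := psum_eq_add heb ht'
  have e4 := psum_eq_add (le_mul_succ_of_le hC) ht'
  have e5 := psum_eq_add (le_mul_succ_of_le hC') ht'
  have e6 : e 0 = a 0 := by simp [he]
  have e7 : e 0 = g 0 := by
    rw [hee]
    simp [hg, aperyCoeff]
  have hs : (tanHalfSin t : ℂ) ^ 2 = X := by push_cast [hX]; rfl
  have hcs : (tanHalfCos t : ℂ) ^ 2 = 1 - X := by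
    have : (tanHalfSin t : ℂ) ^ 2 + tanHalfCos t ^ 2 = 1 := by
      exact_mod_cast tanHalf_sq_add_sq t
    linear_combination this - hs
  refine (((hasDerivAt_ofReal (hasDerivAt_tanHalfSin t)).mul
    (hasDerivAt_ofReal (hasDerivAt_tanHalfCos t))).mul
    (hasDerivAt_psum_sin_sq hC ht)).congr_deriv ?_
  rw [aperyGen]
  simp only [← hX, ← hg, Pi.mul_apply, Complex.ofReal_mul, Complex.ofReal_neg]
  -- The recurrence summed against X^n, where X = sin² θ; the coefficient 1 - 2X is cos² θ - sin² θ,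
  -- the derivative of sin θ cos θ.
  have key : (1 - 2 * (X : ℂ)) * psum a X +
      2 * X * (1 - X) * psum (fun n => ((n : ℂ) + 1) * a (n + 1)) X = psum g X := by
    linear_combination (-(1 - X) : ℂ) * (e3 - e4 + e6 + X * e2) + e3 - e5 + e7 + X * e1
  have : (tanHalfCos t * tanHalfDeriv t * tanHalfCos t + tanHalfSin t *
      (-tanHalfSin t * tanHalfDeriv t) : ℂ) = tanHalfDeriv t * (1 - 2 * X) := by
    linear_combination (tanHalfDeriv t : ℂ) * hcs - (tanHalfDeriv t : ℂ) * hs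
  rw [this]
  linear_combination (tanHalfDeriv t : ℂ) * key + 2 * tanHalfCos t ^ 2 * tanHalfDeriv t *
    psum (fun n => ((n : ℂ) + 1) * a (n + 1)) X * hs + 2 * X * tanHalfDeriv t *
    psum (fun n => ((n : ℂ) + 1) * a (n + 1)) X * hcs

/-! ### Primitives of the generating series -/

/-- `I * psum c` is the primitive of `∑ b_n τ(n) sin²ⁿ θ dθ`. -/
def IsAnglePrimitive (τ : ℕ → ℝ) (c : ℕ → ℂ) : Prop :=
  ∀ t ∈ Set.Ioo (0 : ℝ) 1,
    HasDerivAt (fun t => Complex.I * psum c t) (tanHalfDeriv t * aperyGen τ t) t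

theorem tendsto_I_mul_psum {w : ℕ} {c : ℕ → ℂ} (h : c ∈ polylogSpan w) (hw : 1 ≤ w) :
    Tendsto (fun t => Complex.I * psum c t) (𝓝[>] 0) (𝓝 0) := by
  simpa using (tendsto_psum_zero_of_mem h hw).const_mul Complex.I

theorem tendsto_aperyGen {τ : ℕ → ℝ} (h : SqrtDecay τ) :
    Tendsto (aperyGen τ) (𝓝[>] 0) (𝓝 (aperyCoeff τ 0)) := by
  obtain ⟨C, hC⟩ := h.aperyCoeff_le
  exact tendsto_psum_sin_sq hC

theorem tendsto_aperyGen_evenSeq {τ : ℕ → ℝ} (h : SqrtDecay τ) {s : ℕ} (hs : 1 ≤ s) :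
    Tendsto (aperyGen (evenSeq s τ)) (𝓝[>] 0) (𝓝 0) := by
  have := tendsto_aperyGen (sqrtDecay_evenSeq h hs)
  rwa [aperyCoeff_evenSeq_zero] at this

theorem tendsto_ofReal_tanHalfSin_zero :
    Tendsto (fun t => (tanHalfSin t : ℂ)) (𝓝[>] 0) (𝓝 0) := by
  have := (Complex.continuous_ofReal.tendsto 0).comp tendsto_tanHalfSin_zero
  rw [Complex.ofReal_zero] at this
  exact this

theorem tendsto_sin_mul_aperyGen {τ : ℕ → ℝ} (h : SqrtDecay τ) :
    Tendsto (fun t => tanHalfSin t * aperyGen τ t) (𝓝[>] 0) (𝓝 0) := by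
  simpa using tendsto_ofReal_tanHalfSin_zero.mul (tendsto_aperyGen h)

theorem tanHalfSin_ne_zero {t : ℝ} (ht : t ∈ Set.Ioo (0 : ℝ) 1) : (tanHalfSin t : ℂ) ≠ 0 := by
  exact_mod_cast (tanHalfSin_pos ht.1).ne'

theorem tanHalfCos_ne_zero {t : ℝ} (ht : t ∈ Set.Ioo (0 : ℝ) 1) : (tanHalfCos t : ℂ) ≠ 0 := by
  exact_mod_cast (tanHalfCos_pos ht).ne'

theorem IsAnglePrimitive.oddSeq_one {τ : ℕ → ℝ} {c : ℕ → ℂ} {w : ℕ} (hτ : SqrtDecay τ)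
    (h : IsAnglePrimitive τ c) (hc : c ∈ polylogSpan (w + 1)) {t : ℝ}
    (ht : t ∈ Set.Ioo (0 : ℝ) 1) :
    aperyGen (oddSeq 1 τ) t = Complex.I * psum c t / (tanHalfSin t * tanHalfCos t) := by
  rw [eq_div_iff (mul_ne_zero (tanHalfSin_ne_zero ht) (tanHalfCos_ne_zero ht)), mul_comm]
  refine eqOn_Ioo_of_hasDerivAt (fun t ht => hasDerivAt_aperyGen_oddSeq_one hτ ht) h ?_
    (tendsto_I_mul_psum hc (by omega)) ht
  have h1 : Tendsto (fun t => (tanHalfCos t : ℂ)) (𝓝[>] 0) (𝓝 (tanHalfCos 0)) :=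
    ((hasDerivAt_ofReal (hasDerivAt_tanHalfCos 0)).continuousAt.tendsto).mono_left
      nhdsWithin_le_nhds
  simpa using (tendsto_ofReal_tanHalfSin_zero.mul h1).mul
    (tendsto_aperyGen (sqrtDecay_oddSeq hτ le_rfl))

theorem IsAnglePrimitive.evenSeq_one {τ : ℕ → ℝ} {c : ℕ → ℂ} {w : ℕ} (hτ : SqrtDecay τ)
    (h : IsAnglePrimitive τ c) (hc : c ∈ polylogSpan (w + 1)) {t : ℝ}
    (ht : t ∈ Set.Ioo (0 : ℝ) 1) :
    aperyGen (evenSeq 1 τ) t = tanHalfSin t / tanHalfCos t * (Complex.I * psum c t) := by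
  rw [aperyGen_evenSeq_one hτ ht, h.oddSeq_one hτ hc ht]
  have := tanHalfSin_ne_zero ht
  have := tanHalfCos_ne_zero ht
  field_simp

/-- At exponent 2 the factor cot θ cancels the tan θ of exponent 1 and leaves i dθ, which absorbs
the i of the angle primitive. The even generating functions therefore carry no i. -/
theorem IsAnglePrimitive.exists_evenSeq {τ : ℕ → ℝ} {c : ℕ → ℂ} {w : ℕ} (hτ : SqrtDecay τ)
    (h : IsAnglePrimitive τ c) (hc : c ∈ polylogSpan (w + 1)) (s : ℕ) :
    ∃ c' ∈ polylogSpan (w + s + 2),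
      ∀ t ∈ Set.Ioo (0 : ℝ) 1, aperyGen (evenSeq (s + 2) τ) t = psum c' t := by
  induction s with
  | zero =>
    obtain ⟨φ, hφ, hφ'⟩ := exists_angle_form
    obtain ⟨c', hc', hd⟩ := exists_conv_primitive hc (by omega) hφ
    refine ⟨c', convPolylogSpan_le _ hc', eqOn_Ioo_of_hasDerivAt
      (fun t ht => hasDerivAt_aperyGen_evenSeq hτ le_rfl ht) (fun t ht => ?_)
      (tendsto_aperyGen_evenSeq hτ (by omega))
      (tendsto_psum_zero_of_mem (convPolylogSpan_le _ hc') (by omega))⟩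
    refine (hd t ht).congr_deriv ?_
    rw [h.evenSeq_one hτ hc ht, hφ' t ht]
    have := tanHalfSin_ne_zero ht
    have := tanHalfCos_ne_zero ht
    field_simp
  | succ s ih =>
    obtain ⟨c₁, hc₁, h₁⟩ := ih
    obtain ⟨φ, hφ, hφ'⟩ := exists_cot_form
    obtain ⟨c', hc', hd⟩ := exists_conv_primitive hc₁ (by omega) hφ
    refine ⟨c', by convert convPolylogSpan_le _ hc' using 2; omega, eqOn_Ioo_of_hasDerivAt
      (fun t ht => hasDerivAt_aperyGen_evenSeq (s := s + 2) hτ (by omega) ht) (fun t ht => ?_)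
      (tendsto_aperyGen_evenSeq hτ (by omega))
      (tendsto_psum_zero_of_mem (convPolylogSpan_le _ hc') (by omega))⟩
    refine (hd t ht).congr_deriv ?_
    rw [h₁ t ht, hφ' t ht]

/-- At exponent 2 the form cos θ dθ / (sin θ cos θ) = dθ / sin θ is already rational, so the i of
the angle primitive persists. -/
theorem IsAnglePrimitive.exists_oddSeq {τ : ℕ → ℝ} {c : ℕ → ℂ} {w : ℕ} (hτ : SqrtDecay τ)
    (h : IsAnglePrimitive τ c) (hc : c ∈ polylogSpan (w + 1)) (s : ℕ) :
    ∃ c' ∈ polylogSpan (w + s + 2), ∀ t ∈ Set.Ioo (0 : ℝ) 1,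
      tanHalfSin t * aperyGen (oddSeq (s + 2) τ) t = Complex.I * psum c' t := by
  induction s with
  | zero =>
    obtain ⟨φ, hφ, hφ'⟩ := exists_csc_form
    obtain ⟨c', hc', hd⟩ := exists_conv_primitive hc (by omega) hφ
    refine ⟨c', convPolylogSpan_le _ hc', eqOn_Ioo_of_hasDerivAt
      (fun t ht => hasDerivAt_aperyGen_oddSeq hτ le_rfl ht) (fun t ht => ?_)
      (tendsto_sin_mul_aperyGen (sqrtDecay_oddSeq hτ (by omega)))
      (tendsto_I_mul_psum (convPolylogSpan_le _ hc') (by omega))⟩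
    refine ((hd t ht).const_mul Complex.I).congr_deriv ?_
    rw [h.oddSeq_one hτ hc ht, hφ' t ht]
    have := tanHalfSin_ne_zero ht
    have := tanHalfCos_ne_zero ht
    field_simp
  | succ s ih =>
    obtain ⟨c₁, hc₁, h₁⟩ := ih
    obtain ⟨φ, hφ, hφ'⟩ := exists_cot_form
    obtain ⟨c', hc', hd⟩ := exists_conv_primitive hc₁ (by omega) hφ
    refine ⟨c', by convert convPolylogSpan_le _ hc' using 2; omega, eqOn_Ioo_of_hasDerivAt
      (fun t ht => hasDerivAt_aperyGen_oddSeq (s := s + 2) hτ (by omega) ht) (fun t ht => ?_)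
      (tendsto_sin_mul_aperyGen (sqrtDecay_oddSeq hτ (by omega)))
      (tendsto_I_mul_psum (convPolylogSpan_le _ hc') (by omega))⟩
    refine ((hd t ht).const_mul Complex.I).congr_deriv ?_
    have h2 := tanHalfSin_ne_zero ht
    rw [hφ' t ht]
    field_simp
    linear_combination (-(tanHalfCos t : ℂ) * tanHalfDeriv t) * h₁ t ht

theorem IsAnglePrimitive.evenSeq_two_add {τ : ℕ → ℝ} {c : ℕ → ℂ} {w : ℕ} (hτ : SqrtDecay τ)
    (h : IsAnglePrimitive τ c) (hc : c ∈ polylogSpan (w + 1)) (s : ℕ) :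
    ∃ c' ∈ convPolylogSpan (w + (s + 2) + 1), IsAnglePrimitive (evenSeq (s + 2) τ) c' := by
  obtain ⟨c₁, hc₁, h₁⟩ := h.exists_evenSeq hτ hc s
  obtain ⟨φ, hφ, hφ'⟩ := exists_angle_form
  obtain ⟨c', hc', hd⟩ := exists_conv_primitive hc₁ (by omega) hφ
  -- The sign is i² = -1: the primitive is taken against i dθ and multiplied by i once more.
  refine ⟨(-1 : ℚ) • c', Submodule.smul_mem _ _ (by convert hc' using 2; omega), fun t ht => ?_⟩
  refine ((hasDerivAt_psum_smul (-1) (hd t ht)).const_mul Complex.I).congr_deriv ?_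
  rw [h₁ t ht, hφ' t ht, Rat.smul_def]
  push_cast
  linear_combination (-(tanHalfDeriv t : ℂ) * psum c₁ t) * Complex.I_sq

theorem IsAnglePrimitive.oddSeq_two_add {τ : ℕ → ℝ} {c : ℕ → ℂ} {w : ℕ} (hτ : SqrtDecay τ)
    (h : IsAnglePrimitive τ c) (hc : c ∈ polylogSpan (w + 1)) (s : ℕ) :
    ∃ c' ∈ convPolylogSpan (w + (s + 2) + 1), IsAnglePrimitive (oddSeq (s + 2) τ) c' := by
  obtain ⟨c₁, hc₁, h₁⟩ := h.exists_oddSeq hτ hc s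
  obtain ⟨φ, hφ, hφ'⟩ := exists_csc_form
  obtain ⟨c', hc', hd⟩ := exists_conv_primitive hc₁ (by omega) hφ
  refine ⟨c', by convert hc' using 2; omega, fun t ht => ?_⟩
  refine ((hd t ht).const_mul Complex.I).congr_deriv ?_
  have h2 := tanHalfSin_ne_zero ht
  rw [hφ' t ht]
  field_simp
  linear_combination (-(tanHalfDeriv t : ℂ)) * h₁ t ht

theorem exists_isAnglePrimitive_unit : ∃ c ∈ convPolylogSpan 1, IsAnglePrimitive unitSeq c := by
  have hu : (unitSeq : ℕ → ℂ) ∈ polylogSpan 0 := Submodule.subset_span IsPolylogSeq.unit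
  have hb : ∀ n, ‖(unitSeq : ℕ → ℂ) n‖ ≤ 1 := fun n => by
    unfold unitSeq; split_ifs <;> simp
  have h1 := letterSeq_mem_convPolylogSpan hu Complex.I_pow_four I_ne_one
  have h2 := letterSeq_mem_convPolylogSpan hu neg_I_pow_four neg_I_ne_one
  refine ⟨_, Submodule.add_mem _ h1 (Submodule.smul_mem _ (-1 : ℚ) h2), fun t ht => ?_⟩
  have ht' : |t| < 1 := by rw [abs_of_pos ht.1]; exact ht.2
  have e : ∀ x : ℝ, psum unitSeq x = 1 := by
    intro x
    rw [psum, tsum_eq_single 0]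
    · simp [unitSeq]
    · intro n hn; simp [unitSeq, hn]
  have e' : aperyCoeff unitSeq = unitSeq := by
    funext n
    by_cases hn : n = 0 <;> simp [aperyCoeff, unitSeq, hn, aperyB_zero]
  refine ((hasDerivAt_psum_add (convPolylogSpan_le _ h1)
    (convPolylogSpan_le _ (Submodule.smul_mem _ (-1 : ℚ) h2)) ht
    (hasDerivAt_psum_letterSeq hb Complex.I_pow_four ht')
    (hasDerivAt_psum_smul (-1) (hasDerivAt_psum_letterSeq hb neg_I_pow_four ht'))).const_mul
    Complex.I).congr_deriv ?_
  have h := letterForm_I_sub t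
  unfold letterForm at h
  rw [e, aperyGen, e', e, Rat.smul_def]
  push_cast
  linear_combination Complex.I * h - (tanHalfDeriv t : ℂ) * Complex.I_sq

/-- Induction on the nested sum. Only leading exponent 1 uses a form with the letter 1, so only
there can convergence at t = 1 be lost. -/
theorem IsParitySeq.exists_isAnglePrimitive {w : ℕ} {τ : ℕ → ℝ} (h : IsParitySeq w τ) :
    ∃ c ∈ polylogSpan (w + 1), IsAnglePrimitive τ c := by
  induction h with
  | unit =>
    obtain ⟨c, hc, h⟩ := exists_isAnglePrimitive_unit
    exact ⟨c, convPolylogSpan_le _ hc, h⟩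
  | @even w τ s w' h hs hw ih =>
    obtain ⟨c, hc, ih⟩ := ih
    subst hw
    rcases s with _ | _ | s
    · omega
    · obtain ⟨φ, hφ, hφ'⟩ := exists_tan_form
      obtain ⟨c', hc', hd⟩ := exists_primitive hc (by omega) hφ
      refine ⟨c', hc', fun t ht => ?_⟩
      refine ((hd t ht).const_mul Complex.I).congr_deriv ?_
      rw [ih.evenSeq_one h.sqrtDecay hc ht, hφ' t ht]
      ring
    · obtain ⟨c', hc', hd⟩ := ih.evenSeq_two_add h.sqrtDecay hc s
      exact ⟨c', convPolylogSpan_le _ hc', hd⟩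
  | @odd w τ s w' h hs hw ih =>
    obtain ⟨c, hc, ih⟩ := ih
    subst hw
    rcases s with _ | _ | s
    · omega
    · obtain ⟨φ, hφ, hφ'⟩ := exists_csc_sec_form
      obtain ⟨c', hc', hd⟩ := exists_primitive hc (by omega) hφ
      refine ⟨c', hc', fun t ht => ?_⟩
      refine ((hd t ht).const_mul Complex.I).congr_deriv ?_
      rw [ih.oddSeq_one h.sqrtDecay hc ht, hφ' t ht]
      ring
    · obtain ⟨c', hc', hd⟩ := ih.oddSeq_two_add h.sqrtDecay hc s
      exact ⟨c', convPolylogSpan_le _ hc', hd⟩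

/-! ### Integration up to `θ = π / 2` -/

/-- `∫_0^t κ sin²ⁿ`. -/
def sinMoment (κ : ℝ → ℝ) (n : ℕ) (t : ℝ) : ℝ := ∫ u in (0 : ℝ)..t, κ u * tanHalfSin u ^ (2 * n)

theorem continuous_tanHalfSin : Continuous tanHalfSin :=
  continuous_iff_continuousAt.2 fun t => (hasDerivAt_tanHalfSin t).continuousAt

theorem continuous_tanHalfDeriv : Continuous tanHalfDeriv := by
  unfold tanHalfDeriv
  exact continuous_const.div (by fun_prop) one_add_sq_ne_zero

theorem hasDerivAt_sinMoment {κ : ℝ → ℝ} (hκ : Continuous κ) (n : ℕ) (t : ℝ) :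
    HasDerivAt (sinMoment κ n) (κ t * tanHalfSin t ^ (2 * n)) t := by
  have h : Continuous fun u => κ u * tanHalfSin u ^ (2 * n) :=
    hκ.mul (continuous_tanHalfSin.pow _)
  exact intervalIntegral.integral_hasDerivAt_right (h.intervalIntegrable _ _)
    (h.stronglyMeasurableAtFilter _ _) h.continuousAt

theorem sinMoment_zero (κ : ℝ → ℝ) (n : ℕ) : sinMoment κ n 0 = 0 := by simp [sinMoment]

theorem monotoneOn_tanHalfSin : MonotoneOn tanHalfSin (Set.Icc 0 1) := by
  refine monotoneOn_of_deriv_nonneg (convex_Icc 0 1) continuous_tanHalfSin.continuousOn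
    (fun t _ => (hasDerivAt_tanHalfSin t).differentiableAt.differentiableWithinAt) fun t ht => ?_
  rw [interior_Icc] at ht
  rw [(hasDerivAt_tanHalfSin t).deriv]
  exact (mul_pos (tanHalfCos_pos ht) (tanHalfDeriv_pos t)).le

theorem monotoneOn_sinMoment {κ : ℝ → ℝ} (hκ : Continuous κ)
    (hκ0 : ∀ t ∈ Set.Icc (0 : ℝ) 1, 0 ≤ κ t) (n : ℕ) :
    MonotoneOn (sinMoment κ n) (Set.Icc 0 1) := by
  refine monotoneOn_of_deriv_nonneg (convex_Icc 0 1)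
    (fun t _ => (hasDerivAt_sinMoment hκ n t).continuousAt.continuousWithinAt)
    (fun t _ => (hasDerivAt_sinMoment hκ n t).differentiableAt.differentiableWithinAt)
    fun t ht => ?_
  rw [interior_Icc] at ht
  rw [(hasDerivAt_sinMoment hκ n t).deriv]
  exact mul_nonneg (hκ0 t ⟨ht.1.le, ht.2.le⟩) (pow_nonneg (tanHalfSin_nonneg ht.1.le) _)

theorem sinMoment_mem {κ : ℝ → ℝ} (hκ : Continuous κ) (hκ0 : ∀ t ∈ Set.Icc (0 : ℝ) 1, 0 ≤ κ t)
    (n : ℕ) {t : ℝ} (ht : t ∈ Set.Icc (0 : ℝ) 1) :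
    0 ≤ sinMoment κ n t ∧ sinMoment κ n t ≤ sinMoment κ n 1 := by
  have h := monotoneOn_sinMoment hκ hκ0 n
  refine ⟨?_, h ht (by simp) ht.2⟩
  rw [← sinMoment_zero κ n]
  exact h (by simp) ht ht.1

/-- Termwise integration of `∑ aₙ sin²ⁿ` against the continuous density `κ` up to `t = 1`. -/
theorem exists_termwise_primitive {κ : ℝ → ℝ} (hκ : Continuous κ)
    (hκ0 : ∀ t ∈ Set.Icc (0 : ℝ) 1, 0 ≤ κ t) {a : ℕ → ℝ} {C : ℝ} (ha0 : ∀ n, 0 ≤ a n)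
    (ha : ∀ n, a n ≤ C) (hs : Summable fun n => a n * sinMoment κ n 1) :
    ∃ F : ℝ → ℂ, (∀ t ∈ Set.Ioo (0 : ℝ) 1,
        HasDerivAt F (κ t * psum (fun n => (a n : ℂ)) (tanHalfSin t ^ 2)) t) ∧
      Tendsto F (𝓝[>] 0) (𝓝 0) ∧
      Tendsto F (𝓝[<] 1) (𝓝 ((∑' n, a n * sinMoment κ n 1 : ℝ) : ℂ)) := by
  have hC : 0 ≤ C := (ha0 0).trans (ha 0)
  set f : ℝ → ℝ := fun t => ∑' n, a n * sinMoment κ n t with hf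
  have hb : ∀ n, ∀ t ∈ Set.Icc (0 : ℝ) 1, ‖a n * sinMoment κ n t‖ ≤ a n * sinMoment κ n 1 := by
    intro n t ht
    obtain ⟨h1, h2⟩ := sinMoment_mem hκ hκ0 n ht
    rw [Real.norm_of_nonneg (mul_nonneg (ha0 n) h1)]
    exact mul_le_mul_of_nonneg_left h2 (ha0 n)
  have hlim : ∀ x ∈ Set.Icc (0 : ℝ) 1, ∀ s : Set ℝ, (Set.Icc 0 1 ∈ 𝓝[s] x) →
      Tendsto f (𝓝[s] x) (𝓝 (f x)) := by
    intro x hx s hsx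
    refine tendsto_tsum_of_dominated_convergence hs (fun n => ?_) ?_
    · exact ((hasDerivAt_sinMoment hκ n x).continuousAt.tendsto.mono_left
        nhdsWithin_le_nhds).const_mul _
    · filter_upwards [hsx] with t ht n using hb n t ht
  obtain ⟨D, hD⟩ : ∃ D, ∀ t ∈ Set.Icc (0 : ℝ) 1, κ t ≤ D := by
    obtain ⟨D, hD⟩ := isCompact_Icc.bddAbove_image hκ.continuousOn
    exact ⟨D, fun t ht => hD ⟨t, ht, rfl⟩⟩
  have hD0 : 0 ≤ D := (hκ0 0 (by simp)).trans (hD 0 (by simp))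
  have hd : ∀ t ∈ Set.Ioo (0 : ℝ) 1,
      HasDerivAt f (∑' n, a n * (κ t * tanHalfSin t ^ (2 * n))) t := by
    intro t ht
    -- Away from t = 1 the derivatives are dominated by a geometric series in sin² at r.
    obtain ⟨r, htr, hr⟩ := exists_between ht.2
    have hr' : r ∈ Set.Ioo (0 : ℝ) 1 := ⟨ht.1.trans htr, hr⟩
    have hrs : tanHalfSin r ^ 2 < 1 := (abs_lt.1 (tanHalfSin_sq_lt_one hr')).2
    refine hasDerivAt_tsum_of_isPreconnected (t := Set.Ioo 0 r)
      (u := fun n => C * (D * (tanHalfSin r ^ 2) ^ n))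
      ((summable_geometric_of_lt_one (sq_nonneg _) hrs).mul_left D |>.mul_left C) isOpen_Ioo
      isPreconnected_Ioo (fun n y _ => (hasDerivAt_sinMoment hκ n y).const_mul _) ?_ ⟨ht.1, htr⟩ ?_
      ⟨ht.1, htr⟩
    · intro n y hy
      have hy' : y ∈ Set.Icc (0 : ℝ) 1 := ⟨hy.1.le, (hy.2.trans hr).le⟩
      have h0 := hκ0 y hy'
      have h1 := tanHalfSin_nonneg hy.1.le
      have h2 := ha0 n
      rw [Real.norm_of_nonneg (by positivity), ← pow_mul]
      have h3 := monotoneOn_tanHalfSin hy' ⟨hr'.1.le, hr.le⟩ hy.2.le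
      have h4 := ha n
      have h5 := hD y hy'
      gcongr
    · exact Summable.of_norm_bounded hs fun n => hb n t ⟨ht.1.le, ht.2.le⟩
  refine ⟨fun t => (f t : ℂ), fun t ht => ?_, ?_, ?_⟩
  · refine (hasDerivAt_ofReal (hd t ht)).congr_deriv ?_
    rw [psum, ← tsum_mul_left, Complex.ofReal_tsum]
    refine tsum_congr fun n => ?_
    push_cast
    rw [pow_mul]
    ring
  · have h := hlim 0 (by simp) (Set.Ioi 0) (Icc_mem_nhdsGT (by norm_num))
    have h0 : f 0 = 0 := by simp [hf, sinMoment_zero]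
    rw [h0] at h
    have := (Complex.continuous_ofReal.tendsto 0).comp h
    rw [Complex.ofReal_zero] at this
    exact this
  · have h := hlim 1 (by simp) (Set.Iio 1) (Icc_mem_nhdsLT (by norm_num))
    exact (Complex.continuous_ofReal.tendsto _).comp h

/-- Any explicit primitive agrees with the termwise integral, so its limit at t = 1 evaluates the
series of moments. -/
theorem tendsto_of_hasDerivAt_psum {κ : ℝ → ℝ} (hκ : Continuous κ)
    (hκ0 : ∀ t ∈ Set.Icc (0 : ℝ) 1, 0 ≤ κ t) {a : ℕ → ℝ} {C : ℝ} (ha0 : ∀ n, 0 ≤ a n)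
    (ha : ∀ n, a n ≤ C) (hs : Summable fun n => a n * sinMoment κ n 1) {F : ℝ → ℂ}
    (hF : ∀ t ∈ Set.Ioo (0 : ℝ) 1,
      HasDerivAt F (κ t * psum (fun n => (a n : ℂ)) (tanHalfSin t ^ 2)) t)
    (hF0 : Tendsto F (𝓝[>] 0) (𝓝 0)) :
    Tendsto F (𝓝[<] 1) (𝓝 ((∑' n, a n * sinMoment κ n 1 : ℝ) : ℂ)) := by
  obtain ⟨G, hG, hG0, hG1⟩ := exists_termwise_primitive hκ hκ0 ha0 ha hs
  refine hG1.congr' ?_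
  filter_upwards [Ioo_mem_nhdsLT (show (0 : ℝ) < 1 by norm_num)] with t ht
  exact (eqOn_Ioo_of_hasDerivAt hF hG hF0 hG0 ht).symm

/-! ### Series with values in a given space -/

/-- The series of `f` converges and its sum lies in `V`. -/
def SumIn (V : Submodule ℚ ℂ) (f : ℕ → ℝ) : Prop := Summable f ∧ ((∑' n, f n : ℝ) : ℂ) ∈ V

theorem SumIn.add {V : Submodule ℚ ℂ} {f g : ℕ → ℝ} (hf : SumIn V f) (hg : SumIn V g) :
    SumIn V fun n => f n + g n := by
  refine ⟨hf.1.add hg.1, ?_⟩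
  rw [hf.1.tsum_add hg.1, Complex.ofReal_add]
  exact V.add_mem hf.2 hg.2

theorem SumIn.const_mul {V : Submodule ℚ ℂ} {f : ℕ → ℝ} (q : ℚ) (hf : SumIn V f) :
    SumIn V fun n => (q : ℝ) * f n := by
  refine ⟨hf.1.mul_left _, ?_⟩
  rw [tsum_mul_left, Complex.ofReal_mul, Complex.ofReal_ratCast, ← Rat.smul_def]
  exact V.smul_mem q hf.2

theorem SumIn.sub {V : Submodule ℚ ℂ} {f g : ℕ → ℝ} (hf : SumIn V f) (hg : SumIn V g) :
    SumIn V fun n => f n - g n := by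
  have := hf.add (hg.const_mul (-1))
  simpa [sub_eq_add_neg] using this

theorem SumIn.mono {V W : Submodule ℚ ℂ} {f : ℕ → ℝ} (hf : SumIn V f) (h : V ≤ W) : SumIn W f :=
  ⟨hf.1, h hf.2⟩

theorem SumIn.congr {V : Submodule ℚ ℂ} {f g : ℕ → ℝ} (hf : SumIn V f) (h : ∀ n, f n = g n) :
    SumIn V g := by rwa [← funext h]

theorem SumIn.of_succ {V : Submodule ℚ ℂ} {f : ℕ → ℝ} (hf : SumIn V fun n => f (n + 1))
    (h0 : ((f 0 : ℝ) : ℂ) ∈ V) : SumIn V f := by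
  have hs : Summable f := (summable_nat_add_iff 1).1 hf.1
  refine ⟨hs, ?_⟩
  rw [hs.tsum_eq_zero_add, Complex.ofReal_add]
  exact V.add_mem h0 hf.2

/-- The `ℚ`-vector space underlying `CMZVleGaussian 4 w`. -/
def gaussianSpan (w : ℕ) : Submodule ℚ ℂ := (CMZVleGaussian 4 w).restrictScalars ℚ

theorem CMZV_le_gaussianSpan {k w : ℕ} (h : k ≤ w) : CMZV 4 k ≤ gaussianSpan w := fun _ hv =>
  Submodule.subset_span ((le_iSup₂_of_le k h le_rfl : CMZV 4 k ≤ CMZVle 4 w) hv)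

theorem gaussianSpan_mono {k w : ℕ} (h : k ≤ w) : gaussianSpan k ≤ gaussianSpan w := by
  refine fun v hv => Submodule.span_mono ?_ hv
  exact SetLike.coe_subset_coe.2 (iSup₂_le fun j hj => le_iSup₂_of_le j (hj.trans h) le_rfl)

theorem I_mul_mem_gaussianSpan {w : ℕ} {v : ℂ} (hv : v ∈ gaussianSpan w) :
    Complex.I * v ∈ gaussianSpan w :=
  (CMZVleGaussian 4 w).smul_mem
    (⟨Complex.I, Algebra.subset_adjoin rfl⟩ : Algebra.adjoin ℚ {Complex.I}) hv

theorem one_mem_CMZV_zero : (1 : ℂ) ∈ CMZV 4 0 := by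
  have h : IsConvPolylogSeq 0 unitSeq := .unit
  obtain ⟨v, hv⟩ := h.exists_tendsto
  have h1 : Tendsto (fun N => ∑ n ∈ Finset.range N, (unitSeq n : ℂ)) atTop (𝓝 1) := by
    refine tendsto_const_nhds.congr' ?_
    filter_upwards [eventually_ge_atTop 1] with N hN
    simp only [unitSeq]
    rw [Finset.sum_ite_eq', if_pos (Finset.mem_range.2 hN)]
  exact Submodule.subset_span (h.isCMZV h1)

theorem ratCast_mem_gaussianSpan (q : ℚ) (w : ℕ) : (q : ℂ) ∈ gaussianSpan w := by
  have := (gaussianSpan w).smul_mem q (CMZV_le_gaussianSpan (Nat.zero_le w) one_mem_CMZV_zero)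
  simpa [Rat.smul_def] using this

/-! ### The moments of `sin` -/

/-- The Wallis integral `∫_0^{π/2} sin^m θ dθ`. -/
def sinPowIntegral (m : ℕ) : ℝ := ∫ u in (0 : ℝ)..1, tanHalfSin u ^ m * tanHalfDeriv u

theorem intervalIntegrable_sinPow (m : ℕ) :
    IntervalIntegrable (fun u => tanHalfSin u ^ m * tanHalfDeriv u) MeasureTheory.volume 0 1 :=
  ((continuous_tanHalfSin.pow m).mul continuous_tanHalfDeriv).intervalIntegrable _ _

theorem sinPowIntegral_zero : sinPowIntegral 0 = Real.pi / 2 := by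
  have h : ∀ u ∈ Set.uIcc (0 : ℝ) 1, HasDerivAt (fun t => 2 * Real.arctan t)
      (tanHalfSin u ^ 0 * tanHalfDeriv u) u := by
    intro u _
    refine ((Real.hasDerivAt_arctan u).const_mul 2).congr_deriv ?_
    rw [tanHalfDeriv]
    ring
  rw [sinPowIntegral, intervalIntegral.integral_eq_sub_of_hasDerivAt h (intervalIntegrable_sinPow 0),
    Real.arctan_one, Real.arctan_zero]
  ring

theorem sinPowIntegral_one : sinPowIntegral 1 = 1 := by
  have h : ∀ u ∈ Set.uIcc (0 : ℝ) 1, HasDerivAt (fun t => -tanHalfCos t)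
      (tanHalfSin u ^ 1 * tanHalfDeriv u) u := by
    intro u _
    refine (hasDerivAt_tanHalfCos u).neg.congr_deriv ?_
    ring
  rw [sinPowIntegral, intervalIntegral.integral_eq_sub_of_hasDerivAt h (intervalIntegrable_sinPow 1)]
  simp [tanHalfCos]

theorem sinPowIntegral_add_two (m : ℕ) :
    (m + 2) * sinPowIntegral (m + 2) = (m + 1) * sinPowIntegral m := by
  -- Integration by parts: sin^{m+1} θ cos θ vanishes at both ends.
  have h : ∀ u ∈ Set.uIcc (0 : ℝ) 1, HasDerivAt (fun t => tanHalfSin t ^ (m + 1) * tanHalfCos t)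
      ((m + 1) * (tanHalfSin u ^ m * tanHalfDeriv u) -
        (m + 2) * (tanHalfSin u ^ (m + 2) * tanHalfDeriv u)) u := by
    intro u _
    refine (((hasDerivAt_tanHalfSin u).pow (m + 1)).mul (hasDerivAt_tanHalfCos u)).congr_deriv ?_
    have := tanHalf_sq_add_sq u
    simp only [Nat.add_sub_cancel, Pi.pow_apply]
    push_cast
    linear_combination ((m + 1) * tanHalfSin u ^ m * tanHalfDeriv u) * this
  have h1 := intervalIntegral.integral_eq_sub_of_hasDerivAt h
    (((intervalIntegrable_sinPow m).const_mul _).sub ((intervalIntegrable_sinPow (m + 2)).const_mul _))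
  rw [intervalIntegral.integral_sub ((intervalIntegrable_sinPow m).const_mul _)
    ((intervalIntegrable_sinPow (m + 2)).const_mul _), intervalIntegral.integral_const_mul,
    intervalIntegral.integral_const_mul] at h1
  have h2 : tanHalfCos 1 = 0 := by simp [tanHalfCos]
  have h3 : tanHalfSin 0 = 0 := by simp [tanHalfSin]
  rw [h2, h3] at h1
  simp only [mul_zero, ne_eq, Nat.add_eq_zero_iff, one_ne_zero, and_false, not_false_eq_true,
    zero_pow, zero_mul, sub_zero] at h1
  unfold sinPowIntegral
  linarith

theorem sinPowIntegral_even (n : ℕ) : sinPowIntegral (2 * n) = Real.pi / 2 / aperyB n := by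
  have hb := aperyB_pos
  induction n with
  | zero => simp [sinPowIntegral_zero, aperyB_zero]
  | succ n ih =>
    have h := sinPowIntegral_add_two (2 * n)
    rw [ih] at h
    have h2 := aperyB_succ n
    have h0 := (hb n).ne'
    have h1 := (hb (n + 1)).ne'
    have h3 : (2 * (n : ℝ) + 2) ≠ 0 := by positivity
    have h' : (2 * (n : ℝ) + 2) * sinPowIntegral (2 * n + 2) * aperyB n =
        (2 * n + 1) * (Real.pi / 2) := by
      push_cast at h
      rw [h]
      field_simp
    rw [show 2 * (n + 1) = 2 * n + 2 by ring, eq_div_iff h1]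
    apply mul_left_cancel₀ (mul_ne_zero h3 h0)
    linear_combination aperyB (n + 1) * h' + Real.pi / 2 * h2

theorem sinPowIntegral_odd (n : ℕ) : sinPowIntegral (2 * n + 1) = aperyB n / (2 * n + 1) := by
  induction n with
  | zero => simp [sinPowIntegral_one, aperyB_zero]
  | succ n ih =>
    have h := sinPowIntegral_add_two (2 * n + 1)
    rw [ih] at h
    have h2 := aperyB_succ n
    have h1 : (2 * (n : ℝ) + 1) ≠ 0 := by positivity
    have h3 : (2 * (n : ℝ) + 3) ≠ 0 := by positivity
    rw [show 2 * (n + 1) + 1 = 2 * n + 1 + 2 by ring]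
    push_cast at h ⊢
    rw [show 2 * ((n : ℝ) + 1) + 1 = 2 * n + 3 by ring, eq_div_iff h3]
    apply mul_left_cancel₀ h1
    field_simp at h
    linear_combination h - h2

/-- The density `sin θ dθ`. -/
def sinDensity (t : ℝ) : ℝ := tanHalfSin t * tanHalfDeriv t

/-- The density `(1 - sin θ) dθ`. -/
def oneSubSinDensity (t : ℝ) : ℝ := (1 - tanHalfSin t) * tanHalfDeriv t

theorem continuous_sinDensity : Continuous sinDensity :=
  continuous_tanHalfSin.mul continuous_tanHalfDeriv

theorem continuous_oneSubSinDensity : Continuous oneSubSinDensity :=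
  (continuous_const.sub continuous_tanHalfSin).mul continuous_tanHalfDeriv

theorem sinDensity_nonneg {t : ℝ} (ht : t ∈ Set.Icc (0 : ℝ) 1) : 0 ≤ sinDensity t :=
  mul_nonneg (tanHalfSin_nonneg ht.1) (tanHalfDeriv_pos t).le

theorem oneSubSinDensity_nonneg (t : ℝ) : 0 ≤ oneSubSinDensity t :=
  mul_nonneg (sub_nonneg.2 (tanHalfSin_le_one t)) (tanHalfDeriv_pos t).le

theorem sinMoment_sinDensity (n : ℕ) : sinMoment sinDensity n 1 = aperyB n / (2 * n + 1) := by
  rw [← sinPowIntegral_odd, sinMoment, sinPowIntegral]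
  congr 1
  funext u
  rw [sinDensity]
  ring

theorem sinMoment_tanHalfDeriv (n : ℕ) :
    sinMoment tanHalfDeriv n 1 = Real.pi / 2 / aperyB n := by
  rw [← sinPowIntegral_even, sinMoment, sinPowIntegral]
  congr 1
  funext u
  ring

theorem sinMoment_oneSubSinDensity (n : ℕ) : sinMoment oneSubSinDensity n 1 =
    Real.pi / 2 / aperyB n - aperyB n / (2 * n + 1) := by
  rw [← sinPowIntegral_even, ← sinPowIntegral_odd, sinMoment, sinPowIntegral, sinPowIntegral,
    ← intervalIntegral.integral_sub (intervalIntegrable_sinPow _) (intervalIntegrable_sinPow _)]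
  congr 1
  funext u
  rw [oneSubSinDensity]
  ring

/-! ### Summability -/

theorem aperyB_sq_le (n : ℕ) : aperyB n ^ 2 ≤ 4 * (n + 1) := by
  have h := aperyB_le n
  have h1 := (aperyB_pos n).le
  calc aperyB n ^ 2 ≤ (2 * √(n + 1)) ^ 2 := by gcongr
    _ = _ := by rw [mul_pow, Real.sq_sqrt (by positivity)]; norm_num

theorem summable_of_abs_le_sqrt {f : ℕ → ℝ} {C : ℝ}
    (h : ∀ n : ℕ, |f n| ≤ C / (((n : ℝ) + 1) * √(n + 1))) : Summable f :=
  Summable.of_norm_bounded (summable_one_div_mul_sqrt.mul_left C) fun n => by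
    rw [mul_one_div]
    exact h n

/-- The orders n · n^{-3} · n^{1/2} combine to n^{-3/2}; this is why total head exponent 3 suffices.
-/
theorem summable_aperyB_sq_mul {r B : ℕ → ℝ} {C D : ℝ} (hr : ∀ n : ℕ, |r n| ≤ D / ((n : ℝ) + 1) ^ 3)
    (hB : ∀ n : ℕ, |B n| ≤ C * √(n + 1)) : Summable fun n => aperyB n ^ 2 * (r n * B n) := by
  refine summable_of_abs_le_sqrt (C := 4 * (D * C)) fun n => ?_
  have hC : 0 ≤ D := by simpa using (abs_nonneg _).trans (hr 0)
  have hD : 0 ≤ C := by simpa using (abs_nonneg _).trans (hB 0)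
  have h1 : 0 < √((n : ℝ) + 1) := by positivity
  rw [abs_mul, abs_mul, abs_of_nonneg (sq_nonneg _)]
  calc _ ≤ 4 * ((n : ℝ) + 1) * (D / ((n : ℝ) + 1) ^ 3 * (C * √(n + 1))) := by
        have := aperyB_sq_le n
        have := hr n
        have := hB n
        gcongr
    _ = _ := by
        have h2 := Real.sq_sqrt (show 0 ≤ (n : ℝ) + 1 by positivity)
        field_simp
        linear_combination (D * C) * h2

theorem abs_inv_eval_le (l : ParityForm) (n : ℕ) : |1 / l.eval n| ≤ 2 / (n + 1) := by
  have h0 := n.cast_nonneg (α := ℝ)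
  rcases Nat.eq_zero_or_pos n with rfl | hn
  -- At `n = 0` the form 2n vanishes and its inverse is `0` by convention; the other two have
  -- modulus 1.
  · cases l <;> simp [ParityForm.eval]
  · have hn' : (1 : ℝ) ≤ n := by exact_mod_cast hn
    have h : ((n : ℝ) + 1) / 2 ≤ l.eval n := by
      cases l <;> simp only [ParityForm.eval] <;> linarith
    have hpos : 0 < l.eval n := by linarith
    rw [abs_of_pos (one_div_pos.2 hpos), div_le_div_iff₀ hpos (by positivity)]
    linarith

theorem abs_inv_eval_pow_le (l : ParityForm) (a n : ℕ) :
    |1 / l.eval n ^ a| ≤ 2 ^ a / ((n : ℝ) + 1) ^ a := by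
  rw [← one_div_pow, abs_pow, ← div_pow]
  exact pow_le_pow_left₀ (abs_nonneg _) (abs_inv_eval_le l n) a

theorem abs_inv_eval_pow_mul_le (l l' : ParityForm) {a b : ℕ} (h : 3 ≤ a + b) (n : ℕ) :
    |1 / l.eval n ^ a * (1 / l'.eval n ^ b)| ≤ 2 ^ (a + b) / ((n : ℝ) + 1) ^ 3 := by
  have h1 : (1 : ℝ) ≤ n + 1 := by linarith [n.cast_nonneg (α := ℝ)]
  rw [abs_mul]
  calc _ ≤ 2 ^ a / ((n : ℝ) + 1) ^ a * (2 ^ b / ((n : ℝ) + 1) ^ b) := by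
        have := abs_inv_eval_pow_le l a n
        have := abs_inv_eval_pow_le l' b n
        gcongr
    _ = 2 ^ (a + b) / ((n : ℝ) + 1) ^ (a + b) := by
        rw [div_mul_div_comm, ← pow_add, ← pow_add]
    _ ≤ _ := by gcongr

theorem SqrtDecay.exists_abs_sum_le {τ : ℕ → ℝ} (h : SqrtDecay τ) :
    ∃ C, ∀ n : ℕ, |∑ m ∈ Finset.range n, τ m| ≤ C * √((n : ℝ) + 1) := by
  obtain ⟨C, hC, h⟩ := h.exists_norm_sum_le
  refine ⟨C, fun n => (h n).trans ?_⟩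
  gcongr
  linarith

theorem summable_aperyB_sq_eval {τ : ℕ → ℝ} (h : SqrtDecay τ) (l l' : ParityForm) {a b : ℕ}
    (hab : 3 ≤ a + b) : Summable fun n => aperyB n ^ 2 *
      (1 / l.eval n ^ a * (1 / l'.eval n ^ b) * ∑ m ∈ Finset.range n, τ m) := by
  obtain ⟨C, hC⟩ := h.exists_abs_sum_le
  exact summable_aperyB_sq_mul (abs_inv_eval_pow_mul_le l l' hab) hC

theorem summable_aperyB_sq_evenSeq {τ : ℕ → ℝ} (h : SqrtDecay τ) {s : ℕ} (hs : 3 ≤ s) :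
    Summable fun n => aperyB n ^ 2 * evenSeq s τ n := by
  refine (summable_aperyB_sq_eval h .even .even (a := s) (b := 0) (by omega)).congr fun n => ?_
  simp [evenSeq, ParityForm.eval]

theorem summable_aperyB_sq_oddSeq {τ : ℕ → ℝ} (h : SqrtDecay τ) {s : ℕ} (hs : 3 ≤ s) :
    Summable fun n => aperyB n ^ 2 * oddSeq s τ n := by
  obtain ⟨C, hC, h⟩ := h.exists_norm_sum_le
  refine summable_aperyB_sq_mul (r := fun n => 1 / (2 * (n : ℝ) + 1) ^ s)
    (B := fun n => ∑ m ∈ Finset.range (n + 1), τ m) (D := 2 ^ s) (C := C) (fun n => ?_)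
    (fun n => by exact_mod_cast h (n + 1))
  have := abs_inv_eval_pow_mul_le .oddPlus .even (a := s) (b := 0) (by omega) n
  simpa [ParityForm.eval] using this

/-! ### The standard series -/

theorem SqrtDecay.exists_aperyB_mul_le {τ : ℕ → ℝ} (h : SqrtDecay τ) :
    ∃ C, ∀ n, aperyB n * τ n ≤ C := by
  obtain ⟨C, hC⟩ := h.aperyCoeff_le
  refine ⟨C, fun n => (le_abs_self _).trans ?_⟩
  have := hC n
  rwa [aperyCoeff, Complex.norm_real] at this

/-- The generating function with exponent one less is integrated against dθ / sin θ. Since ∫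
sin^{2n-1} θ dθ = b_{n-1} / (2n-1) = b_n / (2n) over [0, π/2], this supplies both the missing power
and the second b_n. Neither factor brings in an i. -/
theorem sumIn_evenSeq {w s : ℕ} {τ : ℕ → ℝ} (h : IsParitySeq w τ) (hs : 3 ≤ s) :
    SumIn (CMZV 4 (w + s)) fun n => aperyB n ^ 2 * evenSeq s τ n := by
  have hsum := summable_aperyB_sq_evenSeq h.sqrtDecay hs
  refine ⟨hsum, ?_⟩
  obtain ⟨s, rfl⟩ := Nat.exists_eq_add_of_le' hs
  obtain ⟨c, hc, hA⟩ := h.exists_isAnglePrimitive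
  obtain ⟨c₁, hc₁, h₁⟩ := hA.exists_evenSeq h.sqrtDecay hc s
  obtain ⟨φ, hφ, hφ'⟩ := exists_csc_form
  obtain ⟨c', hc', hd⟩ := exists_conv_primitive hc₁ (by omega) hφ
  obtain ⟨v, hv, hlim⟩ := exists_tendsto_psum_one hc'
  have hdec := sqrtDecay_evenSeq h.sqrtDecay (s := s + 2) (by omega)
  obtain ⟨C, hC⟩ := hdec.exists_aperyB_mul_le
  obtain ⟨C', hC'⟩ := hdec.aperyCoeff_le
  have he : IsParitySeq (w + (s + 2)) (evenSeq (s + 2) τ) := .even _ _ h (by omega) rfl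
  -- The term at 0 vanishes; dividing the rest by sin² θ shifts the index and turns dθ / sin θ into
  -- the continuous density sin θ dθ.
  have hterm : ∀ n, aperyB (n + 1) * evenSeq (s + 2) τ (n + 1) * sinMoment sinDensity n 1 =
      aperyB (n + 1) ^ 2 * evenSeq (s + 3) τ (n + 1) := by
    intro n
    have h2 := aperyB_succ n
    have h1 : (2 * (n : ℝ) + 1) ≠ 0 := by positivity
    have h' : aperyB n = aperyB (n + 1) * (2 * n + 1) / (2 * n + 2) := by
      rw [eq_div_iff (by positivity)]
      linear_combination -h2
    rw [sinMoment_sinDensity, h', evenSeq, evenSeq, pow_succ _ (s + 2)]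
    push_cast
    field_simp
  have hsum' := (summable_nat_add_iff 1).2 hsum
  have := tendsto_of_hasDerivAt_psum continuous_sinDensity (fun t ht => sinDensity_nonneg ht)
    (a := fun n => aperyB (n + 1) * evenSeq (s + 2) τ (n + 1)) (C := C)
    (fun n => mul_nonneg (aperyB_pos _).le (he.nonneg _)) (fun n => hC (n + 1))
    (hsum'.congr fun n => (hterm n).symm) (F := psum c') (fun t ht => ?_)
    (tendsto_psum_zero_of_mem (convPolylogSpan_le _ hc') (by omega))
  · have h2 := tendsto_nhds_unique hlim this
    rw [hsum.tsum_eq_zero_add]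
    simp_rw [hterm] at h2
    rw [show aperyB 0 ^ 2 * evenSeq (s + 3) τ 0 = 0 by simp [evenSeq], zero_add, ← h2]
    exact hv
  · refine (hd t ht).congr_deriv ?_
    rw [hφ' t ht, ← h₁ t ht, aperyGen,
      psum_eq_add (le_mul_succ_of_le hC') (tanHalfSin_sq_lt_one ht), aperyCoeff_evenSeq_zero,
      zero_add, sinDensity]
    have := tanHalfSin_ne_zero ht
    simp only [aperyCoeff]
    push_cast
    field_simp

/-- Integration against sin θ dθ supplies b_n / (2n+1). The i carried by sin θ G is absorbed by the
form i dθ, so the value is rational in the colored zeta values. -/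
theorem sumIn_oddSeq {w s : ℕ} {τ : ℕ → ℝ} (h : IsParitySeq w τ) (hs : 3 ≤ s) :
    SumIn (CMZV 4 (w + s)) fun n => aperyB n ^ 2 * oddSeq s τ n := by
  have hsum := summable_aperyB_sq_oddSeq h.sqrtDecay hs
  refine ⟨hsum, ?_⟩
  obtain ⟨s, rfl⟩ := Nat.exists_eq_add_of_le' hs
  obtain ⟨c, hc, hA⟩ := h.exists_isAnglePrimitive
  obtain ⟨c₁, hc₁, h₁⟩ := hA.exists_oddSeq h.sqrtDecay hc s
  obtain ⟨φ, hφ, hφ'⟩ := exists_angle_form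
  obtain ⟨c', hc', hd⟩ := exists_conv_primitive hc₁ (by omega) hφ
  obtain ⟨v, hv, hlim⟩ := exists_tendsto_psum_one hc'
  have hdec := sqrtDecay_oddSeq h.sqrtDecay (s := s + 2) (by omega)
  obtain ⟨C, hC⟩ := hdec.exists_aperyB_mul_le
  have he : IsParitySeq (w + (s + 2)) (oddSeq (s + 2) τ) := .odd _ _ h (by omega) rfl
  have hterm : ∀ n, aperyB n * oddSeq (s + 2) τ n * sinMoment sinDensity n 1 =
      aperyB n ^ 2 * oddSeq (s + 3) τ n := by
    intro n
    have h1 : (2 * (n : ℝ) + 1) ≠ 0 := by positivity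
    rw [sinMoment_sinDensity, oddSeq, oddSeq, pow_succ _ (s + 2)]
    field_simp
  have := tendsto_of_hasDerivAt_psum continuous_sinDensity (fun t ht => sinDensity_nonneg ht)
    (a := fun n => aperyB n * oddSeq (s + 2) τ n) (C := C)
    (fun n => mul_nonneg (aperyB_pos _).le (he.nonneg _)) hC
    (hsum.congr fun n => (hterm n).symm) (F := psum c') (fun t ht => ?_)
    (tendsto_psum_zero_of_mem (convPolylogSpan_le _ hc') (by omega))
  · have h2 := tendsto_nhds_unique hlim this
    simp_rw [hterm] at h2
    rw [← h2]
    exact hv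
  · refine (hd t ht).congr_deriv ?_
    have h2 := h₁ t ht
    rw [aperyGen] at h2
    simp only [sinDensity]
    rw [hφ' t ht]
    change _ = _ * psum (aperyCoeff (oddSeq (s + 2) τ)) _
    push_cast
    linear_combination (-(tanHalfDeriv t : ℂ)) * h2

/-! ### The series `∑ τ(n) (π / 2 - b_n² / (2n + 1))` -/

/-- The moment of sin^{2n} θ is π / (2 b_n), so the angle primitive at θ = π/2 is the sum. Its
single factor i survives and forces Gaussian coefficients. -/
theorem sumIn_pi_div_two_mul {w : ℕ} {τ : ℕ → ℝ} {c : ℕ → ℂ} (h : SqrtDecay τ)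
    (h0 : ∀ n, 0 ≤ τ n) (hA : IsAnglePrimitive τ c) (hc : c ∈ convPolylogSpan w) (hw : 1 ≤ w)
    (hs : Summable τ) : SumIn (gaussianSpan w) fun n => Real.pi / 2 * τ n := by
  refine ⟨hs.mul_left _, ?_⟩
  obtain ⟨v, hv, hlim⟩ := exists_tendsto_psum_one hc
  obtain ⟨C, hC⟩ := h.exists_aperyB_mul_le
  have hterm : ∀ n, aperyB n * τ n * sinMoment tanHalfDeriv n 1 = Real.pi / 2 * τ n := by
    intro n
    have := (aperyB_pos n).ne'
    rw [sinMoment_tanHalfDeriv]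
    field_simp
  have := tendsto_of_hasDerivAt_psum continuous_tanHalfDeriv (fun t _ => (tanHalfDeriv_pos t).le)
    (a := fun n => aperyB n * τ n) (C := C) (fun n => mul_nonneg (aperyB_pos _).le (h0 n)) hC
    ((hs.mul_left _).congr fun n => (hterm n).symm) hA
    (tendsto_I_mul_psum (convPolylogSpan_le _ hc) hw)
  have h2 := tendsto_nhds_unique (hlim.const_mul Complex.I) this
  simp_rw [hterm] at h2
  rw [← h2]
  exact I_mul_mem_gaussianSpan (CMZV_le_gaussianSpan le_rfl hv)

/-- The differences `π / 2 - b_n² / (2n + 1)`. -/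
def wallisDefect (n : ℕ) : ℝ := Real.pi / 2 - aperyB n ^ 2 / (2 * n + 1)

theorem wallisDefect_nonneg (n : ℕ) : 0 ≤ wallisDefect n := by
  rw [wallisDefect, aperyB_sq_div]
  linarith [Real.Wallis.W_le n]

theorem wallisDefect_le (n : ℕ) : wallisDefect n ≤ 1 / (n + 1) := by
  have h := Real.Wallis.le_W n
  have h1 : (0 : ℝ) < 2 * n + 2 := by positivity
  rw [wallisDefect, aperyB_sq_div]
  have h2 : Real.pi / 2 - (2 * (n : ℝ) + 1) / (2 * n + 2) * (Real.pi / 2) =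
      Real.pi / 4 * (1 / (n + 1)) := by
    field_simp
    ring
  have h3 : Real.pi / 4 * (1 / ((n : ℝ) + 1)) ≤ 1 * (1 / (n + 1)) := by
    gcongr
    linarith [Real.pi_le_four]
  linarith

theorem summable_mul_wallisDefect {τ : ℕ → ℝ} (h : SqrtDecay τ) :
    Summable fun n => τ n * wallisDefect n := by
  obtain ⟨C, hC, h⟩ := h
  refine summable_of_abs_le_sqrt (C := C) fun n => ?_
  rw [abs_mul, abs_of_nonneg (wallisDefect_nonneg n)]
  have h1 : 0 < √((n : ℝ) + 1) := by positivity
  calc _ ≤ C / √(n + 1) * (1 / (n + 1)) := by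
        have := wallisDefect_le n
        have := h n
        rw [Real.norm_eq_abs] at this
        have := wallisDefect_nonneg n
        gcongr
    _ = _ := by field_simp

theorem aperyB_mul_sinMoment_oneSubSinDensity (τ : ℕ → ℝ) (n : ℕ) :
    aperyB n * τ n * sinMoment oneSubSinDensity n 1 = τ n * wallisDefect n := by
  have := (aperyB_pos n).ne'
  rw [sinMoment_oneSubSinDensity, wallisDefect]
  field_simp

theorem exists_wallisDefect_primitive {τ : ℕ → ℝ} (h : SqrtDecay τ) (h0 : ∀ n, 0 ≤ τ n) :
    ∃ F : ℝ → ℂ, (∀ t ∈ Set.Ioo (0 : ℝ) 1,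
        HasDerivAt F (oneSubSinDensity t * aperyGen τ t) t) ∧
      Tendsto F (𝓝[>] 0) (𝓝 0) ∧
      Tendsto F (𝓝[<] 1) (𝓝 ((∑' n, τ n * wallisDefect n : ℝ) : ℂ)) := by
  obtain ⟨C, hC⟩ := h.exists_aperyB_mul_le
  have := exists_termwise_primitive continuous_oneSubSinDensity
    (fun t _ => oneSubSinDensity_nonneg t) (a := fun n => aperyB n * τ n) (C := C)
    (fun n => mul_nonneg (aperyB_pos _).le (h0 n)) hC
    ((summable_mul_wallisDefect h).congr fun n =>
      (aperyB_mul_sinMoment_oneSubSinDensity τ n).symm)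
  simp_rw [aperyB_mul_sinMoment_oneSubSinDensity] at this
  exact this

theorem tsum_wallisDefect_eq_of_tendsto {τ : ℕ → ℝ} (h : SqrtDecay τ) (h0 : ∀ n, 0 ≤ τ n)
    {F : ℝ → ℂ} (hF : ∀ t ∈ Set.Ioo (0 : ℝ) 1,
      HasDerivAt F (oneSubSinDensity t * aperyGen τ t) t)
    (hF0 : Tendsto F (𝓝[>] 0) (𝓝 0)) {v : ℂ} (hv : Tendsto F (𝓝[<] 1) (𝓝 v)) :
    ((∑' n, τ n * wallisDefect n : ℝ) : ℂ) = v := by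
  obtain ⟨G, hG, hG0, hG1⟩ := exists_wallisDefect_primitive h h0
  refine tendsto_nhds_unique hG1 (hv.congr' ?_)
  filter_upwards [Ioo_mem_nhdsLT (show (0 : ℝ) < 1 by norm_num)] with t ht
  exact eqOn_Ioo_of_hasDerivAt hF hG hF0 hG0 ht

/-- Bounded coefficients allow growth at most 1 / (1 - t), which the double zero of 1 - sin θ at t =
1 overcomes. -/
theorem tendsto_one_sub_sin_mul_psum {w : ℕ} {c : ℕ → ℂ} (h : c ∈ polylogSpan w) :
    Tendsto (fun t => ((tanHalfSin t : ℂ) - 1) * (Complex.I * psum c t)) (𝓝[<] 1) (𝓝 0) := by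
  obtain ⟨C, hC⟩ := norm_le_of_mem_polylogSpan h
  rw [tendsto_zero_iff_norm_tendsto_zero]
  have h1 : Tendsto (fun t : ℝ => C * (1 - t)) (𝓝[<] 1) (𝓝 0) := by
    have : Tendsto (fun t : ℝ => C * (1 - t)) (𝓝 1) (𝓝 (C * (1 - 1))) :=
      Continuous.tendsto (by fun_prop) 1
    rw [sub_self, mul_zero] at this
    exact this.mono_left nhdsWithin_le_nhds
  refine tendsto_of_tendsto_of_tendsto_of_le_of_le' tendsto_const_nhds h1
    (Eventually.of_forall fun _ => norm_nonneg _) ?_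
  filter_upwards [Ioo_mem_nhdsLT (show (0 : ℝ) < 1 by norm_num)] with t ht
  have ht1 : 0 < 1 - t := sub_pos.2 ht.2
  have h2 : ‖psum c t‖ ≤ C * (1 - t)⁻¹ := by
    refine tsum_of_norm_bounded ((hasSum_geometric_of_lt_one ht.1.le ht.2).mul_left C) fun n => ?_
    rw [norm_mul, norm_pow, Complex.norm_real, Real.norm_of_nonneg ht.1.le]
    exact mul_le_mul_of_nonneg_right (hC n) (pow_nonneg ht.1.le n)
  have h3 : ‖(tanHalfSin t : ℂ) - 1‖ ≤ (1 - t) ^ 2 := by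
    rw [show (tanHalfSin t : ℂ) - 1 = ((-(1 - tanHalfSin t) : ℝ) : ℂ) by push_cast; ring,
      Complex.norm_real, norm_neg, one_sub_tanHalfSin, Real.norm_of_nonneg (by positivity)]
    exact div_le_self (by positivity) (by nlinarith [sq_nonneg t])
  rw [norm_mul, norm_mul, Complex.norm_I, one_mul]
  calc _ ≤ (1 - t) ^ 2 * (C * (1 - t)⁻¹) := by gcongr
    _ = C * (1 - t) := by field_simp

/-- Here ∑ evenSeq 1 τ need not converge by itself, so the two halves of the defect are integrated
together. With A the angle primitive, (1 - sin θ) tan θ A = ((sin θ - 1) / cos θ) A + cos θ A. The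
last term is integrated by parts, giving (sin θ - 1) A and the same problem for `τ`. -/
theorem sumIn_evenSeq_one_mul_wallisDefect {w : ℕ} {τ : ℕ → ℝ} (h : IsParitySeq w τ)
    (hτ : SumIn (gaussianSpan (w + 1)) fun n => τ n * wallisDefect n) :
    SumIn (gaussianSpan (w + 2)) fun n => evenSeq 1 τ n * wallisDefect n := by
  have he : IsParitySeq (w + 1) (evenSeq 1 τ) := .even _ _ h le_rfl rfl
  refine ⟨summable_mul_wallisDefect he.sqrtDecay, ?_⟩
  obtain ⟨c, hc, hA⟩ := h.exists_isAnglePrimitive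
  obtain ⟨φ, hφ, hφ'⟩ := exists_tan_sub_sec_form
  obtain ⟨c', hc', hd⟩ := exists_conv_primitive hc (by omega) hφ
  obtain ⟨v, hv, hlim⟩ := exists_tendsto_psum_one hc'
  obtain ⟨F, hF, hF0, hF1⟩ := exists_wallisDefect_primitive h.sqrtDecay h.nonneg
  rw [tsum_wallisDefect_eq_of_tendsto he.sqrtDecay he.nonneg (F := fun t =>
    Complex.I * psum c' t + ((tanHalfSin t : ℂ) - 1) * (Complex.I * psum c t) + F t)
    (v := Complex.I * v + 0 + ((∑' n, τ n * wallisDefect n : ℝ) : ℂ)) (fun t ht => ?_) ?_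
    (((hlim.const_mul _).add (tendsto_one_sub_sin_mul_psum hc)).add hF1)]
  · rw [add_zero]
    exact Submodule.add_mem _ (I_mul_mem_gaussianSpan (CMZV_le_gaussianSpan le_rfl hv))
      (gaussianSpan_mono (by omega) hτ.2)
  · have h4 := ((tendsto_I_mul_psum (convPolylogSpan_le _ hc') (by omega)).add
      ((tendsto_ofReal_tanHalfSin_zero.sub_const 1).mul (tendsto_I_mul_psum hc (by omega)))).add hF0
    simpa using h4
  · refine ((((hd t ht).const_mul Complex.I).add
      (((hasDerivAt_ofReal (hasDerivAt_tanHalfSin t)).sub_const 1).mul (hA t ht))).add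
      (hF t ht)).congr_deriv ?_
    rw [hφ' t ht, hA.evenSeq_one h.sqrtDecay hc ht]
    have h2 := tanHalfCos_ne_zero ht
    have h3 : (tanHalfSin t : ℂ) ^ 2 + tanHalfCos t ^ 2 = 1 := by
      exact_mod_cast tanHalf_sq_add_sq t
    simp only [oneSubSinDensity]
    push_cast
    field_simp
    linear_combination (tanHalfDeriv t * Complex.I * psum c t) * h3

/-- The integrand is A (1 - sin θ) / (sin θ cos θ) with A the angle primitive, a single integration
without the letter 1; no recursion is needed. -/
theorem sumIn_oddSeq_one_mul_wallisDefect {w : ℕ} {τ : ℕ → ℝ} (h : IsParitySeq w τ) :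
    SumIn (gaussianSpan (w + 2)) fun n => oddSeq 1 τ n * wallisDefect n := by
  have he : IsParitySeq (w + 1) (oddSeq 1 τ) := .odd _ _ h le_rfl rfl
  refine ⟨summable_mul_wallisDefect he.sqrtDecay, ?_⟩
  obtain ⟨c, hc, hA⟩ := h.exists_isAnglePrimitive
  obtain ⟨φ, hφ, hφ'⟩ := exists_csc_sec_sub_sec_form
  obtain ⟨c', hc', hd⟩ := exists_conv_primitive hc (by omega) hφ
  obtain ⟨v, hv, hlim⟩ := exists_tendsto_psum_one hc'
  rw [tsum_wallisDefect_eq_of_tendsto he.sqrtDecay he.nonneg (F := fun t => Complex.I * psum c' t)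
    (fun t ht => ?_) (tendsto_I_mul_psum (convPolylogSpan_le _ hc') (by omega))
    (hlim.const_mul _)]
  · exact I_mul_mem_gaussianSpan (CMZV_le_gaussianSpan le_rfl hv)
  · refine ((hd t ht).const_mul Complex.I).congr_deriv ?_
    rw [hφ' t ht, hA.oddSeq_one h.sqrtDecay hc ht]
    simp only [oneSubSinDensity]
    push_cast
    ring

/-! ### Sequences with a mixed head -/

/-- The sequence of partial sums `∑_{m < n} τ(m)`. -/
def partialSum (τ : ℕ → ℝ) (n : ℕ) : ℝ := ∑ m ∈ Finset.range n, τ m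

theorem partialSum_zero (τ : ℕ → ℝ) : partialSum τ 0 = 0 := by simp [partialSum]

theorem partialSum_succ (τ : ℕ → ℝ) (n : ℕ) : partialSum τ (n + 1) = partialSum τ n + τ n :=
  Finset.sum_range_succ _ _

/-- `l(n)^{-a} l'(n)^{-b} ∑_{m < n} τ(m)`. -/
def mixedSeq (l l' : ParityForm) (a b : ℕ) (τ : ℕ → ℝ) (n : ℕ) : ℝ :=
  1 / l.eval n ^ a * (1 / l'.eval n ^ b) * partialSum τ n

theorem mixedSeq_apply_zero (l l' : ParityForm) (a b : ℕ) (τ : ℕ → ℝ) :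
    mixedSeq l l' a b τ 0 = 0 := by rw [mixedSeq, partialSum_zero, mul_zero]

theorem mixedSeq_comm (l l' : ParityForm) (a b : ℕ) (τ : ℕ → ℝ) :
    mixedSeq l l' a b τ = mixedSeq l' l b a τ := by
  funext n
  rw [mixedSeq, mixedSeq, mul_comm (1 / l.eval n ^ a)]

theorem mixedSeq_self (l : ParityForm) (a b : ℕ) (τ : ℕ → ℝ) (l' : ParityForm) :
    mixedSeq l l a b τ = mixedSeq l l' (a + b) 0 τ := by
  funext n
  rw [mixedSeq, mixedSeq, pow_add, pow_zero, one_div_mul_one_div, div_one, mul_one]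

theorem mixedSeq_zero_right (l l' l'' : ParityForm) (a : ℕ) (τ : ℕ → ℝ) :
    mixedSeq l l' a 0 τ = mixedSeq l l'' a 0 τ := by
  funext n
  simp [mixedSeq]

theorem mixedSeq_even (a : ℕ) (τ : ℕ → ℝ) (l : ParityForm) :
    mixedSeq .even l a 0 τ = evenSeq a τ := by
  funext n
  simp [mixedSeq, evenSeq, ParityForm.eval, partialSum]

theorem mixedSeq_odd (a : ℕ) (τ : ℕ → ℝ) (l : ParityForm) (n : ℕ) :
    mixedSeq l .oddPlus 0 a τ n = oddSeq a τ n - 1 / (2 * (n : ℝ) + 1) ^ a * τ n := by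
  rw [oddSeq, Finset.sum_range_succ]
  simp [mixedSeq, ParityForm.eval, partialSum]
  ring

theorem ParityForm.eval_ne_zero (l : ParityForm) {n : ℕ} (hn : n ≠ 0) : l.eval n ≠ 0 := by
  have hn' : (1 : ℝ) ≤ n := by exact_mod_cast Nat.one_le_iff_ne_zero.2 hn
  cases l <;> simp only [ParityForm.eval] <;> linarith

theorem mixedSeq_split {l l' : ParityForm} {δ : ℚ} (h : ∀ n, l'.eval n - l.eval n = δ) (hδ : δ ≠ 0)
    (a b : ℕ) (τ : ℕ → ℝ) (n : ℕ) : mixedSeq l l' (a + 1) (b + 1) τ n =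
      ((δ⁻¹ : ℚ) : ℝ) * (mixedSeq l l' (a + 1) b τ n - mixedSeq l l' a (b + 1) τ n) := by
  -- Partial fractions fail where 2n vanishes, but there the inner sum is empty.
  rcases eq_or_ne n 0 with rfl | hn
  · simp [mixedSeq_apply_zero]
  have h1 := l.eval_ne_zero hn
  have h2 := l'.eval_ne_zero hn
  have h3 : (δ : ℝ) ≠ 0 := by exact_mod_cast hδ
  have h4 := h n
  simp only [mixedSeq, pow_succ]
  push_cast
  field_simp
  linear_combination (-partialSum τ n) * h4

theorem eval_oddPlus_sub_even (n : ℕ) :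
    ParityForm.oddPlus.eval n - ParityForm.even.eval n = ((1 : ℚ) : ℝ) := by
  simp [ParityForm.eval]

theorem eval_even_sub_oddMinus (n : ℕ) :
    ParityForm.even.eval n - ParityForm.oddMinus.eval n = ((1 : ℚ) : ℝ) := by
  simp [ParityForm.eval]

theorem eval_oddPlus_sub_oddMinus (n : ℕ) :
    ParityForm.oddPlus.eval n - ParityForm.oddMinus.eval n = ((2 : ℚ) : ℝ) := by
  simp [ParityForm.eval]
  norm_num

/-- The series `∑ b_n² l(n)^{-a} l'(n)^{-b} ∑_{m < n} τ(m)` has its sum in `V`. -/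
def MixedIn (V : Submodule ℚ ℂ) (l l' : ParityForm) (a b : ℕ) (τ : ℕ → ℝ) : Prop :=
  SumIn V fun n => aperyB n ^ 2 * mixedSeq l l' a b τ n

theorem MixedIn.split {V : Submodule ℚ ℂ} {l l' : ParityForm} {δ : ℚ}
    (h : ∀ n, l'.eval n - l.eval n = δ) (hδ : δ ≠ 0) {a b : ℕ} {τ : ℕ → ℝ}
    (h1 : MixedIn V l l' (a + 1) b τ) (h2 : MixedIn V l l' a (b + 1) τ) :
    MixedIn V l l' (a + 1) (b + 1) τ := by
  refine ((SumIn.sub h1 h2).const_mul δ⁻¹).congr fun n => ?_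
  rw [mixedSeq_split h hδ]
  ring

theorem mixedIn_even {w a : ℕ} {τ : ℕ → ℝ} (h : IsParitySeq w τ) (ha : 3 ≤ a) (l : ParityForm) :
    MixedIn (CMZV 4 (w + a)) .even l a 0 τ := by
  rw [MixedIn, mixedSeq_even]
  exact sumIn_evenSeq h ha

theorem abs_partialSum_le {τ : ℕ → ℝ} (h : SqrtDecay τ) :
    ∃ C, ∀ n : ℕ, |partialSum τ n| ≤ C * √((n : ℝ) + 1) := h.exists_abs_sum_le

/-- Summation by parts against a sequence `D = O(1 / n)`. -/
theorem SumIn.of_telescope {V : Submodule ℚ ℂ} {τ D f : ℕ → ℝ} {C : ℝ} (h : SqrtDecay τ)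
    (hD : ∀ n : ℕ, |D n| ≤ C / (n + 1)) (hf0 : f 0 = 0)
    (hf : ∀ n, f (n + 1) = (D n - D (n + 1)) * partialSum τ (n + 1)) (hfs : Summable f)
    (hs : SumIn V fun n => τ n * D n) : SumIn V f := by
  refine ⟨hfs, ?_⟩
  have key : ∀ N, ∑ n ∈ Finset.range (N + 1), f n =
      ∑ n ∈ Finset.range N, τ n * D n - D N * partialSum τ N := by
    intro N
    induction N with
    | zero => simp [hf0, partialSum_zero]
    | succ N ih =>
      rw [Finset.sum_range_succ, ih, hf, Finset.sum_range_succ _ N, partialSum_succ]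
      ring
  obtain ⟨B, hB⟩ := abs_partialSum_le h
  have h0 : Tendsto (fun N => D N * partialSum τ N) atTop (𝓝 0) := by
    refine squeeze_zero_norm (a := fun N : ℕ => C * B * (1 / √((N : ℝ) + 1))) (fun N => ?_)
      (by simpa only [mul_zero] using tendsto_one_div_sqrt.const_mul (C * B))
    have hC : 0 ≤ C / ((N : ℝ) + 1) := (abs_nonneg _).trans (hD N)
    rw [norm_mul, Real.norm_eq_abs, Real.norm_eq_abs]
    calc _ ≤ C / (N + 1) * (B * √(N + 1)) := by gcongr; exacts [hD N, hB N]
      _ = _ := by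
        have h2 := Real.sq_sqrt (show 0 ≤ (N : ℝ) + 1 by positivity)
        have h3 : 0 < √((N : ℝ) + 1) := by positivity
        field_simp
        linear_combination (C * B) * h2
  have h1 := (tendsto_add_atTop_iff_nat 1).2 hfs.hasSum.tendsto_sum_nat
  simp_rw [key] at h1
  have h2 := hs.1.hasSum.tendsto_sum_nat.sub h0
  rw [sub_zero] at h2
  rw [tendsto_nhds_unique h1 h2]
  exact hs.2

theorem summable_mixedSeq {τ : ℕ → ℝ} (h : SqrtDecay τ) (l l' : ParityForm) {a b : ℕ}
    (hab : 3 ≤ a + b) : Summable fun n => aperyB n ^ 2 * mixedSeq l l' a b τ n :=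
  summable_aperyB_sq_eval h l l' hab

/-! ### Heads mixing 2n and 2n+1. -/

theorem aperyB_succ_eq (n : ℕ) : aperyB (n + 1) = (2 * n + 2) / (2 * n + 1) * aperyB n := by
  have h := aperyB_succ n
  have h1 : (2 * (n : ℝ) + 1) ≠ 0 := by positivity
  field_simp
  linear_combination h

/-- The term b_{n+1}² / ((2n+2)² (2n+3)) is the decrement of π/2 - b_n² / (2n+1) from n to n+1,
because (2n+2)² - (2n+1)(2n+3) = 1. The constant π/2 makes the boundary term vanish in the limit. -/
theorem mixedIn_two_one {V : Submodule ℚ ℂ} {τ : ℕ → ℝ} (h : SqrtDecay τ)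
    (hK : SumIn V fun n => τ n * wallisDefect n) : MixedIn V .even .oddPlus 2 1 τ := by
  refine SumIn.of_telescope (C := 1) h (fun n => ?_) ?_ (fun n => ?_)
    (summable_mixedSeq h _ _ (by norm_num)) hK
  · rw [abs_of_nonneg (wallisDefect_nonneg n)]
    exact wallisDefect_le n
  · rw [mixedSeq_apply_zero, mul_zero]
  · simp only [mixedSeq, wallisDefect, ParityForm.eval, aperyB_succ_eq n]
    push_cast
    rw [show 2 * ((n : ℝ) + 1) + 1 = 2 * n + 3 by ring, show 2 * ((n : ℝ) + 1) = 2 * n + 2 by ring]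
    have h1 : (2 * (n : ℝ) + 1) ≠ 0 := by positivity
    have h2 : (2 * (n : ℝ) + 2) ≠ 0 := by positivity
    have h3 : (2 * (n : ℝ) + 3) ≠ 0 := by positivity
    field_simp
    ring

theorem mixedIn_one_two {V : Submodule ℚ ℂ} {τ : ℕ → ℝ} (h : SqrtDecay τ)
    (hK : SumIn V fun n => τ n * wallisDefect n)
    (hL : SumIn V fun n => aperyB n ^ 2 * (1 / (2 * (n : ℝ) + 1) ^ 2 * τ n)) :
    MixedIn V .even .oddPlus 1 2 τ := by
  have hs := (summable_mixedSeq h .even .oddPlus (a := 2) (b := 1) (by norm_num)).add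
    (summable_mixedSeq h .even .oddPlus (a := 1) (b := 2) (by norm_num))
  -- The sum of the exponent patterns (2,1) and (1,2) telescopes with b_n² / (2n+1)², since 1/x² -
  -- 1/(x+1)² = 1/(x²(x+1)) + 1/(x(x+1)²).
  have key : SumIn V fun n => aperyB n ^ 2 * mixedSeq .even .oddPlus 2 1 τ n +
      aperyB n ^ 2 * mixedSeq .even .oddPlus 1 2 τ n := by
    refine SumIn.of_telescope (C := 4) (D := fun n => aperyB n ^ 2 * (1 / (2 * (n : ℝ) + 1) ^ 2)) h
      (fun n => ?_) ?_ (fun n => ?_) hs (hL.congr fun n => by ring)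
    · rw [abs_of_nonneg (by positivity), mul_one_div, div_le_div_iff₀ (by positivity) (by positivity)]
      have h0 := n.cast_nonneg (α := ℝ)
      calc _ ≤ 4 * ((n : ℝ) + 1) * (n + 1) := by gcongr; exact aperyB_sq_le n
        _ ≤ _ := by nlinarith
    · rw [mixedSeq_apply_zero, mixedSeq_apply_zero]
      ring
    · simp only [mixedSeq, ParityForm.eval, aperyB_succ_eq n]
      push_cast
      rw [show 2 * ((n : ℝ) + 1) + 1 = 2 * n + 3 by ring,
        show 2 * ((n : ℝ) + 1) = 2 * n + 2 by ring]
      have h1 : (2 * (n : ℝ) + 1) ≠ 0 := by positivity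
      have h2 : (2 * (n : ℝ) + 2) ≠ 0 := by positivity
      have h3 : (2 * (n : ℝ) + 3) ≠ 0 := by positivity
      field_simp
      ring
  refine (key.sub (mixedIn_two_one h hK)).congr fun n => ?_
  ring

theorem mixedIn_even_odd {w : ℕ} {τ : ℕ → ℝ} (h : IsParitySeq w τ)
    (hK : SumIn (gaussianSpan (w + 1)) fun n => τ n * wallisDefect n)
    (hL : ∀ b, 2 ≤ b → SumIn (gaussianSpan (w + b))
      fun n => aperyB n ^ 2 * (1 / (2 * (n : ℝ) + 1) ^ b * τ n)) {W : ℕ} :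
    ∀ a b, 3 ≤ a + b → w + a + b ≤ W → MixedIn (gaussianSpan W) .even .oddPlus a b τ
  | a, 0, hab, hW => SumIn.mono (mixedIn_even h (by omega) _) (CMZV_le_gaussianSpan (by omega))
  | 0, b + 1, hab, hW => by
    refine SumIn.congr ((SumIn.mono (sumIn_oddSeq h (s := b + 1) (by omega))
      (CMZV_le_gaussianSpan (by omega))).sub (SumIn.mono (hL (b + 1) (by omega))
      (gaussianSpan_mono (by omega)))) fun n => ?_
    rw [mixedSeq_odd]
    ring
  | a + 1, b + 1, hab, hW => by
    by_cases h3 : 3 ≤ a + b + 1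
    · exact MixedIn.split eval_oddPlus_sub_even one_ne_zero
        (mixedIn_even_odd h hK hL (a + 1) b (by omega) (by omega))
        (mixedIn_even_odd h hK hL a (b + 1) (by omega) (by omega))
    -- At total exponent 3 a further split would produce divergent series, so summation by parts
    -- takes over.
    · obtain ⟨rfl, rfl⟩ | ⟨rfl, rfl⟩ : a = 1 ∧ b = 0 ∨ a = 0 ∧ b = 1 := by omega
      · exact mixedIn_two_one h.sqrtDecay (hK.mono (gaussianSpan_mono (by omega)))
      · exact mixedIn_one_two h.sqrtDecay (hK.mono (gaussianSpan_mono (by omega)))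
          ((hL 2 le_rfl).mono (gaussianSpan_mono (by omega)))

theorem sumIn_single {V : Submodule ℚ ℂ} (hV : (1 : ℂ) ∈ V) (q : ℚ) (f : ℕ → ℝ) (h0 : f 0 = q) :
    SumIn V fun n => f n * unitSeq n := by
  have hz : ∀ n, n ≠ 0 → f n * (unitSeq n : ℝ) = 0 := fun n hn => by simp [unitSeq, hn]
  refine ⟨summable_of_ne_finset_zero (s := {0}) fun n hn => hz n (by simpa using hn), ?_⟩
  rw [tsum_eq_single 0 hz]
  have := V.smul_mem q hV
  simpa [unitSeq, h0, Rat.smul_def] using this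

theorem one_mem_gaussianSpan (w : ℕ) : (1 : ℂ) ∈ gaussianSpan w := by
  simpa using ratCast_mem_gaussianSpan 1 w

theorem summable_of_sqrtDecay_mul {r B : ℕ → ℝ} {C D : ℝ}
    (hr : ∀ n : ℕ, |r n| ≤ D / ((n : ℝ) + 1) ^ 2) (hB : ∀ n : ℕ, |B n| ≤ C * √(n + 1)) :
    Summable fun n => r n * B n := by
  refine summable_of_abs_le_sqrt (C := D * C) fun n => ?_
  have hD : 0 ≤ D := by simpa using (abs_nonneg _).trans (hr 0)
  have h1 : 0 < √((n : ℝ) + 1) := by positivity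
  rw [abs_mul]
  calc _ ≤ D / ((n : ℝ) + 1) ^ 2 * (C * √(n + 1)) := by
        have := hr n
        have := hB n
        gcongr
    _ = _ := by
        have h2 := Real.sq_sqrt (show 0 ≤ (n : ℝ) + 1 by positivity)
        field_simp
        linear_combination (D * C) * h2

theorem abs_inv_eval_pow_le_sq (l : ParityForm) {s : ℕ} (hs : 2 ≤ s) (n : ℕ) :
    |1 / l.eval n ^ s| ≤ 2 ^ s / ((n : ℝ) + 1) ^ 2 := by
  have h1 : (1 : ℝ) ≤ n + 1 := by linarith [n.cast_nonneg (α := ℝ)]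
  refine (abs_inv_eval_pow_le l s n).trans ?_
  gcongr

theorem summable_evenSeq {τ : ℕ → ℝ} (h : SqrtDecay τ) {s : ℕ} (hs : 2 ≤ s) :
    Summable (evenSeq s τ) := by
  obtain ⟨C, hC⟩ := h.exists_abs_sum_le
  exact summable_of_sqrtDecay_mul (abs_inv_eval_pow_le_sq .even hs) hC

theorem summable_oddSeq {τ : ℕ → ℝ} (h : SqrtDecay τ) {s : ℕ} (hs : 2 ≤ s) :
    Summable (oddSeq s τ) := by
  obtain ⟨C, hC, h⟩ := h.exists_norm_sum_le
  exact summable_of_sqrtDecay_mul (B := fun n => ∑ m ∈ Finset.range (n + 1), τ m) (C := C)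
    (abs_inv_eval_pow_le_sq .oddPlus hs) (fun n => by exact_mod_cast h (n + 1))

/-- The two claims are proved by one induction: a new head 2n makes them mixed series over the tail,
and these need both claims for the tail. Leading exponent at least 2 lets the defect be split into
two convergent series; exponent 1 is handled by integration. A new head 2n+1 merges with the extra
powers of 2n+1. -/
theorem sumIn_parity {w : ℕ} {τ : ℕ → ℝ} (h : IsParitySeq w τ) :
    (SumIn (gaussianSpan (w + 1)) fun n => τ n * wallisDefect n) ∧
    (∀ b, 2 ≤ b → SumIn (gaussianSpan (w + b))
      fun n => aperyB n ^ 2 * (1 / (2 * (n : ℝ) + 1) ^ b * τ n)) := by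
  induction h with
  | unit =>
    obtain ⟨c, hc, hA⟩ := exists_isAnglePrimitive_unit
    refine ⟨?_, fun b hb => ?_⟩
    · have hs : Summable (unitSeq : ℕ → ℝ) :=
        summable_of_ne_finset_zero (s := {0}) fun n hn => by
          have : n ≠ 0 := by simpa using hn
          simp [unitSeq, this]
      have h1 := sumIn_pi_div_two_mul sqrtDecay_unitSeq_real IsParitySeq.unit.nonneg hA hc le_rfl hs
      have h2 := sumIn_single (one_mem_gaussianSpan 1) 1
        (fun n => aperyB n ^ 2 / (2 * (n : ℝ) + 1)) (by simp [aperyB_zero])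
      refine (h1.sub h2).congr fun n => ?_
      rw [wallisDefect]
      ring
    · refine (sumIn_single (one_mem_gaussianSpan _) 1
        (fun n => aperyB n ^ 2 * (1 / (2 * (n : ℝ) + 1) ^ b)) (by simp [aperyB_zero])).congr
        fun n => by ring
  | @even w τ s w' h hs hw ih =>
    subst hw
    obtain ⟨c, hc, hA⟩ := h.exists_isAnglePrimitive
    have hM := fun W => mixedIn_even_odd h ih.1 ih.2 (W := W)
    refine ⟨?_, fun b hb => ?_⟩
    · rcases s with _ | _ | s
      · omega
      · exact sumIn_evenSeq_one_mul_wallisDefect h ih.1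
      · obtain ⟨c', hc', hA'⟩ := hA.evenSeq_two_add h.sqrtDecay hc s
        have he : IsParitySeq (w + (s + 2)) (evenSeq (s + 2) τ) := .even _ _ h (by omega) rfl
        have h1 := sumIn_pi_div_two_mul he.sqrtDecay he.nonneg hA' hc' (by omega)
          (summable_evenSeq h.sqrtDecay (by omega))
        refine (h1.sub (hM _ (s + 2) 1 (by omega) (by omega))).congr fun n => ?_
        simp only [wallisDefect, mixedSeq, evenSeq, ParityForm.eval, partialSum]
        ring
    · refine (hM _ s b (by omega) (by omega)).congr fun n => ?_
      simp only [mixedSeq, evenSeq, ParityForm.eval, partialSum]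
      ring
  | @odd w τ s w' h hs hw ih =>
    subst hw
    obtain ⟨c, hc, hA⟩ := h.exists_isAnglePrimitive
    refine ⟨?_, fun b hb => ?_⟩
    · rcases s with _ | _ | s
      · omega
      · exact sumIn_oddSeq_one_mul_wallisDefect h
      · obtain ⟨c', hc', hA'⟩ := hA.oddSeq_two_add h.sqrtDecay hc s
        have he : IsParitySeq (w + (s + 2)) (oddSeq (s + 2) τ) := .odd _ _ h (by omega) rfl
        have h1 := sumIn_pi_div_two_mul he.sqrtDecay he.nonneg hA' hc' (by omega)
          (summable_oddSeq h.sqrtDecay (by omega))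
        refine (h1.sub ((sumIn_oddSeq h (s := s + 3) (by omega)).mono
          (CMZV_le_gaussianSpan (by omega)))).congr fun n => ?_
        simp only [wallisDefect, oddSeq, pow_succ]
        field_simp
    · refine ((sumIn_oddSeq h (s := s + b) (by omega)).mono
        (CMZV_le_gaussianSpan (by omega))).congr fun n => ?_
      simp only [oddSeq, pow_add]
      field_simp

theorem IsParitySeq.mixedIn_even_odd {w W : ℕ} {τ : ℕ → ℝ} (h : IsParitySeq w τ) (a b : ℕ)
    (hab : 3 ≤ a + b) (hW : w + a + b ≤ W) : MixedIn (gaussianSpan W) .even .oddPlus a b τ :=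
  _root_.mixedIn_even_odd h (sumIn_parity h).1 (sumIn_parity h).2 a b hab hW

theorem sumIn_succ_sq_mul_oddSeq {V : Submodule ℚ ℂ} {s : ℕ} {τ : ℕ → ℝ}
    (h0 : SumIn V fun n => aperyB n ^ 2 * oddSeq s τ n)
    (h1 : SumIn V fun n => aperyB n ^ 2 * oddSeq (s + 1) τ n)
    (h2 : SumIn V fun n => aperyB n ^ 2 * oddSeq (s + 2) τ n) :
    SumIn V fun n => aperyB (n + 1) ^ 2 * oddSeq s τ n := by
  refine ((h0.add (h1.const_mul 2)).add h2).congr fun n => ?_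
  rw [aperyB_succ_eq]
  simp only [oddSeq, pow_succ]
  have h1 : (2 * (n : ℝ) + 1) ≠ 0 := by positivity
  push_cast
  field_simp
  ring

theorem mixedSeq_oddMinus_succ (a b : ℕ) (τ : ℕ → ℝ) (n : ℕ) :
    mixedSeq .oddMinus .even a b τ (n + 1) = 1 / (2 * (n : ℝ) + 2) ^ b * oddSeq a τ n := by
  simp only [mixedSeq, oddSeq, ParityForm.eval, partialSum]
  push_cast
  rw [show 2 * ((n : ℝ) + 1) - 1 = 2 * n + 1 by ring, show 2 * ((n : ℝ) + 1) = 2 * n + 2 by ring]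
  ring

/-- After n ↦ n+1 the factor b_{n+1}² = b_n² (2n+2)² / (2n+1)² cancels up to two powers of the even
form, leaving pure powers of 2n+1 with exponent between a and a + 2. Hence the bound w + a + 2 on
the weight. Higher even powers are first lowered by partial fractions. -/
theorem IsParitySeq.mixedIn_oddMinus_even {w W : ℕ} {τ : ℕ → ℝ} (h : IsParitySeq w τ) :
    ∀ a b, 1 ≤ a → 3 ≤ a + b → w + a + b ≤ W → w + a + 2 ≤ W →
      MixedIn (gaussianSpan W) .oddMinus .even a b τ := by
  have hO : ∀ s, 3 ≤ s → w + s ≤ W →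
      SumIn (gaussianSpan W) fun n => aperyB n ^ 2 * oddSeq s τ n := fun s h1 h2 =>
    (sumIn_oddSeq h h1).mono (CMZV_le_gaussianSpan h2)
  have hz : ∀ a b, ((aperyB 0 ^ 2 * mixedSeq .oddMinus .even a b τ 0 : ℝ) : ℂ) ∈ gaussianSpan W :=
    fun a b => by simp [mixedSeq_apply_zero]
  intro a b
  induction b using Nat.strong_induction_on generalizing a with
  | _ b ihb =>
    intro ha hab h1 h2
    by_cases hb : b ≤ 2
    · refine SumIn.of_succ ?_ (hz a b)
      simp_rw [mixedSeq_oddMinus_succ]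
      -- The remaining numerator (2n+2)^{2-b} is expanded in powers of 2n+1.
      interval_cases b
      · refine (sumIn_succ_sq_mul_oddSeq (hO a (by omega) (by omega)) (hO (a + 1) (by omega) (by omega))
          (hO (a + 2) (by omega) (by omega))).congr fun n => by simp
      · refine ((hO (a + 1) (by omega) (by omega)).add (hO (a + 2) (by omega) (by omega))).congr
          fun n => ?_
        rw [aperyB_succ_eq]
        simp only [oddSeq, pow_succ]
        have h1 : (2 * (n : ℝ) + 1) ≠ 0 := by positivity
        field_simp
        ring
      · refine (hO (a + 2) (by omega) (by omega)).congr fun n => ?_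
        rw [aperyB_succ_eq]
        simp only [oddSeq, pow_succ]
        have h1 : (2 * (n : ℝ) + 1) ≠ 0 := by positivity
        field_simp
    · obtain ⟨b, rfl⟩ : ∃ b', b = b' + 3 := ⟨b - 3, by omega⟩
      clear hb
      induction a with
      | zero => omega
      | succ a iha =>
        refine MixedIn.split eval_even_sub_oddMinus one_ne_zero
          (ihb (b + 2) (by omega) (a + 1) (by omega) (by omega) (by omega) (by omega)) ?_
        rcases Nat.eq_zero_or_pos a with rfl | ha'
        · rw [MixedIn, mixedSeq_comm]
          exact SumIn.mono (mixedIn_even h (by omega) _) (CMZV_le_gaussianSpan (by omega))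
        · exact iha ha' (by omega) (by omega) (by omega)

theorem IsParitySeq.mixedIn_oddMinus_odd {w W : ℕ} {τ : ℕ → ℝ} (h : IsParitySeq w τ) :
    ∀ a c, 3 ≤ a + c → w + a + c ≤ W → (1 ≤ a → w + a + 2 ≤ W) →
      MixedIn (gaussianSpan W) .oddMinus .oddPlus a c τ
  | a, 0, h1, h2, h3 => by
    rw [MixedIn, mixedSeq_zero_right _ _ .even]
    exact h.mixedIn_oddMinus_even a 0 (by omega) h1 h2 (h3 (by omega))
  | 0, c + 1, h1, h2, h3 => by
    rw [MixedIn, mixedSeq_comm, mixedSeq_zero_right _ _ .even, mixedSeq_comm]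
    exact h.mixedIn_even_odd 0 (c + 1) h1 h2
  | a + 1, c + 1, h1, h2, h3 => by
    have h3 := h3 (by omega)
    by_cases h4 : 3 ≤ a + c + 1
    · exact MixedIn.split eval_oddPlus_sub_oddMinus two_ne_zero
        (h.mixedIn_oddMinus_odd (a + 1) c (by omega) (by omega) (by omega))
        (h.mixedIn_oddMinus_odd a (c + 1) (by omega) (by omega) (by omega))
    -- With x = 2n, total exponent 3 is reached through the even form: 1/((x-1)x²) + 1/(x²(x+1)) =
    -- 2/(x(x²-1)). Adding half of 1/((x-1)²x) or of 1/(x(x+1)²) to a quarter of this gives the two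
    -- patterns without a divergent piece.
    · have hN := h.mixedIn_oddMinus_even (W := W) 1 2 le_rfl le_rfl (by omega) (by omega)
      have hM := h.mixedIn_even_odd (W := W) 2 1 le_rfl (by omega)
      obtain ⟨rfl, rfl⟩ | ⟨rfl, rfl⟩ : a = 1 ∧ c = 0 ∨ a = 0 ∧ c = 1 := by omega
      · have hN' := h.mixedIn_oddMinus_even (W := W) 2 1 (by omega) le_rfl (by omega) (by omega)
        refine SumIn.congr ((SumIn.const_mul (1 / 2) hN').add ((SumIn.add hN hM).const_mul (1 / 4)))
          fun n => ?_
        rcases eq_or_ne n 0 with rfl | hn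
        · simp [mixedSeq_apply_zero]
        have e1 := ParityForm.oddMinus.eval_ne_zero hn
        have e2 := ParityForm.oddPlus.eval_ne_zero hn
        have e3 := ParityForm.even.eval_ne_zero hn
        simp only [mixedSeq]
        simp only [ParityForm.eval] at e1 e2 e3 ⊢
        push_cast
        field_simp
        ring
      · have hM' := h.mixedIn_even_odd (W := W) 1 2 le_rfl (by omega)
        refine SumIn.congr ((SumIn.const_mul (1 / 2) hM').add ((SumIn.add hN hM).const_mul (1 / 4)))
          fun n => ?_
        rcases eq_or_ne n 0 with rfl | hn
        · simp [mixedSeq_apply_zero]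
        have e1 := ParityForm.oddMinus.eval_ne_zero hn
        have e2 := ParityForm.oddPlus.eval_ne_zero hn
        have e3 := ParityForm.even.eval_ne_zero hn
        simp only [mixedSeq]
        simp only [ParityForm.eval] at e1 e2 e3 ⊢
        push_cast
        field_simp
        ring

/-- A form 2n-1 in the second place costs nothing: its bound exceeds its own exponent by 2, which is
covered by a ≥ 3. Only the leading form can raise the weight. -/
theorem IsParitySeq.mixedIn {w W : ℕ} {τ : ℕ → ℝ} (h : IsParitySeq w τ) (l l' : ParityForm)
    {a b : ℕ} (ha : 3 ≤ a) (hW : w + a + b + 2 * l.nu ≤ W) :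
    MixedIn (gaussianSpan W) l l' a b τ := by
  cases l <;> cases l' <;> simp only [ParityForm.nu] at hW
  · rw [MixedIn, mixedSeq_self _ _ _ _ .oddPlus]
    exact h.mixedIn_even_odd _ _ (by omega) (by omega)
  · exact h.mixedIn_even_odd _ _ (by omega) (by omega)
  · rcases Nat.eq_zero_or_pos b with rfl | hb
    · rw [MixedIn, mixedSeq_zero_right _ _ .oddPlus]
      exact h.mixedIn_even_odd _ _ (by omega) (by omega)
    · rw [MixedIn, mixedSeq_comm]
      exact h.mixedIn_oddMinus_even _ _ hb (by omega) (by omega) (by omega)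
  · rw [MixedIn, mixedSeq_comm]
    exact h.mixedIn_even_odd _ _ (by omega) (by omega)
  · rw [MixedIn, mixedSeq_self _ _ _ _ .even, mixedSeq_comm]
    exact h.mixedIn_even_odd _ _ (by omega) (by omega)
  · rw [MixedIn, mixedSeq_comm]
    exact h.mixedIn_oddMinus_odd _ _ (by omega) (by omega) (by omega)
  · exact h.mixedIn_oddMinus_even _ _ (by omega) (by omega) (by omega) (by omega)
  · exact h.mixedIn_oddMinus_odd _ _ (by omega) (by omega) (by omega)
  · rw [MixedIn, mixedSeq_self _ _ _ _ .even]
    exact h.mixedIn_oddMinus_even _ _ (by omega) (by omega) (by omega) (by omega)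

/-! ### The general nested sums -/

/-- The sequence `l(n)^{-a} ∑_{m < n} τ(m)`. -/
def formSeq (l : ParityForm) (a : ℕ) (τ : ℕ → ℝ) (n : ℕ) : ℝ := 1 / l.eval n ^ a * partialSum τ n

theorem mixedSeq_eq_formSeq (l l' : ParityForm) (a : ℕ) (τ : ℕ → ℝ) :
    mixedSeq l l' a 0 τ = formSeq l a τ := by
  funext n
  simp [mixedSeq, formSeq]

/-- The rational span of the standard nested sums of weight at most `w`. -/
def paritySpan (w : ℕ) : Submodule ℚ (ℕ → ℝ) :=
  Submodule.span ℚ {τ | ∃ k ≤ w, IsParitySeq k τ}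

/-- The rational span of `unitSeq` and of the sequences `formSeq l a τ` of weight at most `w`. -/
def innerSpan (w : ℕ) : Submodule ℚ (ℕ → ℝ) :=
  Submodule.span ℚ {f | f = unitSeq ∨
    ∃ l a τ k, IsParitySeq k τ ∧ a + k ≤ w ∧ f = formSeq l a τ}

/-- As `innerSpan`, with `1 ≤ a`. -/
def outerSpan (w : ℕ) : Submodule ℚ (ℕ → ℝ) :=
  Submodule.span ℚ {f | f = unitSeq ∨
    ∃ l a τ k, 1 ≤ a ∧ IsParitySeq k τ ∧ a + k ≤ w ∧ f = formSeq l a τ}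

theorem outerSpan_le_innerSpan (w : ℕ) : outerSpan w ≤ innerSpan w := by
  refine Submodule.span_mono ?_
  rintro f (h | ⟨l, a, τ, k, _, h⟩)
  · exact .inl h
  · exact .inr ⟨l, a, τ, k, h⟩

theorem unitSeq_mem_outerSpan (w : ℕ) : unitSeq ∈ outerSpan w := Submodule.subset_span (.inl rfl)

theorem IsParitySeq.mem_paritySpan {w k : ℕ} {τ : ℕ → ℝ} (h : IsParitySeq k τ) (hk : k ≤ w) :
    τ ∈ paritySpan w := Submodule.subset_span ⟨k, hk, h⟩

theorem paritySpan_mono {w w' : ℕ} (h : w ≤ w') : paritySpan w ≤ paritySpan w' :=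
  Submodule.span_mono fun _ ⟨k, hk, h'⟩ => ⟨k, hk.trans h, h'⟩

/-! ### Reduction of arbitrary chains to standard sums, with weights only bounded above. -/

theorem exists_eval_sub (l l' : ParityForm) (h : l ≠ l') :
    ∃ δ : ℚ, δ ≠ 0 ∧ ∀ n, l'.eval n - l.eval n = δ := by
  cases l <;> cases l' <;> first | exact absurd rfl h | skip
  · exact ⟨1, by norm_num, fun n => by simp [ParityForm.eval]⟩
  · exact ⟨-1, by norm_num, fun n => by simp [ParityForm.eval]⟩
  · exact ⟨-1, by norm_num, fun n => by simp [ParityForm.eval]⟩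
  · exact ⟨-2, by norm_num, fun n => by simp [ParityForm.eval]; ring⟩
  · exact ⟨1, by norm_num, fun n => by simp [ParityForm.eval]⟩
  · exact ⟨2, by norm_num, fun n => by simp [ParityForm.eval]; norm_num⟩

theorem mixedSeq_mem_of_split {V : Submodule ℚ (ℕ → ℝ)} {l l' : ParityForm} (hl : l ≠ l') {a b : ℕ}
    {τ : ℕ → ℝ} (h1 : mixedSeq l l' (a + 1) b τ ∈ V) (h2 : mixedSeq l l' a (b + 1) τ ∈ V) :
    mixedSeq l l' (a + 1) (b + 1) τ ∈ V := by
  obtain ⟨δ, hδ, h⟩ := exists_eval_sub l l' hl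
  convert V.smul_mem δ⁻¹ (V.sub_mem h1 h2) using 1
  funext n
  rw [mixedSeq_split h hδ, Pi.smul_apply, Pi.sub_apply, Rat.smul_def]

theorem mixedSeq_mem_outerSpan {k w : ℕ} {τ : ℕ → ℝ} (h : IsParitySeq k τ) {l l' : ParityForm}
    (hl : l ≠ l') : ∀ a b, 1 ≤ a + b → a + b + k ≤ w → mixedSeq l l' a b τ ∈ outerSpan w
  | a, 0, h1, h2 => by
    rw [mixedSeq_eq_formSeq]
    exact Submodule.subset_span (.inr ⟨l, a, τ, k, by omega, h, by omega, rfl⟩)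
  | 0, b + 1, h1, h2 => by
    rw [mixedSeq_comm, mixedSeq_eq_formSeq]
    exact Submodule.subset_span (.inr ⟨l', b + 1, τ, k, by omega, h, by omega, rfl⟩)
  | a + 1, b + 1, h1, h2 => mixedSeq_mem_of_split hl
      (mixedSeq_mem_outerSpan h hl (a + 1) b (by omega) (by omega))
      (mixedSeq_mem_outerSpan h hl a (b + 1) (by omega) (by omega))

theorem mul_mem_outerSpan {w s : ℕ} {f : ℕ → ℝ} (hf : f ∈ innerSpan w) (l : ParityForm)
    (hs : 1 ≤ s) : (fun n => 1 / l.eval n ^ s * f n) ∈ outerSpan (w + s) := by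
  induction hf using Submodule.span_induction with
  | mem f hf =>
    obtain rfl | ⟨l', a, τ, k, h, hk, rfl⟩ := hf
    -- Only `n = 0` matters. There 1/0 = 0 for the form 2n, and the other forms take the values 1
    -- and -1.
    · have : (fun n => 1 / l.eval n ^ s * (unitSeq n : ℝ)) =
          (match l with | .even => 0 | .oddPlus => 1 | .oddMinus => (-1) ^ s : ℚ) • unitSeq := by
        funext n
        rcases eq_or_ne n 0 with rfl | hn
        · cases l
          · have : s ≠ 0 := by omega
            simp [ParityForm.eval, this]
          · simp [ParityForm.eval, unitSeq]
          · rcases neg_one_pow_eq_or ℝ s with h | h <;>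
              simp [ParityForm.eval, unitSeq, Rat.smul_def, h]
        · simp [unitSeq, hn]
      rw [this]
      exact Submodule.smul_mem _ _ (unitSeq_mem_outerSpan _)
    · have e : (fun n => 1 / l.eval n ^ s * formSeq l' a τ n) = mixedSeq l l' s a τ := by
        funext n
        rw [mixedSeq, formSeq, mul_assoc]
      rw [e]
      by_cases hl : l = l'
      · rw [hl, mixedSeq_self _ _ _ _ l', mixedSeq_eq_formSeq]
        exact Submodule.subset_span (.inr ⟨l', s + a, τ, k, by omega, h, by omega, rfl⟩)
      · exact mixedSeq_mem_outerSpan h hl s a (by omega) (by omega)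
  | zero =>
    convert (outerSpan (w + s)).zero_mem using 1
    funext n
    simp
  | add f g _ _ h h' =>
    convert (outerSpan (w + s)).add_mem h h' using 1
    funext n
    simp [mul_add]
  | smul q f _ h =>
    convert (outerSpan (w + s)).smul_mem q h using 1
    funext n
    simp [Rat.smul_def]
    ring

theorem formSeq_oddPlus (a : ℕ) (τ : ℕ → ℝ) :
    formSeq .oddPlus a τ = oddSeq a τ - fun n : ℕ => 1 / (2 * (n : ℝ) + 1) ^ a * τ n := by
  funext n
  rw [Pi.sub_apply, ← mixedSeq_odd a τ .even, mixedSeq_comm, mixedSeq_eq_formSeq]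

/-- A head 2n+1 absorbs the factor. Against a head 2n partial fractions leave pure powers; a pure
power of 2n+1 over a strict sum is a standard odd sum minus its diagonal, and the diagonal is the
same claim for the shorter tail. -/
theorem IsParitySeq.mul_mem_paritySpan {k a : ℕ} {τ : ℕ → ℝ} (h : IsParitySeq k τ) (ha : 1 ≤ a) :
    (fun n : ℕ => 1 / (2 * (n : ℝ) + 1) ^ a * τ n) ∈ paritySpan (k + a) := by
  induction h generalizing a with
  | unit =>
    convert IsParitySeq.unit.mem_paritySpan (Nat.zero_le _) using 1
    funext n
    rcases eq_or_ne n 0 with rfl | hn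
    · simp
    · simp [unitSeq, hn]
  | @even w τ s w' h hs hw ih =>
    have key : ∀ b a, 1 ≤ b + a → b + a ≤ s + a →
        ∀ W, w + b + a ≤ W → mixedSeq .even .oddPlus b a τ ∈ paritySpan W := by
      intro b a
      induction a generalizing b with
      | zero =>
        intro h1 _ W hW
        rw [mixedSeq_even]
        exact (IsParitySeq.even b _ h (by omega) rfl).mem_paritySpan (by omega)
      | succ a iha =>
        induction b with
        | zero =>
          intro _ _ W hW
          rw [mixedSeq_comm, mixedSeq_eq_formSeq, formSeq_oddPlus]
          exact Submodule.sub_mem _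
            ((IsParitySeq.odd (a + 1) _ h (by omega) rfl).mem_paritySpan (by omega))
            (paritySpan_mono (by omega) (ih (a := a + 1) (by omega)))
        | succ b ihb =>
          intro h1 h2 W hW
          exact mixedSeq_mem_of_split (by simp)
            (iha (b + 1) (by omega) (by omega) W (by omega))
            (ihb (by omega) (by omega) W (by omega))
    convert key s a (by omega) le_rfl (w' + a) (by omega) using 1
    funext n
    simp only [mixedSeq, evenSeq, ParityForm.eval, partialSum]
    ring
  | @odd w τ s w' h hs hw ih =>
    convert (IsParitySeq.odd (s + a) _ h (by omega) rfl).mem_paritySpan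
      (show w + (s + a) ≤ w' + a by omega) using 1
    funext n
    simp only [oddSeq, pow_add]
    field_simp

theorem partialSum_add (f g : ℕ → ℝ) : partialSum (f + g) = partialSum f + partialSum g := by
  funext n
  simp [partialSum, Finset.sum_add_distrib]

theorem partialSum_smul (q : ℚ) (f : ℕ → ℝ) : partialSum (q • f) = q • partialSum f := by
  funext n
  simp [partialSum, Rat.smul_def, Finset.mul_sum]

theorem partialSum_zero_fun : partialSum 0 = 0 := by
  funext n
  simp [partialSum]

theorem IsParitySeq.partialSum_mem {k w : ℕ} {τ : ℕ → ℝ} (h : IsParitySeq k τ) (hk : k ≤ w) :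
    partialSum τ ∈ innerSpan w :=
  Submodule.subset_span (.inr ⟨.even, 0, τ, k, h, by omega, by funext n; simp [formSeq]⟩)

theorem partialSum_mem_of_paritySpan {w : ℕ} {f : ℕ → ℝ} (hf : f ∈ paritySpan w) :
    partialSum f ∈ innerSpan w := by
  induction hf using Submodule.span_induction with
  | mem f hf =>
    obtain ⟨k, hk, h⟩ := hf
    exact h.partialSum_mem hk
  | zero => rw [partialSum_zero_fun]; exact Submodule.zero_mem _
  | add f g _ _ h h' => rw [partialSum_add]; exact Submodule.add_mem _ h h'
  | smul q f _ h => rw [partialSum_smul]; exact Submodule.smul_mem _ _ h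

theorem formSeq_oddMinus_succ (a : ℕ) (τ : ℕ → ℝ) (n : ℕ) :
    formSeq .oddMinus a τ (n + 1) = oddSeq a τ n := by
  simp only [formSeq, oddSeq, ParityForm.eval, partialSum]
  push_cast
  rw [show 2 * ((n : ℝ) + 1) - 1 = 2 * n + 1 by ring]

/-- The 2n-1 sequence is the 2n+1 sequence delayed by one index, so their partial sums differ by a
single boundary term, itself of the same kind. -/
theorem partialSum_formSeq_oddMinus (a : ℕ) (τ : ℕ → ℝ) :
    partialSum (formSeq .oddMinus a τ) = partialSum (oddSeq a τ) - formSeq .oddMinus a τ := by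
  funext n
  rw [Pi.sub_apply]
  induction n with
  | zero => simp [partialSum_zero, formSeq]
  | succ n ih =>
    rw [partialSum_succ, ih, partialSum_succ, formSeq_oddMinus_succ]
    ring

theorem partialSum_mem_innerSpan {w : ℕ} {f : ℕ → ℝ} (hf : f ∈ outerSpan w) :
    partialSum f ∈ innerSpan w := by
  induction hf using Submodule.span_induction with
  | mem f hf =>
    obtain rfl | ⟨l, a, τ, k, ha, h, hk, rfl⟩ := hf
    · exact IsParitySeq.unit.partialSum_mem (Nat.zero_le w)
    · cases l with
      | even =>
        rw [← mixedSeq_eq_formSeq .even .even, mixedSeq_even]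
        exact (IsParitySeq.even a (k + a) h ha rfl).partialSum_mem (by omega)
      | oddPlus =>
        rw [formSeq_oddPlus]
        refine partialSum_mem_of_paritySpan (Submodule.sub_mem _
          ((IsParitySeq.odd a (k + a) h ha rfl).mem_paritySpan (by omega))
          (paritySpan_mono (by omega) (h.mul_mem_paritySpan ha)))
      | oddMinus =>
        rw [partialSum_formSeq_oddMinus]
        exact Submodule.sub_mem _
          ((IsParitySeq.odd a (k + a) h ha rfl).partialSum_mem (by omega))
          (Submodule.subset_span (.inr ⟨_, a, τ, k, h, by omega, rfl⟩))
  | zero => rw [partialSum_zero_fun]; exact Submodule.zero_mem _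
  | add f g _ _ h h' => rw [partialSum_add]; exact Submodule.add_mem _ h h'
  | smul q f _ h => rw [partialSum_smul]; exact Submodule.smul_mem _ _ h

/-- The factors `l_j(n)^{-s_j}`. -/
def formWeight {d : ℕ} (s : Fin d → ℕ) (l : Fin d → ParityForm) (j : Fin d) (n : ℕ) : ℝ :=
  1 / (l j).eval n ^ s j

theorem sum_indicesBelow_mem {w : ℕ} {f : ℕ → ℝ} (hf : f ∈ outerSpan w) (p : Prop) :
    (fun n => ∑ m ∈ indicesBelow p n, f m) ∈ innerSpan w := by
  have h1 := partialSum_mem_innerSpan hf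
  by_cases hp : p
  · simp_rw [indicesBelow_of_true hp]
    exact h1
  · simp_rw [indicesBelow_of_false hp, Finset.sum_range_succ]
    exact Submodule.add_mem _ h1 (outerSpan_le_innerSpan w hf)

/-- Summation leads from `outerSpan` to `innerSpan`, and multiplication by a new factor leads back;
a weak inequality adds just the diagonal term to a strict one. -/
theorem chainSeq_mem_outerSpan {d : ℕ} (s : Fin d → ℕ) (hs : ∀ j, 1 ≤ s j)
    (l : Fin d → ParityForm) (S : Set (Fin d)) :
    chainSeq d (formWeight s l) S ∈ outerSpan (∑ j, s j) := by
  induction d with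
  | zero => exact unitSeq_mem_outerSpan _
  | succ d ih =>
    have h := ih (fun j => s j.succ) (fun j => hs _) (fun j => l j.succ) (Fin.succ ⁻¹' S)
    rw [Fin.sum_univ_succ, add_comm]
    exact mul_mem_outerSpan (sum_indicesBelow_mem h _) (l 0) (hs 0)

theorem sumIn_sq_mul_of_innerSpan {w s : ℕ} {f : ℕ → ℝ} (hf : f ∈ innerSpan w) (l : ParityForm)
    (hs : 3 ≤ s) : SumIn (gaussianSpan (s + w + 2 * l.nu))
      fun n => aperyB n ^ 2 * (1 / l.eval n ^ s * f n) := by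
  induction hf using Submodule.span_induction with
  | mem f hf =>
    obtain rfl | ⟨l', a, τ, k, h, hk, rfl⟩ := hf
    · obtain ⟨q, hq⟩ : ∃ q : ℚ, aperyB 0 ^ 2 * (1 / l.eval 0 ^ s) = q := by
        cases l
        · exact ⟨0, by have : s ≠ 0 := by omega
                       simp [ParityForm.eval, this]⟩
        · exact ⟨1, by simp [ParityForm.eval, aperyB_zero]⟩
        · exact ⟨1 / (-1) ^ s, by simp [ParityForm.eval, aperyB_zero]⟩
      refine (sumIn_single (one_mem_gaussianSpan _) q
        (fun n => aperyB n ^ 2 * (1 / l.eval n ^ s)) hq).congr fun n => by ring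
    · refine SumIn.congr (h.mixedIn l l' (a := s) (b := a) hs (by omega)) fun n => ?_
      rw [mixedSeq, formSeq, mul_assoc (1 / l.eval n ^ s)]
  | zero => exact ⟨by simp, by simp⟩
  | add f g _ _ h h' => exact (h.add h').congr fun n => by simp only [Pi.add_apply]; ring
  | smul q f _ h =>
    exact (h.const_mul q).congr fun n => by simp only [Pi.smul_apply, Rat.smul_def]; ring

theorem sumIn_chainSeq {d : ℕ} (s : Fin (d + 1) → ℕ) (hs : ∀ j, 1 ≤ s j) (hs0 : 3 ≤ s 0)
    (l : Fin (d + 1) → ParityForm) (S : Set (Fin (d + 1))) :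
    SumIn (gaussianSpan (∑ j, s j + 2 * (l 0).nu))
      fun n => aperyB n ^ 2 * chainSeq (d + 1) (formWeight s l) S n := by
  have h := chainSeq_mem_outerSpan (fun j => s j.succ) (fun j => hs _) (fun j => l j.succ)
    (Fin.succ ⁻¹' S)
  have := sumIn_sq_mul_of_innerSpan (sum_indicesBelow_mem h (0 ∈ S)) (l 0) hs0
  rw [Fin.sum_univ_succ]
  exact this

/-! ### Absolute convergence -/

/-- Absolute values are needed because 2n-1 is negative at `n = 0`. -/
theorem sqrtDecay_chainSeq_abs {d : ℕ} (s : Fin d → ℕ) (hs : ∀ j, 1 ≤ s j)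
    (l : Fin d → ParityForm) (S : Set (Fin d)) :
    (∀ n, 0 ≤ chainSeq d (fun j n => |formWeight s l j n|) S n) ∧
      SqrtDecay (chainSeq d (fun j n => |formWeight s l j n|) S) := by
  induction d with
  | zero => exact ⟨IsParitySeq.unit.nonneg, sqrtDecay_unitSeq_real⟩
  | succ d ih =>
    obtain ⟨h, h'⟩ := ih (fun j => s j.succ) (fun j => hs _) (fun j => l j.succ) (Fin.succ ⁻¹' S)
    have h0 : ∀ n, 0 ≤ chainSeq d (fun j n => |formWeight s l j.succ n|) (Fin.succ ⁻¹' S) n := h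
    have hnn : ∀ n, 0 ≤ ∑ m ∈ indicesBelow (0 ∈ S) n,
        chainSeq d (fun j n => |formWeight s l j.succ n|) (Fin.succ ⁻¹' S) m :=
      fun n => Finset.sum_nonneg fun m _ => h0 m
    refine ⟨fun n => mul_nonneg (abs_nonneg _) (hnn n), ?_⟩
    obtain ⟨C, hC, hB⟩ := h'.exists_norm_sum_le
    refine ⟨2 ^ s 0 * C, by positivity, fun n => ?_⟩
    have h1 : (1 : ℝ) ≤ n + 1 := by linarith [n.cast_nonneg (α := ℝ)]
    have h2 : ∑ m ∈ indicesBelow (0 ∈ S) n,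
        chainSeq d (fun j n => |formWeight s l j.succ n|) (Fin.succ ⁻¹' S) m ≤ C * √(n + 1) := by
      refine (Finset.sum_le_sum_of_subset_of_nonneg (t := Finset.range (n + 1)) (fun m hm => ?_)
        (fun m _ _ => h0 m)).trans ((le_abs_self _).trans (by exact_mod_cast hB (n + 1)))
      rw [mem_indicesBelow] at hm
      rw [Finset.mem_range, Nat.lt_succ_iff]
      by_cases hp : 0 ∈ S
      · exact (hm.1 hp).le
      · exact hm.2 hp
    have h3 : |formWeight s l 0 n| ≤ 2 ^ s 0 / ((n : ℝ) + 1) := by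
      refine (abs_inv_eval_pow_le (l 0) (s 0) n).trans ?_
      have := hs 0
      gcongr
      exact le_self_pow₀ h1 (by omega)
    have h4 : 0 < √((n : ℝ) + 1) := by positivity
    rw [chainSeq_succ, norm_mul, Real.norm_eq_abs, abs_abs,
      Real.norm_of_nonneg (hnn n)]
    calc _ ≤ 2 ^ s 0 / ((n : ℝ) + 1) * (C * √(n + 1)) := by
          have := hnn n
          gcongr
      _ = _ := by
        have h5 := Real.sq_sqrt (show 0 ≤ (n : ℝ) + 1 by positivity)
        field_simp
        linear_combination (C) * h5

theorem summable_chainSeq_abs {d : ℕ} (s : Fin (d + 1) → ℕ) (hs : ∀ j, 1 ≤ s j) (hs0 : 3 ≤ s 0)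
    (l : Fin (d + 1) → ParityForm) (S : Set (Fin (d + 1))) :
    Summable fun n => aperyB n ^ 2 * chainSeq (d + 1) (fun j n => |formWeight s l j n|) S n := by
  obtain ⟨h, h'⟩ := sqrtDecay_chainSeq_abs (fun j => s j.succ) (fun j => hs _) (fun j => l j.succ)
    (Fin.succ ⁻¹' S)
  have h0 : ∀ n, 0 ≤ chainSeq d (fun j n => |formWeight s l j.succ n|) (Fin.succ ⁻¹' S) n := h
  obtain ⟨C, hC, hB⟩ := h'.exists_norm_sum_le
  refine summable_aperyB_sq_mul (D := 2 ^ s 0) (C := C) (r := fun n => |formWeight s l 0 n|)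
    (B := fun n => ∑ m ∈ indicesBelow (0 ∈ S) n,
        chainSeq d (fun j n => |formWeight s l j.succ n|) (Fin.succ ⁻¹' S) m)
    (fun n => ?_) (fun n => ?_)
  · rw [abs_abs]
    have := abs_inv_eval_pow_mul_le (l 0) (l 0) (a := s 0) (b := 0) (by omega) n
    simpa [formWeight] using this
  · rw [abs_of_nonneg (Finset.sum_nonneg fun m _ => h0 m)]
    refine (Finset.sum_le_sum_of_subset_of_nonneg (t := Finset.range (n + 1)) (fun m hm => ?_)
      (fun m _ _ => h0 m)).trans ((le_abs_self _).trans (by exact_mod_cast hB (n + 1)))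
    rw [mem_indicesBelow] at hm
    rw [Finset.mem_range, Nat.lt_succ_iff]
    by_cases hp : 0 ∈ S
    · exact (hm.1 hp).le
    · exact hm.2 hp

theorem sum_chainFinset_aperySqTerm {d : ℕ} (s : Fin (d + 1) → ℕ) (l : Fin (d + 1) → ParityForm)
    (S : Set (Fin (d + 1))) (N : ℕ) : ∑ n ∈ chainFinset (d + 1) S N, aperySqTerm s l n =
      aperyB N ^ 2 * chainSeq (d + 1) (formWeight s l) S N := by
  rw [← sum_chainFinset, Finset.mul_sum]
  refine Finset.sum_congr rfl fun n hn => ?_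
  rw [mem_chainFinset, headIndex_succ] at hn
  simp only [aperySqTerm, formWeight, hn.2, one_div, Finset.prod_inv_distrib]
  rw [div_eq_mul_inv]

theorem sum_chainFinset_abs_aperySqTerm {d : ℕ} (s : Fin (d + 1) → ℕ)
    (l : Fin (d + 1) → ParityForm) (S : Set (Fin (d + 1))) (N : ℕ) :
    ∑ n ∈ chainFinset (d + 1) S N, |aperySqTerm s l n| =
      aperyB N ^ 2 * chainSeq (d + 1) (fun j n => |formWeight s l j n|) S N := by
  rw [← sum_chainFinset, Finset.mul_sum]
  refine Finset.sum_congr rfl fun n hn => ?_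
  rw [mem_chainFinset, headIndex_succ] at hn
  simp only [aperySqTerm, formWeight, hn.2, one_div, abs_div, abs_pow, sq_abs, Finset.abs_prod,
    abs_inv, Finset.prod_inv_distrib]
  rw [div_eq_mul_inv]

theorem aperySqSeriesIn_of_sumIn {d : ℕ} (s : Fin (d + 1) → ℕ) (hs : ∀ j, 1 ≤ s j)
    (hs0 : 3 ≤ s 0) (l : Fin (d + 1) → ParityForm) (S : Set (Fin (d + 1))) {V : Submodule ℚ ℂ}
    (h : SumIn V fun n => aperyB n ^ 2 * chainSeq (d + 1) (formWeight s l) S n) :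
    AperySqSeriesIn s l S V := by
  have h1 := hasSum_chainSet S (aperySqTerm s l)
    ((summable_chainSeq_abs s hs hs0 l S).congr fun N =>
      (sum_chainFinset_abs_aperySqTerm s l S N).symm)
  refine ⟨h1.1, ?_⟩
  rw [h1.2]
  simp_rw [sum_chainFinset_aperySqTerm]
  exact h.2

/-! ### The standard pattern under the chain condition -/

/-- The rational span of the standard nested sums of weight `w`. -/
def exactSpan (w : ℕ) : Submodule ℚ (ℕ → ℝ) := Submodule.span ℚ {τ | IsParitySeq w τ}

/-- The rational span of the standard nested sums of weight `w` with first form `2n` and first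
exponent `≥ s`. -/
def evenHeadSpan (s w : ℕ) : Submodule ℚ (ℕ → ℝ) :=
  Submodule.span ℚ {f | ∃ a τ k, s ≤ a ∧ k + a = w ∧ IsParitySeq k τ ∧ f = evenSeq a τ}

/-- The rational span of the standard nested sums of weight `w` with first form `2n + 1` and first
exponent `≥ s`. -/
def oddHeadSpan (s w : ℕ) : Submodule ℚ (ℕ → ℝ) :=
  Submodule.span ℚ {f | ∃ a τ k, s ≤ a ∧ k + a = w ∧ IsParitySeq k τ ∧ f = oddSeq a τ}

theorem evenHeadSpan_le {s w : ℕ} (hs : 1 ≤ s) : evenHeadSpan s w ≤ exactSpan w :=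
  Submodule.span_mono fun _ ⟨a, _, _, ha, hk, h, e⟩ => e ▸ .even a _ h (hs.trans ha) hk.symm

theorem oddHeadSpan_le {s w : ℕ} (hs : 1 ≤ s) : oddHeadSpan s w ≤ exactSpan w :=
  Submodule.span_mono fun _ ⟨a, _, _, ha, hk, h, e⟩ => e ▸ .odd a _ h (hs.trans ha) hk.symm

theorem oddHeadSpan_mono {s s' w : ℕ} (h : s ≤ s') : oddHeadSpan s' w ≤ oddHeadSpan s w :=
  Submodule.span_mono fun _ ⟨a, τ, k, ha, h'⟩ => ⟨a, τ, k, h.trans ha, h'⟩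

theorem evenSeq_mem_evenHeadSpan {s w : ℕ} {f : ℕ → ℝ} (hf : f ∈ exactSpan w) :
    evenSeq s f ∈ evenHeadSpan s (w + s) := by
  induction hf using Submodule.span_induction with
  | mem f h => exact Submodule.subset_span ⟨s, f, w, le_rfl, rfl, h, rfl⟩
  | zero =>
    convert (evenHeadSpan s (w + s)).zero_mem using 1
    funext n
    simp [evenSeq]
  | add f g _ _ h h' =>
    convert (evenHeadSpan s (w + s)).add_mem h h' using 1
    funext n
    simp [evenSeq, Finset.sum_add_distrib, mul_add]
  | smul q f _ h =>
    convert (evenHeadSpan s (w + s)).smul_mem q h using 1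
    funext n
    simp only [evenSeq, Pi.smul_apply, Rat.smul_def, ← Finset.mul_sum]
    ring

theorem oddSeq_mem_oddHeadSpan {s w : ℕ} {f : ℕ → ℝ} (hf : f ∈ exactSpan w) :
    oddSeq s f ∈ oddHeadSpan s (w + s) := by
  induction hf using Submodule.span_induction with
  | mem f h => exact Submodule.subset_span ⟨s, f, w, le_rfl, rfl, h, rfl⟩
  | zero =>
    convert (oddHeadSpan s (w + s)).zero_mem using 1
    funext n
    simp [oddSeq]
  | add f g _ _ h h' =>
    convert (oddHeadSpan s (w + s)).add_mem h h' using 1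
    funext n
    simp [oddSeq, Finset.sum_add_distrib, mul_add]
  | smul q f _ h =>
    convert (oddHeadSpan s (w + s)).smul_mem q h using 1
    funext n
    simp only [oddSeq, Pi.smul_apply, Rat.smul_def, ← Finset.mul_sum]
    ring

theorem mul_mem_oddHeadSpan {s w : ℕ} {f : ℕ → ℝ} (hf : f ∈ oddHeadSpan 1 w) :
    (fun n : ℕ => 1 / (2 * (n : ℝ) + 1) ^ s * f n) ∈ oddHeadSpan s (w + s) := by
  induction hf using Submodule.span_induction with
  | mem f h =>
    obtain ⟨a, τ, k, ha, hk, h, rfl⟩ := h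
    refine Submodule.subset_span ⟨s + a, τ, k, by omega, by omega, h, ?_⟩
    funext n
    simp only [oddSeq, pow_add]
    field_simp
  | zero =>
    convert (oddHeadSpan s (w + s)).zero_mem using 1
    funext n
    simp
  | add f g _ _ h h' =>
    convert (oddHeadSpan s (w + s)).add_mem h h' using 1
    funext n
    simp [mul_add]
  | smul q f _ h =>
    convert (oddHeadSpan s (w + s)).smul_mem q h using 1
    funext n
    simp only [Pi.smul_apply, Rat.smul_def]
    ring

/-- Undoing the shift inside the sum removes only the term at n, whose odd denominator merges with
the new one; no partial fractions occur and the weight is exact. -/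
theorem oddSeq_mem_of_shift {s w : ℕ} {f : ℕ → ℝ} (h0 : f 0 = 0)
    (hf : (fun n => f (n + 1)) ∈ oddHeadSpan 1 w) : oddSeq s f ∈ oddHeadSpan s (w + s) := by
  have h1 := oddSeq_mem_oddHeadSpan (s := s) (oddHeadSpan_le le_rfl hf)
  convert Submodule.sub_mem _ h1 (mul_mem_oddHeadSpan (s := s) hf) using 1
  funext n
  rw [Pi.sub_apply, oddSeq, Finset.sum_range_succ', h0, oddSeq, Finset.sum_range_succ]
  ring

/-- A head 2n-1 becomes a head 2n+1 after a shift, so it is carried along in shifted form until the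
next factor. An odd factor absorbs the shift. An even factor would not, and the chain condition
excludes it. The last three claims keep the lower bound on the leading exponent that the convergence
of the full series requires. -/
theorem chainSeq_standard_tail {d : ℕ} (s : Fin d → ℕ) (hs : ∀ j, 1 ≤ s j)
    (l : Fin d → ParityForm) (hl : ChainCondition l) :
    ((∀ h : 0 < d, l ⟨0, h⟩ ≠ .oddMinus) →
      chainSeq d (formWeight s l) (standardStrict l) ∈ exactSpan (∑ j, s j)) ∧
    ((∃ h : 0 < d, l ⟨0, h⟩ = .oddMinus) →
      chainSeq d (formWeight s l) (standardStrict l) 0 = 0 ∧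
      (fun n => chainSeq d (formWeight s l) (standardStrict l) (n + 1)) ∈
        oddHeadSpan 1 (∑ j, s j)) ∧
    (∀ h : 0 < d, l ⟨0, h⟩ = .even → chainSeq d (formWeight s l) (standardStrict l) ∈
        evenHeadSpan (s ⟨0, h⟩) (∑ j, s j)) ∧
    (∀ h : 0 < d, l ⟨0, h⟩ = .oddPlus → chainSeq d (formWeight s l) (standardStrict l) ∈
        oddHeadSpan (s ⟨0, h⟩) (∑ j, s j)) ∧
    (∀ h : 0 < d, l ⟨0, h⟩ = .oddMinus →
      (fun n => chainSeq d (formWeight s l) (standardStrict l) (n + 1)) ∈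
        oddHeadSpan (s ⟨0, h⟩) (∑ j, s j)) := by
  induction d with
  | zero =>
    refine ⟨fun _ => Submodule.subset_span ?_, fun ⟨h, _⟩ => absurd h (lt_irrefl 0),
      fun h => absurd h (lt_irrefl 0), fun h => absurd h (lt_irrefl 0),
      fun h => absurd h (lt_irrefl 0)⟩
    exact IsParitySeq.unit
  | succ d ih =>
    set s' : Fin d → ℕ := fun j => s j.succ with hs'
    set l' : Fin d → ParityForm := fun j => l j.succ with hl'
    set g := chainSeq d (formWeight s' l') (standardStrict l') with hg
    have hchain : ChainCondition l' := fun j k hjk => hl j.succ k.succ (by simp [hjk])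
    obtain ⟨ih1, ih2, -, -, -⟩ := ih s' (fun j => hs _) l' hchain
    have hW : ∑ j, s j = (∑ j, s' j) + s 0 := by rw [Fin.sum_univ_succ, add_comm]
    have hodd : oddSeq (s 0) g ∈ oddHeadSpan (s 0) (∑ j, s j) := by
      rw [hW]
      by_cases h : ∃ h : 0 < d, l' ⟨0, h⟩ = .oddMinus
      · exact oddSeq_mem_of_shift (ih2 h).1 (ih2 h).2
      · push Not at h
        exact oddSeq_mem_oddHeadSpan (ih1 h)
    have e : ∀ n, chainSeq (d + 1) (formWeight s l) (standardStrict l) n = formWeight s l 0 n *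
        ∑ m ∈ indicesBelow (l 0 ≠ .oddPlus) n, g m := fun n => rfl
    have h3 : l 0 = .even → chainSeq (d + 1) (formWeight s l) (standardStrict l) ∈
        evenHeadSpan (s 0) (∑ j, s j) := by
      intro h0
      -- The chain condition enters here: below an even head the tail cannot start with 2n-1.
      have hg' : g ∈ exactSpan (∑ j, s' j) := ih1 fun h hm =>
        hl 0 (Fin.succ ⟨0, h⟩) (by simp) hm h0
      rw [hW]
      convert evenSeq_mem_evenHeadSpan (s := s 0) hg' using 1
      funext n
      rw [e, indicesBelow_of_true (by simp [h0]), evenSeq, formWeight, h0]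
      rfl
    have h4 : l 0 = .oddPlus → chainSeq (d + 1) (formWeight s l) (standardStrict l) ∈
        oddHeadSpan (s 0) (∑ j, s j) := by
      intro h0
      convert hodd using 1
      funext n
      rw [e, indicesBelow_of_false (by simp [h0]), oddSeq, formWeight, h0]
      rfl
    have h5 : l 0 = .oddMinus →
        (fun n => chainSeq (d + 1) (formWeight s l) (standardStrict l) (n + 1)) ∈
        oddHeadSpan (s 0) (∑ j, s j) := by
      intro h0
      convert hodd using 1
      funext n
      rw [e, indicesBelow_of_true (by simp [h0]), oddSeq, formWeight, h0, ParityForm.eval]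
      push_cast
      rw [show 2 * ((n : ℝ) + 1) - 1 = 2 * n + 1 by ring]
    refine ⟨fun h => ?_, fun ⟨h, h0⟩ => ⟨?_, oddHeadSpan_mono (hs 0) (h5 h0)⟩,
      fun _ => h3, fun _ => h4, fun _ => h5⟩
    · have h' : l 0 ≠ .oddMinus := h (Nat.succ_pos d)
      cases h0 : l 0 with
      | even => exact evenHeadSpan_le (hs 0) (h3 h0)
      | oddPlus => exact oddHeadSpan_le (hs 0) (h4 h0)
      | oddMinus => exact absurd h0 h'
    · rw [e, indicesBelow_of_true (by
        have : l 0 = .oddMinus := h0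
        simp [this])]
      simp

theorem sumIn_of_span {V : Submodule ℚ ℂ} {A : Set (ℕ → ℝ)} {r : ℕ → ℝ}
    (h : ∀ f ∈ A, SumIn V fun n => r n * f n) {f : ℕ → ℝ} (hf : f ∈ Submodule.span ℚ A) :
    SumIn V fun n => r n * f n := by
  induction hf using Submodule.span_induction with
  | mem f hf => exact h f hf
  | zero => exact ⟨by simp, by simp⟩
  | add f g _ _ h h' => exact (h.add h').congr fun n => by simp only [Pi.add_apply]; ring
  | smul q f _ h =>
    exact (h.const_mul q).congr fun n => by simp only [Pi.smul_apply, Rat.smul_def]; ring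

theorem aperySqSeriesIn_standard {d : ℕ} (s : Fin (d + 1) → ℕ) (hs : ∀ j, 1 ≤ s j)
    (hs0 : 3 ≤ s 0) (l : Fin (d + 1) → ParityForm) (hl : ChainCondition l)
    (h0 : l 0 ≠ .oddMinus) : AperySqSeriesIn s l (standardStrict l) (CMZV 4 (∑ j, s j)) := by
  refine aperySqSeriesIn_of_sumIn s hs hs0 l _ ?_
  obtain ⟨-, -, h3, h4, -⟩ := chainSeq_standard_tail s hs l hl
  cases hl0 : l 0 with
  | even =>
    refine sumIn_of_span (fun f hf => ?_) (h3 (Nat.succ_pos d) hl0)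
    obtain ⟨a, τ, k, ha, hk, h, rfl⟩ := hf
    rw [← hk]
    exact sumIn_evenSeq h (hs0.trans ha)
  | oddPlus =>
    refine sumIn_of_span (fun f hf => ?_) (h4 (Nat.succ_pos d) hl0)
    obtain ⟨a, τ, k, ha, hk, h, rfl⟩ := hf
    rw [← hk]
    exact sumIn_oddSeq h (hs0.trans ha)
  | oddMinus => exact absurd hl0 h0

/-- The term at 0 vanishes, and after the shift b_{n+1}² = (1 + 1/(2n+1))² b_n² produces the three
consecutive weights. -/
theorem aperySqSeriesIn_standard_oddMinus {d : ℕ} (s : Fin (d + 1) → ℕ) (hs : ∀ j, 1 ≤ s j)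
    (hs0 : 3 ≤ s 0) (l : Fin (d + 1) → ParityForm) (hl : ChainCondition l)
    (h0 : l 0 = .oddMinus) : AperySqSeriesIn s l (standardStrict l)
      (CMZV 4 (∑ j, s j) ⊔ CMZV 4 ((∑ j, s j) + 1) ⊔ CMZV 4 ((∑ j, s j) + 2) :
        Submodule ℚ ℂ) := by
  refine aperySqSeriesIn_of_sumIn s hs hs0 l _ ?_
  obtain ⟨-, h2, -, -, h5⟩ := chainSeq_standard_tail s hs l hl
  refine SumIn.of_succ ?_ ?_
  · refine sumIn_of_span (r := fun n => aperyB (n + 1) ^ 2) (fun f hf => ?_)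
      (h5 (Nat.succ_pos d) h0)
    obtain ⟨a, τ, k, ha, hk, h, rfl⟩ := hf
    have ha' : 3 ≤ a := hs0.trans ha
    rw [← hk]
    exact sumIn_succ_sq_mul_oddSeq
      ((sumIn_oddSeq h ha').mono (le_sup_left.trans le_sup_left))
      ((sumIn_oddSeq h (s := a + 1) (by omega)).mono (le_sup_right.trans le_sup_left))
      ((sumIn_oddSeq h (s := a + 2) (by omega)).mono le_sup_right)
  · rw [(h2 ⟨Nat.succ_pos d, h0⟩).1]
    simp

end

theorem mainTheorem3 {d : ℕ} [NeZero d] (s : Fin d → ℕ) (hs : ∀ j, 1 ≤ s j) (hs0 : 3 ≤ s 0)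
    (l : Fin d → ParityForm) :
    (l 0 ≠ ParityForm.oddMinus → ChainCondition l →
      AperySqSeriesIn s l (standardStrict l) (CMZV 4 (∑ j, s j))) ∧
    (l 0 ≠ ParityForm.oddMinus → (∀ j, l j ≠ ParityForm.even) →
      AperySqSeriesIn s l (standardStrict l) (CMZV 4 (∑ j, s j))) ∧
    (l 0 = ParityForm.oddMinus → ChainCondition l →
      AperySqSeriesIn s l (standardStrict l)
        (CMZV 4 (∑ j, s j) ⊔ CMZV 4 ((∑ j, s j) + 1) ⊔ CMZV 4 ((∑ j, s j) + 2) :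
          Submodule ℚ ℂ)) ∧
    AperySqSeriesIn s l (standardStrict l) (CMZVleGaussian 4 ((∑ j, s j) + 2 * (l 0).nu)) ∧
    (∀ S : Set (Fin d), SeriesDefined l S →
      AperySqSeriesIn s l S (CMZVleGaussian 4 ((∑ j, s j) + 2 * (l 0).nu))) := by
  obtain _ | d := d
  · exact absurd rfl (NeZero.ne 0)
  have hall : ∀ S, AperySqSeriesIn s l S (CMZVleGaussian 4 ((∑ j, s j) + 2 * (l 0).nu)) :=
    fun S => aperySqSeriesIn_of_sumIn s hs hs0 l S (sumIn_chainSeq s hs hs0 l S)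
  exact ⟨fun h0 hl => aperySqSeriesIn_standard s hs hs0 l hl h0,
    fun h0 hl => aperySqSeriesIn_standard s hs hs0 l (fun j _ _ _ => hl j) h0,
    fun h0 hl => aperySqSeriesIn_standard_oddMinus s hs hs0 l hl h0,
    hall _, fun S _ => hall S⟩
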